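/- Let $d\ge 1$. For a function $g=g(x,v)$ on $\mathbb R^d\times\mathbb R^d$ write $\langle g\rangle(x)=\int_{\mathbb R^d} g(x,v)\,dv$. Let $G=G(x,v)\in\mathbb R^d$ be a smooth vector field and let $M=M(x,v)\ge 0$ be measurable with $\int M(x,v)\,dv=1$ for every $x$. Consider $$\partial_t f = Af:=-v\cdot\nabla_x f-\nabla_v\cdot(Gf)+Lf ,$$ where either (Fokker–Planck) $Lf=\nabla_v\cdot\big(M\nabla_v(f/M)\big)$, in which case $M$ is assumed positive and $C^2$, or (BGK) $Lf=\langle f\rangle M-f$. **Hypothesis 1 (stationary state).** There is $f_\infty=f_\infty(x,v)>0$, of class $C^1$ (of class $C^2$ for Fokker–Planck), with $\langle f_\infty\rangle$ finite and of class $C^1$, such that $v\cdot\nabla_x f_\infty+\nabla_v\cdot(Gf_\infty)=Lf_\infty$, $\iint f_\infty\,dx\,dv=1$ and $f_\infty(x,v)\ge c_\infty\langle f_\infty\rangle(x)$ for all $x$ and $|v|\le 1$, where $c_\infty>0$. Moreover, for a constant $c_M$: for Fokker–Planck $|\nabla_vM|/M\le c_M$ for all $x$ and $|v|\le 1$; for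 BGK $\int_{|v|\le 1}M^2\,\frac{\langle f_\infty\rangle}{f_\infty}\,dv\le c_M$ for all $x$. **Hypothesis 2 (local coercivity).** There is $\lambda_1>0$ such that for all $x$ and all test functions $g=g(v)\in C_c^\infty(\mathbb R^d)$, the quantity $\int\big|g-\langle g\rangle\frac{f_\infty}{\langle f_\infty\rangle}\big|^2\frac{dv}{f_\infty}$ is bounded for Fokker–Planck by $\lambda_1\int\big|\nabla_v\big(\frac{g}{f_\infty}\big)\big|^2f_\infty\,dv$, and for BGK by $\frac{\lambda_1}{2}\iint\Big(\frac{g(v)}{f_\infty(x,v)}-\frac{g(v_*)}{f_\infty(x,v_*)}\Big)^2f_\infty(x,v)M(x,v_*)\,dv\,dv_*$. **Hypothesis 3W (weak spatial coercivity).** Let $$w(x)=1+\frac{\int_{|v|\le1}f_\infty|G|^2\,dv}{\langle f_\infty\rangle}+\Big(\int_{|v|\le1}\Big|\nabla_x\Big(\frac{f_\infty}{\langle f_\infty\rangle}\Big)\Big|dv\Big)^2+\Big|\frac{\nabla_x\langle f_\infty\rangle}{\langle f_\infty\rangle}\Big|^2 .$$ There are $T>0$, $k>\ell>0$ and $\lambda_2>0$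 such that for every $g=g(t,x)$ on $[0,T]\times\mathbb R^d$ with $\int_{[0,T]\times\mathbb R^d}|g|^2(1+|x|^2)^\ell\frac{dt\,dx}{\langle f_\infty\rangle}<\infty$ and $\int_{[0,T]\times\mathbb R^d}g\,dt\,dx=0$ there is a weakly differentiable vector field $\vec F:[0,T]\times\mathbb R^d\to\mathbb R^{1+d}$ with $\nabla_{t,x}\cdot\vec F=g$, with $\vec F(0,\cdot)=\vec F(T,\cdot)=0$ in the sense of traces, and $$\int_{[0,T]\times\mathbb R^d}\big[|\vec F|^2w+|\nabla_{t,x}\vec F|^2\big]\frac{dt\,dx}{\langle f_\infty\rangle}\le\lambda_2\int_{[0,T]\times\mathbb R^d}|g|^2(1+|x|^2)^\ell\frac{dt\,dx}{\langle f_\infty\rangle}.$$ Let $\|g\|^2=\iint|g|^2\frac{dx\,dv}{f_\infty}$ be the norm of the weighted space $L^2(dx\,dv/f_\infty)$. A solution with initial data $f_{\mathrm{in}}$ is a mild solution in this space of $\partial_tf=\bar Af$, $f(0)=f_{\mathrm{in}}$, where $\bar A$ is the closure of $A$ on $C_c^\infty(\mathbb R^{2d})$: that is, $f:[0,\infty)\to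 L^2(dx\,dv/f_\infty)$ is continuous and $\int_0^tf\,ds\in D(\bar A)$, $f(t)=f_{\mathrm{in}}+\bar A\int_0^tf\,ds$ for all $t\ge0$. **Theorem (polynomial decay).** Assume Hypotheses 1, 2 and 3W, and let $f$ be a solution with zero mass $\iint f_{\mathrm{in}}\,dx\,dv=0$ and with a uniform moment bound on its spatial density, $$\sup_{t\ge0}\int_{\mathbb R^d}\langle f(t)\rangle^2(1+|x|^2)^k\frac{dx}{\langle f_\infty\rangle}\le C_k,\qquad C_k>0.$$ Then for all $t\ge0$ $$\|f(t)\|\le\frac{C}{(1+t)^{k/(2\ell)}}\,\|f_{\mathrm{in}}\| ,$$ where the constant $C>0$ depends only on $d$, the type of the collision operator, $c_\infty,c_M,\lambda_1,\lambda_2,T,k,\ell$, on $C_k$ and on the size $\|f_{\mathrm{in}}\|$ of the data. -/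

import Mathlib

open MeasureTheory

namespace Kinetic

noncomputable section

/-- The Euclidean space of positions, or of velocities. -/
abbrev E (d : ℕ) : Type := EuclideanSpace ℝ (Fin d)

/-- The two collision operators: Fokker-Planck and BGK. -/
inductive Collision where
  | FP : Collision
  | BGK : Collision

/-- The divergence of a vector field on Euclidean space. -/
def divergence {d : ℕ} (V : E d → E d) (v : E d) : ℝ :=
  ∑ i : Fin d, (fderiv ℝ V v (EuclideanSpace.single i 1)) i

/-- The spatial density `⟨g⟩(x) = ∫ g(x,v) dv`. -/
def density {d : ℕ} (g : E d → E d → ℝ) (x : E d) : ℝ := ∫ v, g x v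

/-- The collision operator: `∇_v · (M ∇_v (g / M))` for Fokker-Planck, `⟨g⟩ M - g` for BGK. -/
def collision {d : ℕ} (c : Collision) (M g : E d → E d → ℝ) (x v : E d) : ℝ :=
  match c with
  | Collision.FP => divergence (fun u => M x u • gradient (fun u' => g x u' / M x u') u) v
  | Collision.BGK => density g x * M x v - g x v

/-- The transport operator `v · ∇_x g + ∇_v · (G g)`. -/
def transport {d : ℕ} (G : E d → E d → E d) (g : E d → E d → ℝ) (x v : E d) : ℝ :=
  inner ℝ v (gradient (fun y => g y v) x) + divergence (fun u => g x u • G x u) v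

/-- The right-hand side `A g = - v · ∇_x g - ∇_v · (G g) + L g` of the evolution equation. -/
def generator {d : ℕ} (c : Collision) (G : E d → E d → E d) (M g : E d → E d → ℝ)
    (x v : E d) : ℝ :=
  - transport G g x v + collision c M g x v

/-- The force field is smooth and `M(x, ·)` is a probability density for every `x`.
In the Fokker-Planck case `M` is positive and twice continuously differentiable, so that the
collision operator makes sense. -/
structure Model {d : ℕ} (c : Collision) (G : E d → E d → E d) (M : E d → E d → ℝ) : Prop where
  smooth_force : ContDiff ℝ (⊤ : ℕ∞) (fun p : E d × E d => G p.1 p.2)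
  measurable : Measurable (fun p : E d × E d => M p.1 p.2)
  nonneg : ∀ x v, 0 ≤ M x v
  integrable : ∀ x, Integrable (fun v => M x v)
  mass : ∀ x, ∫ v, M x v = 1
  fp_regular : c = Collision.FP →
    ContDiff ℝ 2 (fun p : E d × E d => M p.1 p.2) ∧ ∀ x v, 0 < M x v

/-- `fSt` is a normalised stationary state with the bounds on `|v| ≤ 1`.  The constant `cM` is
the bound on `|∇_v M| / M` for Fokker-Planck, and on `∫_{|v| ≤ 1} M² ⟨fSt⟩ / fSt dv` for BGK. -/
structure StationaryState {d : ℕ} (c : Collision) (G : E d → E d → E d)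
    (M fSt : E d → E d → ℝ) (cInf cM : ℝ) : Prop where
  pos : ∀ x v, 0 < fSt x v
  regular : ContDiff ℝ 1 (fun p : E d × E d => fSt p.1 p.2)
  fp_regular : c = Collision.FP → ContDiff ℝ 2 (fun p : E d × E d => fSt p.1 p.2)
  integrable_velocity : ∀ x, Integrable (fun v => fSt x v)
  density_regular : ContDiff ℝ 1 (density fSt)
  stationary : ∀ x v, transport G fSt x v = collision c M fSt x v
  integrable : Integrable (fun p : E d × E d => fSt p.1 p.2)
  mass : ∫ p : E d × E d, fSt p.1 p.2 = 1
  lower_bound : ∀ x v, ‖v‖ ≤ 1 → cInf ≤ fSt x v / density fSt x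
  fp_bound : c = Collision.FP →
    ∀ x v, ‖v‖ ≤ 1 → ‖gradient (fun u => M x u) v‖ / M x v ≤ cM
  bgk_bound : c = Collision.BGK →
    ∀ x, ∫⁻ v in Metric.closedBall (0 : E d) 1,
      ENNReal.ofReal (M x v ^ 2 * (density fSt x / fSt x v)) ≤ ENNReal.ofReal cM

/-- Local coercivity with constant `lam1`.  It is only required for test functions `g = g(v)`,
for which both sides are finite. -/
def LocalCoercivity {d : ℕ} (c : Collision) (M fSt : E d → E d → ℝ) (lam1 : ℝ) : Prop :=
  ∀ (x : E d) (g : E d → ℝ), ContDiff ℝ (⊤ : ℕ∞) g → HasCompactSupport g →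
    ∫⁻ v, ENNReal.ofReal ((g v - (∫ u, g u) * (fSt x v / density fSt x)) ^ 2 / fSt x v) ≤
    match c with
    | Collision.FP =>
      ENNReal.ofReal lam1 *
        ∫⁻ v, ENNReal.ofReal (‖gradient (fun u => g u / fSt x u) v‖ ^ 2 * fSt x v)
    | Collision.BGK =>
      ENNReal.ofReal (lam1 / 2) *
        ∫⁻ v, ∫⁻ v', ENNReal.ofReal
          ((g v / fSt x v - g v' / fSt x v') ^ 2 * (fSt x v * M x v'))

/-- The spatial weight `w`. -/
def weight {d : ℕ} (G : E d → E d → E d) (fSt : E d → E d → ℝ) (x : E d) : ℝ :=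
  1 + (∫ v in Metric.closedBall (0 : E d) 1, fSt x v * ‖G x v‖ ^ 2) / density fSt x
    + (∫ v in Metric.closedBall (0 : E d) 1,
        ‖gradient (fun y => fSt y v / density fSt y) x‖) ^ 2
    + (‖gradient (density fSt) x‖ / density fSt x) ^ 2

/-- The slab `[0,T] × ℝ^d` of time and space. -/
def slab (d : ℕ) (T : ℝ) : Set (ℝ × E d) := Set.Icc 0 T ×ˢ Set.univ

/-- The coordinate directions of time and space; the index `0` is time. -/
def direction {d : ℕ} (j : Fin (d + 1)) : ℝ × E d :=
  Fin.cases (1, 0) (fun i => (0, EuclideanSpace.single i 1)) j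

/-- `DF i j` is the weak derivative `∂_j F_i` on the slab and the trace of `F` vanishes at
`t = 0` and at `t = T`: since the test functions need not vanish there, integration by parts
without boundary terms expresses both. -/
def HasWeakGradientZeroTrace {d : ℕ} (T : ℝ) (F : Fin (d + 1) → ℝ × E d → ℝ)
    (DF : Fin (d + 1) → Fin (d + 1) → ℝ × E d → ℝ) : Prop :=
  ∀ (i j : Fin (d + 1)) (φ : ℝ × E d → ℝ), ContDiff ℝ (⊤ : ℕ∞) φ → HasCompactSupport φ →
    ∫ p in slab d T, F i p * fderiv ℝ φ p (direction j) =
      - ∫ p in slab d T, DF i j p * φ p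

/-- Weak spatial coercivity: for every `g = g(t,x)` of mean zero for which the right-hand side
is finite, `div F = g` has a solution vanishing at `t = 0, T` with
`∫ (|F|² w + |∇F|²) / ⟨fSt⟩ ≤ lam2 ∫ |g|² (1 + |x|²)^ℓ / ⟨fSt⟩`. -/
def WeakSpatialCoercivity {d : ℕ} (G : E d → E d → E d) (fSt : E d → E d → ℝ)
    (T ℓ lam2 : ℝ) : Prop :=
  ∀ g : ℝ × E d → ℝ, Measurable g →
    ∫⁻ p in slab d T,
      ENNReal.ofReal (g p ^ 2 * (1 + ‖p.2‖ ^ 2) ^ ℓ / density fSt p.2) < ⊤ →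
    ∫ p in slab d T, g p = 0 →
    ∃ (F : Fin (d + 1) → ℝ × E d → ℝ) (DF : Fin (d + 1) → Fin (d + 1) → ℝ × E d → ℝ),
      (∀ i, Measurable (F i)) ∧ (∀ i j, Measurable (DF i j)) ∧
      HasWeakGradientZeroTrace T F DF ∧
      (∀ᵐ p ∂(volume.restrict (slab d T)), ∑ i, DF i i p = g p) ∧
      ∫⁻ p in slab d T, ENNReal.ofReal
          (((∑ i, F i p ^ 2) * weight G fSt p.2 + ∑ i, ∑ j, DF i j p ^ 2) / density fSt p.2)
        ≤ ENNReal.ofReal lam2 *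
          ∫⁻ p in slab d T,
            ENNReal.ofReal (g p ^ 2 * (1 + ‖p.2‖ ^ 2) ^ ℓ / density fSt p.2)

/-- The measure `dx dv / fSt` on phase space. -/
def weightedMeasure {d : ℕ} (fSt : E d → E d → ℝ) : Measure (E d × E d) :=
  (volume : Measure (E d × E d)).withDensity (fun p => ENNReal.ofReal (fSt p.1 p.2)⁻¹)

/-- The weighted space `L²(dx dv / fSt)` with its norm. -/
abbrev WL2 {d : ℕ} (fSt : E d → E d → ℝ) : Type := Lp ℝ 2 (weightedMeasure fSt)

/-- The graph in `L²(dx dv / fSt)` of the operator `A` on smooth compactly supported functions. -/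
def generatorGraph {d : ℕ} (c : Collision) (G : E d → E d → E d) (M fSt : E d → E d → ℝ) :
    Set (WL2 fSt × WL2 fSt) :=
  {p | ∃ φ : E d → E d → ℝ,
    ContDiff ℝ (⊤ : ℕ∞) (Function.uncurry φ) ∧ HasCompactSupport (Function.uncurry φ) ∧
    p.1 =ᵐ[weightedMeasure fSt] Function.uncurry φ ∧
    p.2 =ᵐ[weightedMeasure fSt] Function.uncurry (generator c G M φ)}

/-- `f` is a (mild) solution of `∂_t f = A f` in `L²(dx dv / fSt)` for `t ≥ 0`, where `A` is the
closure of the operator on smooth compactly supported functions: `f` is continuous,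
`∫_0^t f ds` is in the domain, and `f(t) = f(0) + A ∫_0^t f ds`.  The orbits of the semigroup
generated by this closure are solutions in this sense. -/
def IsSolution {d : ℕ} (c : Collision) (G : E d → E d → E d) (M fSt : E d → E d → ℝ)
    (f : ℝ → WL2 fSt) : Prop :=
  ContinuousOn f (Set.Ici 0) ∧
  ∀ t : ℝ, 0 ≤ t →
    ((∫ s in (0 : ℝ)..t, f s), f t - f 0) ∈ closure (generatorGraph c G M fSt)

/-- The `k`-th spatial moment `∫ ⟨f⟩² (1 + |x|²)^k dx / ⟨fSt⟩`. -/
def spatialMoment {d : ℕ} (fSt : E d → E d → ℝ) (k : ℝ) (f : WL2 fSt) : ENNReal :=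
  ∫⁻ x : E d, ENNReal.ofReal
    (density (fun x v => f (x, v)) x ^ 2 * (1 + ‖x‖ ^ 2) ^ k / density fSt x)

end

end Kinetic

/-! The energy `‖f‖²` is dissipated only in the velocity variable. Write `f = u fSt + micro f` with
`u = ⟨f⟩/⟨fSt⟩` (`localDensity`); this is an orthogonal decomposition in `L²(dx dv / fSt)`.
Stationarity of `fSt` turns the transport term of `-⟨A f, f⟩` into exactly the quantity that
completes the collision term to the quadratic form of the local coercivity hypothesis. This yields
`‖f(t)‖² + (2/lam1) ∫ ‖micro f‖² ≤ ‖f(s)‖²`, the integral running over `[s,t]`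
(`norm_micro_sq_le_of_mem_graph`, `energy_inequality`). It says nothing about `u`.

Control of `u` comes from testing the equation against `χ(v) (1,v) · Z(t,x)`, where `χ` cuts off to
`|v| ≤ 1`. By stationarity again, the local equilibrium `u fSt` contributes `∫ u div(B Z)` to the
weak form, where the divergence is taken in time and space and `B(x) = ∫ χ (1,v) ⊗ (1,v) fSt dv`
(`integral_mul_vectorAdjoint`). The lower bound on `fSt` makes `B` at least a multiple of `⟨fSt⟩`,
so `Z = B⁻¹ Φ` realises any regular compactly supported field `Φ`. The weight `w` is what bounds the
derivatives of `Z` and the force term. Since the remaining part of `f` is `micro f`, the integral of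
`u div Φ` is bounded by the dissipation and a weighted first order energy of `Φ`
(`exists_divergence_estimate`).

Weak spatial coercivity provides a field with divergence `⟨fSt⟩ (u - b) (1+|x|²)^(-ℓ)`, the constant
`b` being chosen so that this source has mean zero. That field is only weakly differentiable; its
zero traces allow extension by zero, and truncation and mollification make it regular at the price
of a time window longer at both ends (`exists_smooth_field`). The outcome is that the weighted
square of `u - b` is bounded by the dissipation (`exists_deviation_estimate`).

The weight `(1+|x|²)^(-ℓ)` degenerates at infinity, and the moment bound repairs this. As `u` has
mean zero, `∫ u² = ∫ u (u - b)`; Cauchy-Schwarz with the weights `(1+|x|²)^(±ℓ/2)` and Hölder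
against the moment of order `k` give a bound on `(∫ u²)^(1+ℓ/k)` (`interpolation`). With the
monotonicity of `e = ‖f‖²` this becomes `e(τ+3T)^(1+ℓ/k) ≤ K (e(τ) - e(τ+3T))`
(`exists_energy_recursion`). It is a discrete form of `e' ≤ -c e^(1+ℓ/k)`, so `e` decays like
`t^(-k/ℓ)` (`le_rpow_of_recursion`) and the norm at half that rate. -/

namespace Kinetic

noncomputable section

/-! ### Differential calculus on phase space and integration by parts -/

section Calculus

variable {d : ℕ}

theorem inner_gradient_left {F : Type*} [NormedAddCommGroup F] [InnerProductSpace ℝ F]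
    [CompleteSpace F] (a : F → ℝ) (v w : F) :
    inner ℝ (gradient a v) w = fderiv ℝ a v w := by
  simp [gradient]

theorem inner_gradient_right {F : Type*} [NormedAddCommGroup F] [InnerProductSpace ℝ F]
    [CompleteSpace F] (a : F → ℝ) (v w : F) :
    inner ℝ w (gradient a v) = fderiv ℝ a v w := by
  rw [real_inner_comm, inner_gradient_left]

theorem norm_gradient {F : Type*} [NormedAddCommGroup F] [InnerProductSpace ℝ F]
    [CompleteSpace F] (a : F → ℝ) (v : F) : ‖gradient a v‖ = ‖fderiv ℝ a v‖ := by
  simp [gradient]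

theorem map_eq_sum_single (L : E d →L[ℝ] ℝ) (w : E d) :
    L w = ∑ i, w i * L (EuclideanSpace.single i 1) := by
  conv_lhs => rw [← (EuclideanSpace.basisFun (Fin d) ℝ).sum_repr w]
  simp [map_sum]

theorem divergence_smul {φ : E d → ℝ} {V : E d → E d} {v : E d}
    (hφ : DifferentiableAt ℝ φ v) (hV : DifferentiableAt ℝ V v) :
    divergence (fun u => φ u • V u) v = φ v * divergence V v + fderiv ℝ φ v (V v) := by
  unfold divergence
  rw [map_eq_sum_single (fderiv ℝ φ v) (V v), Finset.mul_sum, ← Finset.sum_add_distrib]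
  refine Finset.sum_congr rfl fun i _ => ?_
  rw [fderiv_fun_smul hφ hV]
  simp [mul_comm]

theorem fderiv_component {V : E d → E d} {v : E d} (hV : DifferentiableAt ℝ V v) (i : Fin d)
    (w : E d) : fderiv ℝ (fun u => V u i) v w = (fderiv ℝ V v w) i := by
  have := (EuclideanSpace.proj (𝕜 := ℝ) i).hasFDerivAt.comp v hV.hasFDerivAt
  have h2 : HasFDerivAt (fun u => V u i)
    ((EuclideanSpace.proj (𝕜 := ℝ) i).comp (fderiv ℝ V v)) v := this
  rw [h2.fderiv]
  simp

theorem continuous_divergence {V : E d → E d} (hV : ContDiff ℝ 1 V) :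
    Continuous (divergence V) := by
  unfold divergence
  have h := hV.continuous_fderiv one_ne_zero
  fun_prop

theorem divergence_eq_zero_of_notMem {V : E d → E d} {v : E d} (hv : v ∉ tsupport V) :
    divergence V v = 0 := by
  have : fderiv ℝ V v = 0 := by
    by_contra h
    exact hv (support_fderiv_subset ℝ h)
  simp [divergence, this]

/-- Integration by parts for a vector field against a function, one of them with compact
support. -/
theorem integral_divergence_mul {V : E d → E d} {a : E d → ℝ} (hV : ContDiff ℝ 1 V)
    (ha : ContDiff ℝ 1 a) (hc : HasCompactSupport V ∨ HasCompactSupport a) :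
    ∫ v, divergence V v * a v = - ∫ v, fderiv ℝ a v (V v) := by
  have hVi : ∀ i : Fin d, ContDiff ℝ 1 (fun v => V v i) := fun i =>
    (EuclideanSpace.proj (𝕜 := ℝ) i).contDiff.comp hV
  have hfV : ∀ i : Fin d, Continuous fun v =>
      fderiv ℝ (fun v => V v i) v (EuclideanSpace.single i 1) := fun i =>
    ((hVi i).continuous_fderiv one_ne_zero).clm_apply continuous_const
  have hfa : ∀ i : Fin d, Continuous fun v => fderiv ℝ a v (EuclideanSpace.single i 1) := fun i =>
    (ha.continuous_fderiv one_ne_zero).clm_apply continuous_const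
  have hcVi : HasCompactSupport V → ∀ i, HasCompactSupport (fun v => V v i) := fun h i =>
    h.comp_left (g := fun w : E d => w i) rfl
  have i1 : ∀ i : Fin d, Integrable fun v =>
      fderiv ℝ (fun v => V v i) v (EuclideanSpace.single i 1) * a v := by
    intro i
    refine ((hfV i).mul ha.continuous).integrable_of_hasCompactSupport ?_
    rcases hc with h | h
    · exact ((hcVi h i).fderiv_apply (𝕜 := ℝ) _).mul_right
    · exact h.mul_left
  have i2 : ∀ i : Fin d, Integrable fun v =>
      V v i * fderiv ℝ a v (EuclideanSpace.single i 1) := by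
    intro i
    refine ((hVi i).continuous.mul (hfa i)).integrable_of_hasCompactSupport ?_
    rcases hc with h | h
    · exact (hcVi h i).mul_right
    · exact (h.fderiv_apply (𝕜 := ℝ) _).mul_left
  have i3 : ∀ i : Fin d, Integrable fun v => V v i * a v := by
    intro i
    refine ((hVi i).continuous.mul ha.continuous).integrable_of_hasCompactSupport ?_
    rcases hc with h | h
    · exact (hcVi h i).mul_right
    · exact h.mul_left
  have key : ∀ i : Fin d, ∫ v, fderiv ℝ (fun v => V v i) v (EuclideanSpace.single i 1) * a v =
      - ∫ v, V v i * fderiv ℝ a v (EuclideanSpace.single i 1) := by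
    intro i
    rw [integral_mul_fderiv_eq_neg_fderiv_mul_of_integrable (i1 i) (i2 i) (i3 i)
      (fun x _ => (hVi i).differentiable one_ne_zero x)
      (fun x _ => ha.differentiable one_ne_zero x), neg_neg]
  calc ∫ v, divergence V v * a v
      = ∫ v, ∑ i, fderiv ℝ (fun v => V v i) v (EuclideanSpace.single i 1) * a v := by
        refine integral_congr_ae (.of_forall fun v => ?_)
        simp only [divergence, Finset.sum_mul]
        refine Finset.sum_congr rfl fun i _ => ?_
        rw [fderiv_component (hV.differentiable one_ne_zero v)]
    _ = ∑ i, - ∫ v, V v i * fderiv ℝ a v (EuclideanSpace.single i 1) := by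
        rw [integral_finsetSum _ fun i _ => i1 i]
        exact Finset.sum_congr rfl fun i _ => key i
    _ = - ∫ v, fderiv ℝ a v (V v) := by
        rw [Finset.sum_neg_distrib, ← integral_finsetSum _ fun i _ => i2 i]
        congr 1
        refine integral_congr_ae (.of_forall fun v => ?_)
        exact (map_eq_sum_single _ _).symm

section Slices

variable {A B W : Type*} [NormedAddCommGroup A] [NormedSpace ℝ A] [NormedAddCommGroup B]
  [NormedSpace ℝ B] [NormedAddCommGroup W] [NormedSpace ℝ W]

theorem hasFDerivAt_slice_right {F : A → B → W}
    {x : A} {v : B} (h : DifferentiableAt ℝ (fun p : A × B => F p.1 p.2) (x, v)) :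
    HasFDerivAt (F x) ((fderiv ℝ (fun p : A × B => F p.1 p.2) (x, v)).comp
      (ContinuousLinearMap.inr ℝ A B)) v :=
  h.hasFDerivAt.comp (f := fun u => (x, u)) v (hasFDerivAt_prodMk_right x v)

theorem hasFDerivAt_slice_left {F : A → B → W}
    {x : A} {v : B} (h : DifferentiableAt ℝ (fun p : A × B => F p.1 p.2) (x, v)) :
    HasFDerivAt (fun y => F y v) ((fderiv ℝ (fun p : A × B => F p.1 p.2) (x, v)).comp
      (ContinuousLinearMap.inl ℝ A B)) x :=
  h.hasFDerivAt.comp (f := fun y => (y, v)) x (hasFDerivAt_prodMk_left x v)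

theorem contDiff_slice_right {n : WithTop ℕ∞} {F : A → B → W}
    (h : ContDiff ℝ n (fun p : A × B => F p.1 p.2)) (x : A) : ContDiff ℝ n (F x) :=
  h.comp (contDiff_const.prodMk contDiff_id : ContDiff ℝ n fun u : B => (x, u))

theorem contDiff_slice_left {n : WithTop ℕ∞} {F : A → B → W}
    (h : ContDiff ℝ n (fun p : A × B => F p.1 p.2)) (v : B) : ContDiff ℝ n (fun y => F y v) :=
  h.comp (contDiff_id.prodMk contDiff_const : ContDiff ℝ n fun y : A => (y, v))

theorem continuous_fderiv_slice_right {F : A → B → W}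
    (h : ContDiff ℝ 1 (fun p : A × B => F p.1 p.2)) :
    Continuous fun p : A × B => fderiv ℝ (F p.1) p.2 := by
  have : (fun p : A × B => fderiv ℝ (F p.1) p.2) = fun p =>
      (fderiv ℝ (fun p : A × B => F p.1 p.2) p).comp (ContinuousLinearMap.inr ℝ A B) := by
    ext1 p
    exact (hasFDerivAt_slice_right (h.differentiable one_ne_zero _)).fderiv
  rw [this]
  exact (h.continuous_fderiv one_ne_zero).clm_comp continuous_const

theorem continuous_fderiv_slice_left {F : A → B → W}
    (h : ContDiff ℝ 1 (fun p : A × B => F p.1 p.2)) :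
    Continuous fun p : A × B => fderiv ℝ (fun y => F y p.2) p.1 := by
  have : (fun p : A × B => fderiv ℝ (fun y => F y p.2) p.1) = fun p =>
      (fderiv ℝ (fun p : A × B => F p.1 p.2) p).comp (ContinuousLinearMap.inl ℝ A B) := by
    ext1 p
    exact (hasFDerivAt_slice_left (h.differentiable one_ne_zero _)).fderiv
  rw [this]
  exact (h.continuous_fderiv one_ne_zero).clm_comp continuous_const

theorem contDiff_fderiv_slice_right {F : A → B → W}
    (h : ContDiff ℝ 2 (fun p : A × B => F p.1 p.2)) :
    ContDiff ℝ 1 fun p : A × B => fderiv ℝ (F p.1) p.2 := by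
  have : (fun p : A × B => fderiv ℝ (F p.1) p.2) = fun p =>
      (fderiv ℝ (fun p : A × B => F p.1 p.2) p).comp (ContinuousLinearMap.inr ℝ A B) := by
    ext1 p
    exact (hasFDerivAt_slice_right (h.differentiable two_ne_zero _)).fderiv
  rw [this]
  exact (h.fderiv_right (m := 1) (by norm_num)).clm_comp contDiff_const

theorem hasCompactSupport_slice_right {F : A → B → W}
    (h : HasCompactSupport (fun p : A × B => F p.1 p.2)) (x : A) : HasCompactSupport (F x) := by
  refine HasCompactSupport.intro (h.isCompact.image continuous_snd) fun v hv => ?_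
  by_contra h0
  exact hv ⟨(x, v), subset_tsupport _ h0, rfl⟩

theorem hasCompactSupport_slice_left {F : A → B → W}
    (h : HasCompactSupport (fun p : A × B => F p.1 p.2)) (v : B) :
    HasCompactSupport (fun y => F y v) := by
  refine HasCompactSupport.intro (h.isCompact.image continuous_fst) fun x hx => ?_
  by_contra h0
  exact hx ⟨(x, v), subset_tsupport _ h0, rfl⟩

theorem fderiv_slice_right_eq_zero {F : A → B → W} {p : A × B}
    (hp : p ∉ tsupport (fun p : A × B => F p.1 p.2)) : fderiv ℝ (F p.1) p.2 = 0 := by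
  have h : (fun p : A × B => F p.1 p.2) =ᶠ[nhds p] 0 := notMem_tsupport_iff_eventuallyEq.1 hp
  have h2 : F p.1 =ᶠ[nhds p.2] fun _ => 0 :=
    (Continuous.tendsto (by fun_prop : Continuous fun u : B => (p.1, u)) p.2).eventually h
  rw [h2.fderiv_eq]
  simp

theorem fderiv_slice_left_eq_zero {F : A → B → W} {p : A × B}
    (hp : p ∉ tsupport (fun p : A × B => F p.1 p.2)) : fderiv ℝ (fun y => F y p.2) p.1 = 0 := by
  have h : (fun p : A × B => F p.1 p.2) =ᶠ[nhds p] 0 := notMem_tsupport_iff_eventuallyEq.1 hp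
  have h2 : (fun y => F y p.2) =ᶠ[nhds p.1] fun _ => 0 :=
    (Continuous.tendsto (by fun_prop : Continuous fun y : A => (y, p.2)) p.1).eventually h
  rw [h2.fderiv_eq]
  simp

end Slices

/-- The derivative of `ψ` along the characteristics `x' = v`, `v' = G(x,v)`. -/
def alongField (G : E d → E d → E d) (ψ : E d → E d → ℝ) (x v : E d) : ℝ :=
  fderiv ℝ (fun y => ψ y v) x v + fderiv ℝ (ψ x) v (G x v)

variable {G : E d → E d → E d} {φ ψ : E d → E d → ℝ}

theorem continuous_alongField (hG : Continuous (fun p : E d × E d => G p.1 p.2))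
    (hψ : ContDiff ℝ 1 (fun p : E d × E d => ψ p.1 p.2)) :
    Continuous fun p : E d × E d => alongField G ψ p.1 p.2 := by
  unfold alongField
  exact ((continuous_fderiv_slice_left hψ).clm_apply continuous_snd).add
    ((continuous_fderiv_slice_right hψ).clm_apply hG)

theorem continuous_divergence_slice {V : E d → E d → E d}
    (hV : ContDiff ℝ 1 (fun p : E d × E d => V p.1 p.2)) :
    Continuous fun p : E d × E d => divergence (V p.1) p.2 := by
  unfold divergence
  have h := continuous_fderiv_slice_right hV
  fun_prop

theorem continuous_transport (hG : ContDiff ℝ 1 (fun p : E d × E d => G p.1 p.2))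
    (hφ : ContDiff ℝ 1 (fun p : E d × E d => φ p.1 p.2)) :
    Continuous fun p : E d × E d => transport G φ p.1 p.2 := by
  unfold transport
  simp only [inner_gradient_right]
  exact ((continuous_fderiv_slice_left hφ).clm_apply continuous_snd).add
    (continuous_divergence_slice (V := fun x v => φ x v • G x v) (hφ.smul hG))

/-- The transport operator is minus the adjoint of the derivative along characteristics. -/
theorem integral_transport_mul (hG : ContDiff ℝ 1 (fun p : E d × E d => G p.1 p.2))
    (hφ : ContDiff ℝ 1 (fun p : E d × E d => φ p.1 p.2))
    (hψ : ContDiff ℝ 1 (fun p : E d × E d => ψ p.1 p.2))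
    (hc : HasCompactSupport (fun p : E d × E d => φ p.1 p.2) ∨
      HasCompactSupport (fun p : E d × E d => ψ p.1 p.2)) :
    ∫ p : E d × E d, transport G φ p.1 p.2 * ψ p.1 p.2 =
      - ∫ p : E d × E d, φ p.1 p.2 * alongField G ψ p.1 p.2 := by
  have cφ := hφ.continuous
  have cψ := hψ.continuous
  have hGφ : ContDiff ℝ 1 (fun p : E d × E d => φ p.1 p.2 • G p.1 p.2) := hφ.smul hG
  have c1 : Continuous fun p : E d × E d =>
      fderiv ℝ (fun y => φ y p.2) p.1 p.2 * ψ p.1 p.2 :=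
    ((continuous_fderiv_slice_left hφ).clm_apply continuous_snd).mul cψ
  have c2 : Continuous fun p : E d × E d =>
      divergence (fun u => φ p.1 u • G p.1 u) p.2 * ψ p.1 p.2 :=
    (continuous_divergence_slice (V := fun x v => φ x v • G x v) hGφ).mul cψ
  have c3 : Continuous fun p : E d × E d =>
      φ p.1 p.2 * fderiv ℝ (fun y => ψ y p.2) p.1 p.2 :=
    cφ.mul ((continuous_fderiv_slice_left hψ).clm_apply continuous_snd)
  have c4 : Continuous fun p : E d × E d =>
      φ p.1 p.2 * fderiv ℝ (ψ p.1) p.2 (G p.1 p.2) :=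
    cφ.mul ((continuous_fderiv_slice_right hψ).clm_apply hG.continuous)
  -- One compact set off which all four integrands vanish, whichever of the two functions has
  -- compact support.
  obtain ⟨K, hK, hφψ⟩ : ∃ K : Set (E d × E d), IsCompact K ∧ ∀ p ∉ K,
      p ∉ tsupport (fun p : E d × E d => φ p.1 p.2) ∨
      p ∉ tsupport (fun p : E d × E d => ψ p.1 p.2) := by
    rcases hc with h | h
    exacts [⟨_, h.isCompact, fun p hp => Or.inl hp⟩, ⟨_, h.isCompact, fun p hp => Or.inr hp⟩]
  have i1 : Integrable fun p : E d × E d =>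
      fderiv ℝ (fun y => φ y p.2) p.1 p.2 * ψ p.1 p.2 := by
    refine c1.integrable_of_hasCompactSupport (HasCompactSupport.intro hK fun p hp => ?_)
    rcases hφψ p hp with h | h
    · simp [fderiv_slice_left_eq_zero h]
    · simp [image_eq_zero_of_notMem_tsupport h]
  have i2 : Integrable fun p : E d × E d =>
      divergence (fun u => φ p.1 u • G p.1 u) p.2 * ψ p.1 p.2 := by
    refine c2.integrable_of_hasCompactSupport (HasCompactSupport.intro hK fun p hp => ?_)
    rcases hφψ p hp with h | h
    · rw [divergence_smul ((contDiff_slice_right hφ _).differentiable one_ne_zero _)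
        ((contDiff_slice_right hG _).differentiable one_ne_zero _)]
      simp [fderiv_slice_right_eq_zero h, image_eq_zero_of_notMem_tsupport h]
    · simp [image_eq_zero_of_notMem_tsupport h]
  have i3 : Integrable fun p : E d × E d =>
      φ p.1 p.2 * fderiv ℝ (fun y => ψ y p.2) p.1 p.2 := by
    refine c3.integrable_of_hasCompactSupport (HasCompactSupport.intro hK fun p hp => ?_)
    rcases hφψ p hp with h | h
    · simp [image_eq_zero_of_notMem_tsupport h]
    · simp [fderiv_slice_left_eq_zero h]
  have i4 : Integrable fun p : E d × E d =>
      φ p.1 p.2 * fderiv ℝ (ψ p.1) p.2 (G p.1 p.2) := by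
    refine c4.integrable_of_hasCompactSupport (HasCompactSupport.intro hK fun p hp => ?_)
    rcases hφψ p hp with h | h
    · simp [image_eq_zero_of_notMem_tsupport h]
    · simp [fderiv_slice_right_eq_zero h]
  -- Fubini with `v` outermost: for frozen `v` the direction of differentiation is constant, so no
  -- divergence term appears.
  have e1 : ∫ p : E d × E d, fderiv ℝ (fun y => φ y p.2) p.1 p.2 * ψ p.1 p.2 =
      - ∫ p : E d × E d, φ p.1 p.2 * fderiv ℝ (fun y => ψ y p.2) p.1 p.2 := by
    rw [Measure.volume_eq_prod] at i1 i3 ⊢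
    rw [integral_prod_symm _ i1, integral_prod_symm _ i3, ← integral_neg]
    refine integral_congr_ae (.of_forall fun v => ?_)
    have hφv := contDiff_slice_left hφ v
    have hψv := contDiff_slice_left hψ v
    have hcc : HasCompactSupport (fun y => φ y v) ∨ HasCompactSupport (fun y => ψ y v) :=
      hc.imp (hasCompactSupport_slice_left · v) (hasCompactSupport_slice_left · v)
    have cf : Continuous fun x => fderiv ℝ (fun y => φ y v) x v :=
      (hφv.continuous_fderiv one_ne_zero).clm_apply continuous_const
    have cg : Continuous fun x => fderiv ℝ (fun y => ψ y v) x v :=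
      (hψv.continuous_fderiv one_ne_zero).clm_apply continuous_const
    have j1 : Integrable fun x => fderiv ℝ (fun y => φ y v) x v * ψ x v := by
      refine (cf.mul hψv.continuous).integrable_of_hasCompactSupport ?_
      rcases hcc with h | h
      · exact (h.fderiv_apply (𝕜 := ℝ) _).mul_right
      · exact h.mul_left
    have j2 : Integrable fun x => φ x v * fderiv ℝ (fun y => ψ y v) x v := by
      refine (hφv.continuous.mul cg).integrable_of_hasCompactSupport ?_
      rcases hcc with h | h
      · exact h.mul_right
      · exact (h.fderiv_apply (𝕜 := ℝ) _).mul_left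
    have j3 : Integrable fun x => φ x v * ψ x v := by
      refine (hφv.continuous.mul hψv.continuous).integrable_of_hasCompactSupport ?_
      rcases hcc with h | h
      · exact h.mul_right
      · exact h.mul_left
    simp only
    rw [integral_mul_fderiv_eq_neg_fderiv_mul_of_integrable j1 j2 j3
      (fun x _ => hφv.differentiable one_ne_zero x)
      (fun x _ => hψv.differentiable one_ne_zero x), neg_neg]
  -- Now `x` is frozen and the vector field `φ G` is integrated by parts in `v`.
  have e2 : ∫ p : E d × E d, divergence (fun u => φ p.1 u • G p.1 u) p.2 * ψ p.1 p.2 =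
      - ∫ p : E d × E d, φ p.1 p.2 * fderiv ℝ (ψ p.1) p.2 (G p.1 p.2) := by
    rw [Measure.volume_eq_prod] at i2 i4 ⊢
    rw [integral_prod _ i2, integral_prod _ i4, ← integral_neg]
    refine integral_congr_ae (.of_forall fun x => ?_)
    simp only
    rw [integral_divergence_mul (contDiff_slice_right (F := fun x v => φ x v • G x v) hGφ x)
      (contDiff_slice_right hψ x)]
    · simp
    · rcases hc with h | h
      · exact Or.inl (hasCompactSupport_slice_right h x).smul_right
      · exact Or.inr (hasCompactSupport_slice_right h x)
  calc ∫ p : E d × E d, transport G φ p.1 p.2 * ψ p.1 p.2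
      = ∫ p : E d × E d, (fderiv ℝ (fun y => φ y p.2) p.1 p.2 * ψ p.1 p.2 +
          divergence (fun u => φ p.1 u • G p.1 u) p.2 * ψ p.1 p.2) := by
        refine integral_congr_ae (.of_forall fun p => ?_)
        simp only [transport, inner_gradient_right, add_mul]
    _ = _ := by
        rw [integral_add i1 i2, e1, e2, ← neg_add, ← integral_add i3 i4]
        congr 1
        refine integral_congr_ae (.of_forall fun p => ?_)
        simp only [alongField, mul_add]

end Calculus

end

end Kinetic


namespace Kinetic

noncomputable section

/-! ### Measures with a positive density -/

section PositiveDensity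

variable {α : Type*} [MeasurableSpace α] {μ : Measure α} {w : α → ℝ}

/-- Positivity of the density gives the nontrivial direction of absolute continuity. Almost
everywhere statements therefore pass freely between Lebesgue measure and the weighted measures
below. -/
theorem withDensity_ofReal_ac (hw : Measurable w) (hp : ∀ x, 0 < w x) :
    μ ≪ μ.withDensity (fun x => ENNReal.ofReal (w x)) :=
  withDensity_absolutelyContinuous' hw.ennreal_ofReal.aemeasurable
    (.of_forall fun x => by simpa using hp x)

theorem integral_withDensity_ofReal (hw : Measurable w) (hp : ∀ x, 0 < w x) (g : α → ℝ) :
    ∫ x, g x ∂(μ.withDensity fun x => ENNReal.ofReal (w x)) = ∫ x, w x * g x ∂μ := by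
  rw [integral_withDensity_eq_integral_toReal_smul hw.ennreal_ofReal
    (.of_forall fun x => ENNReal.ofReal_lt_top)]
  simp [ENNReal.toReal_ofReal (hp _).le]

theorem integrable_withDensity_ofReal (hw : Measurable w) (hp : ∀ x, 0 < w x) {g : α → ℝ} :
    Integrable g (μ.withDensity fun x => ENNReal.ofReal (w x)) ↔
      Integrable (fun x => w x * g x) μ := by
  rw [integrable_withDensity_iff_integrable_smul' hw.ennreal_ofReal
    (.of_forall fun x => ENNReal.ofReal_lt_top)]
  simp [ENNReal.toReal_ofReal (hp _).le]

theorem aestronglyMeasurable_withDensity_ofReal (hw : Measurable w) (hp : ∀ x, 0 < w x)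
    {g : α → ℝ} : AEStronglyMeasurable g (μ.withDensity fun x => ENNReal.ofReal (w x)) ↔
      AEStronglyMeasurable g μ :=
  ⟨fun h => h.mono_ac (withDensity_ofReal_ac hw hp),
    fun h => h.mono_ac (withDensity_absolutelyContinuous _ _)⟩

theorem memLp_two_withDensity_ofReal (hw : Measurable w) (hp : ∀ x, 0 < w x) {g : α → ℝ} :
    MemLp g 2 (μ.withDensity fun x => ENNReal.ofReal (w x)) ↔
      AEStronglyMeasurable g μ ∧ Integrable (fun x => w x * g x ^ 2) μ := by
  constructor
  · intro h
    have h1 := (aestronglyMeasurable_withDensity_ofReal hw hp).1 h.1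
    exact ⟨h1, (integrable_withDensity_ofReal hw hp).1 ((memLp_two_iff_integrable_sq h.1).1 h)⟩
  · rintro ⟨h1, h2⟩
    have h1' := (aestronglyMeasurable_withDensity_ofReal hw hp).2 h1
    exact (memLp_two_iff_integrable_sq h1').2 ((integrable_withDensity_ofReal hw hp).2 h2)

theorem norm_sq_eq_integral (f : Lp ℝ 2 μ) : ‖f‖ ^ 2 = ∫ x, f x ^ 2 ∂μ := by
  rw [← real_inner_self_eq_norm_sq, L2.inner_def]
  simp [sq]

end PositiveDensity

/-- The probability measure `fSt dx dv`. -/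
def phaseMeasure {d : ℕ} (fSt : E d → E d → ℝ) : Measure (E d × E d) :=
  (volume : Measure (E d × E d)).withDensity (fun p => ENNReal.ofReal (fSt p.1 p.2))

/-- The probability measure `⟨fSt⟩ dx`. -/
def spaceMeasure {d : ℕ} (fSt : E d → E d → ℝ) : Measure (E d) :=
  (volume : Measure (E d)).withDensity (fun x => ENNReal.ofReal (density fSt x))

/-- The space `L²(⟨fSt⟩ dx)`. -/
abbrev SL2 {d : ℕ} (fSt : E d → E d → ℝ) : Type := Lp ℝ 2 (spaceMeasure fSt)

/-! ### Weighted spaces and the projection onto local equilibria -/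

namespace StationaryState

variable {d : ℕ} {c : Collision} {G : E d → E d → E d} {M fSt : E d → E d → ℝ} {cInf cM : ℝ}
  (hS : StationaryState c G M fSt cInf cM)

include hS

theorem density_pos (x : E d) : 0 < density fSt x := by
  unfold density
  rw [integral_pos_iff_support_of_nonneg (fun v => (hS.pos x v).le) (hS.integrable_velocity x)]
  have : Function.support (fSt x) = Set.univ := by
    ext v; simpa using (hS.pos x v).ne'
  rw [this]
  exact NeZero.pos _

theorem measurable : Measurable fun p : E d × E d => fSt p.1 p.2 :=
  hS.regular.continuous.measurable

theorem measurable_inv : Measurable fun p : E d × E d => (fSt p.1 p.2)⁻¹ :=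
  hS.measurable.inv

theorem inv_pos (p : E d × E d) : 0 < (fSt p.1 p.2)⁻¹ := _root_.inv_pos.2 (hS.pos _ _)

theorem measurable_density : Measurable (density fSt) :=
  hS.density_regular.continuous.measurable

theorem ae_weighted {P : E d × E d → Prop} :
    (∀ᵐ p ∂(weightedMeasure fSt), P p) ↔ ∀ᵐ p, P p :=
  ⟨fun h => withDensity_ofReal_ac hS.measurable_inv hS.inv_pos h,
    fun h => withDensity_absolutelyContinuous _ _ h⟩

theorem ae_space {P : E d → Prop} : (∀ᵐ x ∂(spaceMeasure fSt), P x) ↔ ∀ᵐ x, P x :=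
  ⟨fun h => withDensity_ofReal_ac hS.measurable_density hS.density_pos h,
    fun h => withDensity_absolutelyContinuous _ _ h⟩

theorem ae_phase {P : E d × E d → Prop} : (∀ᵐ p ∂(phaseMeasure fSt), P p) ↔ ∀ᵐ p, P p :=
  ⟨fun h => withDensity_ofReal_ac hS.measurable (fun p => hS.pos p.1 p.2) h,
    fun h => withDensity_absolutelyContinuous _ _ h⟩

theorem integral_weighted (F : E d × E d → ℝ) :
    ∫ p, F p ∂(weightedMeasure fSt) = ∫ p, (fSt p.1 p.2)⁻¹ * F p :=
  integral_withDensity_ofReal hS.measurable_inv hS.inv_pos F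

theorem integral_phase (F : E d × E d → ℝ) :
    ∫ p, F p ∂(phaseMeasure fSt) = ∫ p : E d × E d, fSt p.1 p.2 * F p :=
  integral_withDensity_ofReal hS.measurable (fun p => hS.pos p.1 p.2) F

theorem integral_space (F : E d → ℝ) :
    ∫ x, F x ∂(spaceMeasure fSt) = ∫ x, density fSt x * F x :=
  integral_withDensity_ofReal hS.measurable_density hS.density_pos F

theorem isProbabilityMeasure_phase : IsProbabilityMeasure (phaseMeasure fSt) := by
  constructor
  rw [phaseMeasure, withDensity_apply _ MeasurableSet.univ, setLIntegral_univ,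
    ← ofReal_integral_eq_lintegral_ofReal hS.integrable (.of_forall fun p => (hS.pos _ _).le),
    hS.mass, ENNReal.ofReal_one]

/-- Tonelli: integrating `fSt` over `v` produces the density of `spaceMeasure`. Because of this,
functions of `x` embed isometrically among functions of `(x,v)`. -/
theorem measurePreserving_fst :
    MeasurePreserving (Prod.fst : E d × E d → E d) (phaseMeasure fSt) (spaceMeasure fSt) := by
  refine ⟨measurable_fst, ?_⟩
  ext s hs
  rw [Measure.map_apply measurable_fst hs, phaseMeasure, spaceMeasure,
    withDensity_apply _ (measurable_fst hs), withDensity_apply _ hs]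
  have : (Prod.fst ⁻¹' s : Set (E d × E d)) = s ×ˢ Set.univ := by ext; simp
  rw [this, Measure.volume_eq_prod, ← Measure.prod_restrict, Measure.restrict_univ,
    lintegral_prod _ hS.measurable.ennreal_ofReal.aemeasurable]
  refine lintegral_congr fun x => ?_
  exact (ofReal_integral_eq_lintegral_ofReal (hS.integrable_velocity x)
    (.of_forall fun v => (hS.pos _ _).le)).symm

theorem isProbabilityMeasure_space : IsProbabilityMeasure (spaceMeasure fSt) := by
  have := hS.isProbabilityMeasure_phase
  rw [← hS.measurePreserving_fst.map_eq]
  exact Measure.isProbabilityMeasure_map measurable_fst.aemeasurable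

theorem memLp_weighted {g : E d × E d → ℝ} : MemLp g 2 (weightedMeasure fSt) ↔
    AEStronglyMeasurable g volume ∧ Integrable fun p : E d × E d => (fSt p.1 p.2)⁻¹ * g p ^ 2 :=
  memLp_two_withDensity_ofReal hS.measurable_inv hS.inv_pos

theorem memLp_phase {g : E d × E d → ℝ} : MemLp g 2 (phaseMeasure fSt) ↔
    AEStronglyMeasurable g volume ∧ Integrable fun p : E d × E d => fSt p.1 p.2 * g p ^ 2 :=
  memLp_two_withDensity_ofReal hS.measurable (fun p => hS.pos p.1 p.2)

theorem memLp_mul {m : E d × E d → ℝ} (hm : MemLp m 2 (phaseMeasure fSt)) :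
    MemLp (fun p : E d × E d => m p * fSt p.1 p.2) 2 (weightedMeasure fSt) := by
  obtain ⟨h1, h2⟩ := hS.memLp_phase.1 hm
  refine hS.memLp_weighted.2 ⟨h1.mul hS.measurable.aestronglyMeasurable, ?_⟩
  refine h2.congr (.of_forall fun p => ?_)
  have := (hS.pos p.1 p.2).ne'
  simp only
  field_simp

/-- Multiplication by `fSt` is an isometry from `L²(fSt dx dv)` to `L²(dx dv / fSt)`. -/
def mulIsometry : Lp ℝ 2 (phaseMeasure fSt) →ₗᵢ[ℝ] WL2 fSt where
  toFun m := (hS.memLp_mul (Lp.memLp m)).toLp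
  map_add' m n := by
    rw [← MemLp.toLp_add, MemLp.toLp_eq_toLp_iff]
    have := hS.ae_phase.1 (Lp.coeFn_add m n)
    refine hS.ae_weighted.2 ?_
    filter_upwards [this] with p hp
    show (m + n : Lp ℝ 2 (phaseMeasure fSt)) p * fSt p.1 p.2 = _
    rw [hp]
    exact add_mul _ _ _
  map_smul' r m := by
    rw [RingHom.id_apply, ← MemLp.toLp_const_smul, MemLp.toLp_eq_toLp_iff]
    have := hS.ae_phase.1 (Lp.coeFn_smul r m)
    refine hS.ae_weighted.2 ?_
    filter_upwards [this] with p hp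
    show (r • m : Lp ℝ 2 (phaseMeasure fSt)) p * fSt p.1 p.2 = _
    rw [hp]
    exact mul_assoc _ _ _
  norm_map' m := by
    rw [← sq_eq_sq₀ (norm_nonneg _) (norm_nonneg _), norm_sq_eq_integral, norm_sq_eq_integral,
      hS.integral_weighted, hS.integral_phase]
    refine integral_congr_ae ?_
    have := hS.ae_weighted.1 (hS.memLp_mul (Lp.memLp m)).coeFn_toLp
    filter_upwards [this] with p hp
    simp only [LinearMap.coe_mk, AddHom.coe_mk, hp]
    have := (hS.pos p.1 p.2).ne'
    field_simp

theorem mulIsometry_ae (m : Lp ℝ 2 (phaseMeasure fSt)) :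
    ∀ᵐ p : E d × E d, hS.mulIsometry m p = m p * fSt p.1 p.2 :=
  hS.ae_weighted.1 (hS.memLp_mul (Lp.memLp m)).coeFn_toLp

open Classical in
/-- The element of `L²(dx dv / fSt)` represented by `m fSt`, for `m` in `L²(fSt dx dv)`. -/
def ofMultiplier (m : E d × E d → ℝ) : WL2 fSt :=
  if h : MemLp m 2 (phaseMeasure fSt) then hS.mulIsometry h.toLp else 0

variable {m n : E d × E d → ℝ}

theorem ofMultiplier_eq (hm : MemLp m 2 (phaseMeasure fSt)) :
    hS.ofMultiplier m = hS.mulIsometry hm.toLp := by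
  simp [ofMultiplier, hm]

theorem ofMultiplier_ae (hm : MemLp m 2 (phaseMeasure fSt)) :
    ∀ᵐ p : E d × E d, hS.ofMultiplier m p = m p * fSt p.1 p.2 := by
  rw [hS.ofMultiplier_eq hm]
  filter_upwards [hS.mulIsometry_ae hm.toLp, hS.ae_phase.1 hm.coeFn_toLp] with p h1 h2
  rw [h1, h2]

theorem ofMultiplier_add (hm : MemLp m 2 (phaseMeasure fSt))
    (hn : MemLp n 2 (phaseMeasure fSt)) :
    hS.ofMultiplier (m + n) = hS.ofMultiplier m + hS.ofMultiplier n := by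
  rw [hS.ofMultiplier_eq hm, hS.ofMultiplier_eq hn, hS.ofMultiplier_eq (hm.add hn),
    MemLp.toLp_add, map_add]

theorem ofMultiplier_sub (hm : MemLp m 2 (phaseMeasure fSt))
    (hn : MemLp n 2 (phaseMeasure fSt)) :
    hS.ofMultiplier (m - n) = hS.ofMultiplier m - hS.ofMultiplier n := by
  rw [hS.ofMultiplier_eq hm, hS.ofMultiplier_eq hn, hS.ofMultiplier_eq (hm.sub hn),
    MemLp.toLp_sub, map_sub]

theorem ofMultiplier_const_smul (r : ℝ) (hm : MemLp m 2 (phaseMeasure fSt)) :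
    hS.ofMultiplier (r • m) = r • hS.ofMultiplier m := by
  rw [hS.ofMultiplier_eq hm, hS.ofMultiplier_eq (hm.const_smul r),
    MemLp.toLp_const_smul, map_smul]

theorem ofMultiplier_sum {ι : Type*} (s : Finset ι) {m : ι → E d × E d → ℝ}
    (hm : ∀ i, MemLp (m i) 2 (phaseMeasure fSt)) :
    hS.ofMultiplier (∑ i ∈ s, m i) = ∑ i ∈ s, hS.ofMultiplier (m i) := by
  classical
  induction s using Finset.induction_on with
  | empty =>
    have : MemLp (0 : E d × E d → ℝ) 2 (phaseMeasure fSt) := MemLp.zero'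
    rw [Finset.sum_empty, Finset.sum_empty, hS.ofMultiplier_eq this]
    rw [MemLp.toLp_zero, map_zero]
  | insert a s ha ih =>
    rw [Finset.sum_insert ha, Finset.sum_insert ha,
      hS.ofMultiplier_add (hm a) (memLp_finsetSum' s fun i _ => hm i), ih]

theorem norm_ofMultiplier_sq (hm : MemLp m 2 (phaseMeasure fSt)) :
    ‖hS.ofMultiplier m‖ ^ 2 = ∫ p : E d × E d, fSt p.1 p.2 * m p ^ 2 := by
  rw [hS.ofMultiplier_eq hm, LinearIsometry.norm_map, norm_sq_eq_integral, hS.integral_phase]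
  refine integral_congr_ae ?_
  filter_upwards [hS.ae_phase.1 hm.coeFn_toLp] with p h2
  rw [h2]

theorem inner_eq_integral (f g : WL2 fSt) :
    inner ℝ f g = ∫ p : E d × E d, (fSt p.1 p.2)⁻¹ * (f p * g p) := by
  rw [L2.inner_def, hS.integral_weighted]
  simp [mul_comm]

/-- The factor `fSt` of the test element cancels the weight `1/fSt` of the inner product, so pairing
with a multiplier is an unweighted integral, as in the distributional formulation. -/
theorem inner_ofMultiplier (f : WL2 fSt) (hm : MemLp m 2 (phaseMeasure fSt)) :
    inner ℝ f (hS.ofMultiplier m) = ∫ p, f p * m p := by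
  rw [hS.inner_eq_integral]
  refine integral_congr_ae ?_
  filter_upwards [hS.ofMultiplier_ae hm] with p hp
  have := (hS.pos p.1 p.2).ne'
  rw [hp]
  field_simp

theorem integrable_mul (f : WL2 fSt) (hm : MemLp m 2 (phaseMeasure fSt)) :
    Integrable fun p => f p * m p := by
  have h := L2.integrable_inner (𝕜 := ℝ) f (hS.ofMultiplier m)
  refine ((integrable_withDensity_ofReal hS.measurable_inv hS.inv_pos).1 h).congr ?_
  filter_upwards [hS.ofMultiplier_ae hm] with p hp
  have := (hS.pos p.1 p.2).ne'
  simp only [hp, RCLike.inner_apply, conj_trivial]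
  field_simp

theorem memLp_const (r : ℝ) : MemLp (fun _ : E d × E d => r) 2 (phaseMeasure fSt) :=
  have := hS.isProbabilityMeasure_phase
  _root_.MeasureTheory.memLp_const r

theorem memLp_of_bound {C : ℝ} (hm : AEStronglyMeasurable m volume) (h : ∀ p, |m p| ≤ C) :
    MemLp m 2 (phaseMeasure fSt) :=
  have := hS.isProbabilityMeasure_phase
  MemLp.of_bound ((aestronglyMeasurable_withDensity_ofReal hS.measurable
    (fun p => hS.pos p.1 p.2)).2 hm) C (.of_forall h)

/-- Cauchy-Schwarz: `fSt` has mass one, so the constant `1` is an admissible multiplier. Mass and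
spatial density are thus meaningful. -/
theorem integrable_coe (f : WL2 fSt) : Integrable (fun p => f p) := by
  simpa using hS.integrable_mul f (hS.memLp_const 1)

/-- The isometry `u ↦ u(x) fSt(x,v)`. -/
def embed : SL2 fSt →ₗᵢ[ℝ] WL2 fSt :=
  hS.mulIsometry.comp (Lp.compMeasurePreservingₗᵢ ℝ Prod.fst hS.measurePreserving_fst)

theorem memLp_comp_fst {u : E d → ℝ} (hu : MemLp u 2 (spaceMeasure fSt)) :
    MemLp (fun p : E d × E d => u p.1) 2 (phaseMeasure fSt) :=
  hu.comp_measurePreserving hS.measurePreserving_fst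

theorem embed_ae (u : SL2 fSt) : ∀ᵐ p : E d × E d, hS.embed u p = u p.1 * fSt p.1 p.2 := by
  have h1 := hS.mulIsometry_ae
    (Lp.compMeasurePreserving Prod.fst hS.measurePreserving_fst u)
  have h2 := hS.ae_phase.1 (Lp.coeFn_compMeasurePreserving u hS.measurePreserving_fst)
  filter_upwards [h1, h2] with p h1 h2
  exact h1.trans (by rw [h2]; rfl)

theorem embed_toLp {u : E d → ℝ} (hu : MemLp u 2 (spaceMeasure fSt)) :
    hS.embed hu.toLp = hS.ofMultiplier fun p => u p.1 := by
  rw [hS.ofMultiplier_eq (hS.memLp_comp_fst hu), embed]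
  rfl

/-- The coefficient `⟨f⟩ / ⟨fSt⟩` of the projection onto local equilibria. -/
def localDensity : WL2 fSt →L[ℝ] SL2 fSt :=
  ContinuousLinearMap.adjoint hS.embed.toContinuousLinearMap

theorem inner_localDensity (f : WL2 fSt) (u : SL2 fSt) :
    inner ℝ (hS.localDensity f) u = inner ℝ f (hS.embed u) :=
  ContinuousLinearMap.adjoint_inner_left _ _ _

theorem localDensity_embed (u : SL2 fSt) : hS.localDensity (hS.embed u) = u := by
  have := LinearIsometry.adjoint_comp_self (𝕜 := ℝ) hS.embed
  exact congrArg (fun L => L u) this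

/-- The distance to local equilibria, `f - ⟨f⟩ fSt / ⟨fSt⟩`. -/
def micro (f : WL2 fSt) : WL2 fSt := f - hS.embed (hS.localDensity f)

theorem inner_micro_embed (f : WL2 fSt) (u : SL2 fSt) :
    inner ℝ (hS.micro f) (hS.embed u) = 0 := by
  rw [← hS.inner_localDensity, micro, map_sub, hS.localDensity_embed, sub_self, inner_zero_left]

theorem norm_sq_eq_localDensity_add_micro (f : WL2 fSt) :
    ‖f‖ ^ 2 = ‖hS.localDensity f‖ ^ 2 + ‖hS.micro f‖ ^ 2 := by
  have h : f = hS.micro f + hS.embed (hS.localDensity f) := by simp [micro]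
  have h2 := norm_add_sq_real (hS.micro f) (hS.embed (hS.localDensity f))
  rw [← h, hS.inner_micro_embed, LinearIsometry.norm_map] at h2
  linarith

theorem continuous_micro : Continuous hS.micro := by
  unfold micro
  exact continuous_id.sub (hS.embed.continuous.comp hS.localDensity.continuous)

/-- Identifies the abstract adjoint of `embed` with the quotient of densities, by testing both
against indicators of sets of positions. -/
theorem localDensity_ae (f : WL2 fSt) : ∀ᵐ x, hS.localDensity f x =
    density (fun x v => f (x, v)) x / density fSt x := by
  have := hS.isProbabilityMeasure_space
  refine hS.ae_space.1 (Integrable.ae_eq_of_forall_setIntegral_eq _ _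
    ((Lp.memLp (hS.localDensity f)).integrable one_le_two) ?_ ?_)
  · rw [spaceMeasure, integrable_withDensity_ofReal hS.measurable_density hS.density_pos]
    refine ((Measure.volume_eq_prod (E d) (E d) ▸ hS.integrable_coe f).integral_prod_left).congr
      (.of_forall fun x => ?_)
    have := (hS.density_pos x).ne'
    simp only [density] at this ⊢
    field_simp
  · intro s hs _
    have hmem : MemLp (s.indicator fun _ => (1 : ℝ)) 2 (spaceMeasure fSt) :=
      (_root_.MeasureTheory.memLp_const (1 : ℝ)).indicator hs
    have hms := hS.memLp_comp_fst hmem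
    have h1 := hS.inner_localDensity f hmem.toLp
    rw [hS.embed_toLp, hS.inner_ofMultiplier f hms, L2.inner_def] at h1
    have h2 : ∫ x in s, hS.localDensity f x ∂(spaceMeasure fSt) =
        ∫ x, inner ℝ (hS.localDensity f x) (hmem.toLp _ x) ∂(spaceMeasure fSt) := by
      rw [← integral_indicator hs]
      refine integral_congr_ae ?_
      filter_upwards [hmem.coeFn_toLp] with x hx
      by_cases hxs : x ∈ s <;> simp [hx, hxs]
    have hI := hS.integrable_mul f hms
    rw [h2, h1, ← integral_indicator hs, hS.integral_space]
    rw [Measure.volume_eq_prod] at hI ⊢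
    rw [integral_prod _ hI]
    refine integral_congr_ae (.of_forall fun x => ?_)
    have := (hS.density_pos x).ne'
    by_cases hxs : x ∈ s
    · simp only [hxs, Set.indicator_of_mem, mul_one]
      field_simp
      rfl
    · simp [hxs]

end StationaryState

end

end Kinetic


namespace Kinetic

noncomputable section

/-! ### The collision operators and their adjoints in velocity -/

section Collisions

variable {d : ℕ}

theorem gradient_apply (a : E d → ℝ) (v : E d) (i : Fin d) :
    (gradient a v) i = fderiv ℝ a v (EuclideanSpace.single i 1) := by
  rw [← inner_gradient_right, EuclideanSpace.inner_single_left]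
  simp

theorem contDiff_gradient_slice {F : E d → E d → ℝ}
    (h : ContDiff ℝ 2 (fun p : E d × E d => F p.1 p.2)) :
    ContDiff ℝ 1 fun p : E d × E d => gradient (F p.1) p.2 := by
  rw [contDiff_euclidean]
  intro i
  simp only [gradient_apply]
  exact (contDiff_fderiv_slice_right h).clm_apply contDiff_const

theorem contDiff_gradient {a : E d → ℝ} (h : ContDiff ℝ 2 a) : ContDiff ℝ 1 (gradient a) := by
  have : ContDiff ℝ 2 (fun p : E d × E d => (fun _ v => a v : E d → E d → ℝ) p.1 p.2) :=
    h.comp contDiff_snd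
  exact contDiff_slice_right (F := fun _ v => gradient a v) (contDiff_gradient_slice (F := fun (_ : E d) v => a v) this)
    (0 : E d)

/-- The Fokker-Planck flux `M ∇_v (g / M)`. -/
def flux (M g : E d → E d → ℝ) (x v : E d) : E d :=
  M x v • gradient (fun u => g x u / M x u) v

variable {M g : E d → E d → ℝ}

theorem contDiff_flux (hM : ContDiff ℝ 2 (fun p : E d × E d => M p.1 p.2))
    (hpos : ∀ x v, 0 < M x v) (hg : ContDiff ℝ 2 (fun p : E d × E d => g p.1 p.2)) :
    ContDiff ℝ 1 fun p : E d × E d => flux M g p.1 p.2 := by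
  unfold flux
  refine (hM.of_le one_le_two).smul ?_
  exact contDiff_gradient_slice (F := fun x u => g x u / M x u)
    (hg.div hM fun p => (hpos _ _).ne')

theorem hasCompactSupport_flux {x : E d} (hc : HasCompactSupport (g x)) :
    HasCompactSupport (flux M g x) := by
  have h1 : HasCompactSupport (fun u => g x u / M x u) :=
    hc.mono fun u hu => by
      contrapose! hu
      simp at hu ⊢
      simp [hu]
  refine (h1.fderiv (𝕜 := ℝ)).mono fun u hu => ?_
  contrapose! hu
  simp at hu
  simp [flux, gradient, hu]

/-- The adjoint of the collision operator with respect to `dv`. -/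
def collisionAdjoint (c : Collision) (M : E d → E d → ℝ) (a : E d → ℝ) (x v : E d) : ℝ :=
  match c with
  | Collision.FP => divergence (fun u => M x u • gradient a u) v / M x v
  | Collision.BGK => (∫ u, M x u * a u) - a v

theorem integral_divergence_flux_mul (hM : ContDiff ℝ 2 (fun p : E d × E d => M p.1 p.2))
    (hpos : ∀ x v, 0 < M x v) (hg : ContDiff ℝ 2 (fun p : E d × E d => g p.1 p.2))
    {a : E d → ℝ} (ha : ContDiff ℝ 1 a) {x : E d}
    (hc : HasCompactSupport (g x) ∨ HasCompactSupport a) :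
    ∫ v, divergence (flux M g x) v * a v =
      - ∫ v, M x v * fderiv ℝ a v (gradient (fun u => g x u / M x u) v) := by
  rw [integral_divergence_mul (contDiff_slice_right (contDiff_flux hM hpos hg) x) ha
    (hc.imp_left hasCompactSupport_flux)]
  simp [flux]

/-- Two integrations by parts, through the symmetric expression `-∫ M ∇a · ∇(g/M)`. Compact support
of either factor suffices; the alternative with `a` compactly supported is what admits `g = fSt`. -/
theorem integral_collision_mul_fp (hM : ContDiff ℝ 2 (fun p : E d × E d => M p.1 p.2))
    (hpos : ∀ x v, 0 < M x v) (hg : ContDiff ℝ 2 (fun p : E d × E d => g p.1 p.2))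
    {a : E d → ℝ} (ha : ContDiff ℝ 2 a) {x : E d}
    (hc : HasCompactSupport (g x) ∨ HasCompactSupport a) :
    ∫ v, collision Collision.FP M g x v * a v =
      ∫ v, g x v * collisionAdjoint Collision.FP M a x v := by
  have ha1 : ContDiff ℝ 1 a := ha.of_le one_le_two
  have hMx : ContDiff ℝ 1 (M x) := (contDiff_slice_right hM x).of_le one_le_two
  have hq : ContDiff ℝ 1 fun u => g x u / M x u :=
    ((contDiff_slice_right hg x).of_le one_le_two).div hMx fun v => (hpos x v).ne'
  have hV : ContDiff ℝ 1 fun u => M x u • gradient a u := hMx.smul (contDiff_gradient ha)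
  have h1 := integral_divergence_flux_mul hM hpos hg ha1 hc
  have h2 := integral_divergence_mul hV hq (by
    rcases hc with h | h
    · right
      refine h.mono fun u hu => ?_
      contrapose! hu
      simp at hu ⊢
      simp [hu]
    · left
      refine (h.fderiv (𝕜 := ℝ)).mono fun u hu => ?_
      contrapose! hu
      simp at hu
      simp [gradient, hu])
  calc ∫ v, collision Collision.FP M g x v * a v
      = ∫ v, divergence (flux M g x) v * a v := rfl
    _ = - ∫ v, fderiv ℝ (fun u => g x u / M x u) v (M x v • gradient a v) := by
        rw [h1]
        congr 1
        refine integral_congr_ae (.of_forall fun v => ?_)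
        simp only [map_smul, smul_eq_mul]
        rw [← inner_gradient_left a, ← inner_gradient_right (fun u => g x u / M x u)]
    _ = _ := by
        rw [← h2]
        refine integral_congr_ae (.of_forall fun v => ?_)
        simp only [collisionAdjoint]
        ring

/-- Both sides equal `⟨g⟩ ∫ M a - ∫ g a`. No derivative occurs, so integrability of `g` and
boundedness of `a` are enough; this covers `g = fSt` and `a = 1`. -/
theorem integral_collision_mul_bgk (hint : ∀ x, Integrable (fun v => M x v)) {x : E d}
    (hgi : Integrable (g x)) {a : E d → ℝ} {C : ℝ}
    (ha : Continuous a) (hC : ∀ v, ‖a v‖ ≤ C) :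
    ∫ v, collision Collision.BGK M g x v * a v =
      ∫ v, g x v * collisionAdjoint Collision.BGK M a x v := by
  have i1 : Integrable fun v => M x v * a v :=
    (hint x).mul_bdd (c := C) ha.aestronglyMeasurable (.of_forall hC)
  have i2 : Integrable fun v => g x v * a v :=
    hgi.mul_bdd (c := C) ha.aestronglyMeasurable (.of_forall hC)
  calc ∫ v, collision Collision.BGK M g x v * a v
      = ∫ v, (density g x * (M x v * a v) - g x v * a v) := by
        refine integral_congr_ae (.of_forall fun v => ?_)
        simp only [collision]
        ring
    _ = density g x * (∫ v, M x v * a v) - ∫ v, g x v * a v := by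
        rw [integral_sub (i1.const_mul _) i2, integral_const_mul]
    _ = ∫ v, (g x v * (∫ u, M x u * a u) - g x v * a v) := by
        rw [integral_sub (hgi.mul_const _) i2, integral_mul_const, density]
    _ = _ := by
        refine integral_congr_ae (.of_forall fun v => ?_)
        simp only [collisionAdjoint]
        ring

end Collisions

/-! ### Continuity of the collision data -/

section Model

variable {d : ℕ} {c : Collision} {G : E d → E d → E d} {M fSt : E d → E d → ℝ} {cInf cM : ℝ}

theorem Model.contDiff_force (hm : Model c G M) :
    ContDiff ℝ 1 (fun p : E d × E d => G p.1 p.2) :=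
  hm.smooth_force.of_le (by exact_mod_cast le_top)

theorem StationaryState.continuous_collision (hS : StationaryState c G M fSt cInf cM)
    (hm : Model c G M) : Continuous fun p : E d × E d => collision c M fSt p.1 p.2 := by
  have := continuous_transport hm.contDiff_force hS.regular
  refine this.congr fun p => hS.stationary _ _

/-- For BGK only measurability of `M` is assumed. Stationarity equates the collision term with a
continuous transport term, and solving for `M = (L fSt + fSt)/⟨fSt⟩` shows that `M` is continuous.
-/
theorem StationaryState.continuous_mass (hS : StationaryState c G M fSt cInf cM)
    (hm : Model c G M) : Continuous fun p : E d × E d => M p.1 p.2 := by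
  cases c with
  | FP => exact (hm.fp_regular rfl).1.continuous
  | BGK =>
    have h := hS.continuous_collision hm
    have h2 : Continuous fun p : E d × E d =>
        (collision Collision.BGK M fSt p.1 p.2 + fSt p.1 p.2) / density fSt p.1 :=
      (h.add hS.regular.continuous).div
        (hS.density_regular.continuous.comp continuous_fst) fun p => (hS.density_pos _).ne'
    refine h2.congr fun p => ?_
    have := (hS.density_pos p.1).ne'
    simp only [collision]
    field_simp
    ring

theorem continuous_integral_mul_of_hasCompactSupport {X : Type*} [TopologicalSpace X]
    [FirstCountableTopology X] [LocallyCompactSpace X]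
    {W : Type*} [NormedAddCommGroup W] [NormedSpace ℝ W] {F : X → E d → ℝ}
    (hF : Continuous fun p : X × E d => F p.1 p.2) {k : E d → W} (hk : Continuous k)
    (hc : HasCompactSupport k) : Continuous fun x => ∫ v, F x v • k v := by
  have h := continuous_parametric_integral_of_continuous (μ := (volume : Measure (E d)))
    (f := fun x v => F x v • k v) (hF.smul (hk.comp continuous_snd)) hc.isCompact
  refine h.congr fun x => ?_
  refine setIntegral_eq_integral_of_forall_compl_eq_zero fun v hv => ?_
  simp [image_eq_zero_of_notMem_tsupport hv]

theorem continuous_collisionAdjoint (hS : StationaryState c G M fSt cInf cM)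
    (hm : Model c G M) {a : E d → ℝ} (ha : ContDiff ℝ 2 a) (hc : HasCompactSupport a) :
    Continuous fun p : E d × E d => collisionAdjoint c M a p.1 p.2 := by
  have hMc := hS.continuous_mass hm
  cases c with
  | FP =>
    obtain ⟨h1, h2⟩ := hm.fp_regular rfl
    unfold collisionAdjoint
    refine (continuous_divergence_slice (V := fun x u => M x u • gradient a u) ?_).div hMc
      fun p => (h2 _ _).ne'
    exact (h1.of_le one_le_two).smul ((contDiff_gradient ha).comp contDiff_snd)
  | BGK =>
    unfold collisionAdjoint
    have := continuous_integral_mul_of_hasCompactSupport (F := M) hMc ha.continuous hc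
    simp only [smul_eq_mul] at this
    exact (this.comp continuous_fst).sub (ha.continuous.comp continuous_snd)

end Model

end

end Kinetic


namespace Kinetic

noncomputable section

/-! ### Weak form of the generator and of its closure -/

section Graph

variable {d : ℕ} {c : Collision} {G : E d → E d → E d} {M fSt : E d → E d → ℝ} {cInf cM : ℝ}

/-- The zeroth order part of the adjoint equation for a velocity profile `a`. -/
def velocityAdjoint (c : Collision) (G : E d → E d → E d) (M : E d → E d → ℝ) (a : E d → ℝ)
    (x v : E d) : ℝ :=
  fderiv ℝ a v (G x v) + collisionAdjoint c M a x v

theorem continuous_velocityAdjoint (hS : StationaryState c G M fSt cInf cM)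
    (hm : Model c G M) {a : E d → ℝ} (ha : ContDiff ℝ 2 a) (hc : HasCompactSupport a) :
    Continuous fun p : E d × E d => velocityAdjoint c G M a p.1 p.2 := by
  have h1 := ha.continuous_fderiv two_ne_zero
  have h2 := hm.contDiff_force.continuous
  exact ((h1.comp continuous_snd).clm_apply h2).add (continuous_collisionAdjoint hS hm ha hc)

theorem divergence_smul_gradient_eq_zero {a : E d → ℝ} {x v : E d} (hv : v ∉ tsupport a) :
    divergence (fun u => M x u • gradient a u) v = 0 := by
  refine divergence_eq_zero_of_notMem fun h => hv ?_
  refine closure_minimal ?_ (isClosed_tsupport a) h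
  intro u hu
  by_contra h0
  have : fderiv ℝ a u = 0 := by
    by_contra h1
    exact h0 (support_fderiv_subset ℝ h1)
  simp [gradient, this] at hu

/-- The bound is uniform over all velocities. For Fokker-Planck the adjoint is supported where `a`
is; for BGK it has a tail constant in `v`, bounded because `M(x,·)` has mass one. -/
theorem exists_bound_collisionAdjoint (hS : StationaryState c G M fSt cInf cM)
    (hm : Model c G M) {a : E d → ℝ} (ha : ContDiff ℝ 2 a) (hc : HasCompactSupport a)
    {K : Set (E d)} (hK : IsCompact K) :
    ∃ C, ∀ x ∈ K, ∀ v, |collisionAdjoint c M a x v| ≤ C := by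
  have hcont := continuous_collisionAdjoint hS hm ha hc
  obtain ⟨C, hC⟩ := (hK.prod hc.isCompact).exists_bound_of_continuousOn hcont.continuousOn
  cases c with
  | FP =>
    refine ⟨max C 0, fun x hx v => ?_⟩
    by_cases hv : v ∈ tsupport a
    · exact (hC (x, v) ⟨hx, hv⟩).trans (le_max_left _ _)
    · simp [collisionAdjoint, divergence_smul_gradient_eq_zero hv]
  | BGK =>
    obtain ⟨C', hC'⟩ := ha.continuous.bounded_above_of_compact_support hc
    refine ⟨C' + C', fun x _ v => ?_⟩
    have h1 : |∫ u, M x u * a u| ≤ C' := by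
      have h := norm_integral_le_of_norm_le ((hm.integrable x).mul_const C')
        (f := fun u => M x u * a u) (.of_forall fun u => by
          rw [norm_mul, Real.norm_of_nonneg (hm.nonneg x u)]
          exact mul_le_mul_of_nonneg_left (hC' u) (hm.nonneg x u))
      rwa [integral_mul_const, hm.mass, one_mul] at h
    exact (abs_sub _ _).trans (add_le_add h1 (hC' v))

theorem exists_bound_velocityAdjoint (hS : StationaryState c G M fSt cInf cM)
    (hm : Model c G M) {a : E d → ℝ} (ha : ContDiff ℝ 2 a) (hc : HasCompactSupport a)
    {K : Set (E d)} (hK : IsCompact K) :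
    ∃ C, ∀ x ∈ K, ∀ v, |velocityAdjoint c G M a x v| ≤ C := by
  obtain ⟨C, hC⟩ := exists_bound_collisionAdjoint hS hm ha hc hK
  have h1 : Continuous fun p : E d × E d => fderiv ℝ a p.2 (G p.1 p.2) :=
    ((ha.continuous_fderiv two_ne_zero).comp continuous_snd).clm_apply
      hm.contDiff_force.continuous
  obtain ⟨C', hC'⟩ := (hK.prod hc.isCompact).exists_bound_of_continuousOn h1.continuousOn
  refine ⟨max C' 0 + C, fun x hx v => (abs_add_le _ _).trans (add_le_add ?_ (hC x hx v))⟩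
  by_cases hv : v ∈ tsupport a
  · exact (hC' (x, v) ⟨hx, hv⟩).trans (le_max_left _ _)
  · have : fderiv ℝ a v = 0 := by
      by_contra h1
      exact hv (support_fderiv_subset ℝ h1)
    simp [this]

/-- The adjoint equation applied to the product `a(v) z(x)`. -/
def productAdjoint (c : Collision) (G : E d → E d → E d) (M : E d → E d → ℝ) (a z : E d → ℝ)
    (p : E d × E d) : ℝ :=
  a p.2 * fderiv ℝ z p.1 p.2 + z p.1 * velocityAdjoint c G M a p.1 p.2

theorem memLp_product (hS : StationaryState c G M fSt cInf cM) {a z : E d → ℝ}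
    (ha : Continuous a) (hac : HasCompactSupport a) (hz : Continuous z)
    (hzc : HasCompactSupport z) :
    MemLp (fun p : E d × E d => a p.2 * z p.1) 2 (phaseMeasure fSt) := by
  obtain ⟨A, hA⟩ := ha.bounded_above_of_compact_support hac
  obtain ⟨B, hB⟩ := hz.bounded_above_of_compact_support hzc
  have h : Continuous fun p : E d × E d => a p.2 * z p.1 := by fun_prop
  refine hS.memLp_of_bound (C := A * B) h.aestronglyMeasurable fun p => ?_
  rw [abs_mul]
  exact mul_le_mul (hA _) (hB _) (abs_nonneg _) ((norm_nonneg _).trans (hA 0))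

theorem memLp_productAdjoint (hS : StationaryState c G M fSt cInf cM) (hm : Model c G M)
    {a z : E d → ℝ} (ha : ContDiff ℝ 2 a) (hac : HasCompactSupport a) (hz : ContDiff ℝ 1 z)
    (hzc : HasCompactSupport z) :
    MemLp (productAdjoint c G M a z) 2 (phaseMeasure fSt) := by
  have c0 : Continuous fun p : E d × E d => a p.2 * fderiv ℝ z p.1 p.2 :=
    (ha.continuous.comp continuous_snd).mul
      (((hz.continuous_fderiv one_ne_zero).comp continuous_fst).clm_apply continuous_snd)
  have k0 : HasCompactSupport fun p : E d × E d => a p.2 * fderiv ℝ z p.1 p.2 := by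
    refine HasCompactSupport.intro (hzc.isCompact.prod hac.isCompact) fun p hp => ?_
    by_cases h2 : p.2 ∈ tsupport a
    · have h1 : p.1 ∉ tsupport z := fun h1 => hp ⟨h1, h2⟩
      have : fderiv ℝ z p.1 = 0 := by
        by_contra h3
        exact h1 (support_fderiv_subset ℝ h3)
      simp [this]
    · simp [image_eq_zero_of_notMem_tsupport h2]
  obtain ⟨A, hA⟩ := c0.bounded_above_of_compact_support k0
  obtain ⟨B, hB⟩ := hz.continuous.bounded_above_of_compact_support hzc
  obtain ⟨C, hC⟩ := exists_bound_velocityAdjoint hS hm ha hac hzc.isCompact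
  have h : Continuous (productAdjoint c G M a z) :=
    c0.add ((hz.continuous.comp continuous_fst).mul (continuous_velocityAdjoint hS hm ha hac))
  refine hS.memLp_of_bound (C := A + B * max C 0) h.aestronglyMeasurable fun p => ?_
  refine (abs_add_le _ _).trans (add_le_add (hA p) ?_)
  rw [abs_mul]
  by_cases h1 : p.1 ∈ tsupport z
  · exact mul_le_mul (hB _) ((hC _ h1 _).trans (le_max_left _ _)) (abs_nonneg _)
      ((norm_nonneg _).trans (hB 0))
  · rw [image_eq_zero_of_notMem_tsupport h1]
    have := (norm_nonneg _).trans (hB 0)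
    simp only [abs_zero, zero_mul]
    positivity

theorem alongField_product {a z : E d → ℝ} (ha : Differentiable ℝ a) (hz : Differentiable ℝ z)
    (x v : E d) : alongField G (fun x v => a v * z x) x v =
      a v * fderiv ℝ z x v + z x * fderiv ℝ a v (G x v) := by
  unfold alongField
  rw [fderiv_const_mul (hz x), fderiv_mul_const (ha v)]
  simp

variable {φ : E d → E d → ℝ}

theorem contDiff_of_smooth (h : ContDiff ℝ (⊤ : ℕ∞) (Function.uncurry φ)) (n : ℕ) :
    ContDiff ℝ n (fun p : E d × E d => φ p.1 p.2) :=
  h.of_le (by exact_mod_cast le_top)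

theorem integral_collision_mul (hm : Model c G M)
    (h : ContDiff ℝ (⊤ : ℕ∞) (Function.uncurry φ)) (hφc : HasCompactSupport (Function.uncurry φ))
    {a : E d → ℝ} (ha : ContDiff ℝ 2 a) {C : ℝ} (hC : ∀ v, ‖a v‖ ≤ C) (x : E d) :
    ∫ v, collision c M φ x v * a v = ∫ v, φ x v * collisionAdjoint c M a x v := by
  have hx : HasCompactSupport (φ x) := hasCompactSupport_slice_right (F := φ) hφc x
  cases c with
  | FP =>
    obtain ⟨h1, h2⟩ := hm.fp_regular rfl
    exact integral_collision_mul_fp h1 h2 (contDiff_of_smooth h 2) ha (Or.inl hx)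
  | BGK =>
    have hx' : Continuous (φ x) :=
      (contDiff_slice_right (F := φ) (contDiff_of_smooth h 1) x).continuous
    exact integral_collision_mul_bgk hm.integrable (hx'.integrable_of_hasCompactSupport hx)
      ha.continuous hC

theorem integrable_transport_mul (hm : Model c G M)
    (h : ContDiff ℝ (⊤ : ℕ∞) (Function.uncurry φ)) (hφc : HasCompactSupport (Function.uncurry φ))
    {m : E d × E d → ℝ} (hmc : Continuous m) :
    Integrable fun p : E d × E d => transport G φ p.1 p.2 * m p := by
  have hφ := contDiff_of_smooth h 1
  refine ((continuous_transport hm.contDiff_force hφ).mul hmc).integrable_of_hasCompactSupport ?_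
  refine HasCompactSupport.intro hφc.isCompact fun p hp => ?_
  show transport G φ p.1 p.2 * m p = 0
  rw [transport, inner_gradient_right, divergence_smul
    ((contDiff_slice_right hφ _).differentiable one_ne_zero _)
    ((contDiff_slice_right hm.contDiff_force _).differentiable one_ne_zero _)]
  have h0 : φ p.1 p.2 = 0 := image_eq_zero_of_notMem_tsupport (f := Function.uncurry φ) hp
  simp [fderiv_slice_left_eq_zero (F := φ) hp, fderiv_slice_right_eq_zero (F := φ) hp, h0]

/-- The weak form of the generator on test functions. -/
theorem inner_of_mem_graph (hS : StationaryState c G M fSt cInf cM) (hm : Model c G M)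
    {q : WL2 fSt × WL2 fSt} (h : ContDiff ℝ (⊤ : ℕ∞) (Function.uncurry φ))
    (hφc : HasCompactSupport (Function.uncurry φ))
    (h2 : q.2 =ᵐ[weightedMeasure fSt] Function.uncurry (generator c G M φ))
    {m : E d × E d → ℝ} (hmm : MemLp m 2 (phaseMeasure fSt)) (hmc : Continuous m) :
    Integrable (fun p : E d × E d => collision c M φ p.1 p.2 * m p) ∧
    inner ℝ q.2 (hS.ofMultiplier m) =
      - (∫ p : E d × E d, transport G φ p.1 p.2 * m p) +
        ∫ p : E d × E d, collision c M φ p.1 p.2 * m p := by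
  have h2' := hS.ae_weighted.1 h2
  have i0 := integrable_transport_mul hm h hφc hmc
  have i1 : Integrable fun p : E d × E d => generator c G M φ p.1 p.2 * m p := by
    refine (hS.integrable_mul q.2 hmm).congr ?_
    filter_upwards [h2'] with p hp
    rw [hp]
    rfl
  -- The BGK collision term of `φ` need not have compact support. Its integrability follows from
  -- that of the whole generator, which is in the weighted `L²`, and of the compactly supported
  -- transport term.
  have i2 : Integrable (fun p : E d × E d => collision c M φ p.1 p.2 * m p) := by
    refine (i1.add i0).congr (.of_forall fun p => ?_)
    simp only [generator, Pi.add_apply]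
    ring
  refine ⟨i2, ?_⟩
  have i3 : Integrable fun p : E d × E d => -(transport G φ p.1 p.2 * m p) := i0.neg
  rw [hS.inner_ofMultiplier q.2 hmm, ← integral_neg, ← integral_add i3 i2]
  refine integral_congr_ae ?_
  filter_upwards [h2'] with p hp
  rw [hp]
  simp only [Function.uncurry, generator]
  ring

theorem inner_weak_of_mem_graph (hS : StationaryState c G M fSt cInf cM) (hm : Model c G M)
    {q : WL2 fSt × WL2 fSt} (hq : q ∈ generatorGraph c G M fSt) {a z : E d → ℝ}
    (ha : ContDiff ℝ 2 a) (hac : HasCompactSupport a) (hz : ContDiff ℝ 1 z)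
    (hzc : HasCompactSupport z) :
    inner ℝ q.2 (hS.ofMultiplier fun p => a p.2 * z p.1) =
      inner ℝ q.1 (hS.ofMultiplier (productAdjoint c G M a z)) := by
  obtain ⟨φ, h, hφc, h1, h2⟩ := hq
  have hφ := contDiff_of_smooth h 1
  have ha1 : ContDiff ℝ 1 a := ha.of_le one_le_two
  have hψ : ContDiff ℝ 1 fun p : E d × E d => a p.2 * z p.1 :=
    (ha1.comp contDiff_snd).mul (hz.comp contDiff_fst)
  obtain ⟨A, hA⟩ := ha.continuous.bounded_above_of_compact_support hac
  obtain ⟨i2, e⟩ := inner_of_mem_graph hS hm h hφc h2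
    (memLp_product hS ha.continuous hac hz.continuous hzc) hψ.continuous
  have ct : Continuous fun p : E d × E d => φ p.1 p.2 *
      alongField G (fun x v => a v * z x) p.1 p.2 :=
    hφ.continuous.mul (continuous_alongField hm.contDiff_force.continuous hψ)
  have it : Integrable fun p : E d × E d => φ p.1 p.2 *
      alongField G (fun x v => a v * z x) p.1 p.2 :=
    ct.integrable_of_hasCompactSupport (HasCompactSupport.mul_right hφc)
  have cc : Continuous fun p : E d × E d => φ p.1 p.2 *
      (z p.1 * collisionAdjoint c M a p.1 p.2) :=
    hφ.continuous.mul ((hz.continuous.comp continuous_fst).mul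
      (continuous_collisionAdjoint hS hm ha hac))
  have ic : Integrable fun p : E d × E d => φ p.1 p.2 *
      (z p.1 * collisionAdjoint c M a p.1 p.2) :=
    cc.integrable_of_hasCompactSupport (HasCompactSupport.mul_right hφc)
  have ecol : ∫ p : E d × E d, collision c M φ p.1 p.2 * (a p.2 * z p.1) =
      ∫ p : E d × E d, φ p.1 p.2 * (z p.1 * collisionAdjoint c M a p.1 p.2) := by
    rw [Measure.volume_eq_prod] at i2 ic ⊢
    rw [integral_prod _ i2, integral_prod _ ic]
    refine integral_congr_ae (.of_forall fun x => ?_)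
    have := integral_collision_mul hm h hφc ha hA x
    calc ∫ v, collision c M φ x v * (a v * z x)
        = (∫ v, collision c M φ x v * a v) * z x := by
          rw [← integral_mul_const]
          exact integral_congr_ae (.of_forall fun v => by ring)
      _ = ∫ v, φ x v * (z x * collisionAdjoint c M a x v) := by
          rw [this, ← integral_mul_const]
          exact integral_congr_ae (.of_forall fun v => by ring)
  rw [e, ecol, integral_transport_mul (ψ := fun x v => a v * z x) hm.contDiff_force hφ hψ
    (Or.inl hφc), neg_neg, ← integral_add it ic,
    hS.inner_ofMultiplier q.1 (memLp_productAdjoint hS hm ha hac hz hzc)]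
  refine integral_congr_ae ?_
  filter_upwards [hS.ae_weighted.1 h1] with p hp
  rw [hp, alongField_product (ha1.differentiable one_ne_zero) (hz.differentiable one_ne_zero)]
  simp only [Function.uncurry, productAdjoint, velocityAdjoint]
  ring

/-- Conservation of mass: the constant `1` is annihilated by the field derivative and by the
collision adjoint, in the BGK case because `M(x,·)` has mass one. -/
theorem inner_one_of_mem_graph (hS : StationaryState c G M fSt cInf cM) (hm : Model c G M)
    {q : WL2 fSt × WL2 fSt} (hq : q ∈ generatorGraph c G M fSt) :
    inner ℝ q.2 (hS.ofMultiplier fun _ => 1) = 0 := by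
  obtain ⟨φ, h, hφc, h1, h2⟩ := hq
  have hφ := contDiff_of_smooth h 1
  obtain ⟨i2, e⟩ := inner_of_mem_graph hS hm h hφc h2 (hS.memLp_const 1) continuous_const
  have h3 : ∫ p : E d × E d, collision c M φ p.1 p.2 * 1 = 0 := by
    rw [Measure.volume_eq_prod] at i2 ⊢
    rw [integral_prod _ i2]
    refine integral_eq_zero_of_ae (.of_forall fun x => ?_)
    have := integral_collision_mul hm h hφc (a := fun _ => 1) contDiff_const (C := 1)
      (by simp) x
    simp only [this, Pi.zero_apply]
    cases c with
    | FP => simp [collisionAdjoint, gradient, divergence]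
    | BGK => simp [collisionAdjoint, hm.mass]
  have h4 := integral_transport_mul (ψ := fun _ _ => 1) hm.contDiff_force hφ contDiff_const
    (Or.inl hφc)
  rw [e, h3, h4]
  simp [alongField]

/-- The test multipliers are fixed elements of `L²`, so the identity is a closed condition on the
pair and survives passage to the closure of the graph. -/
theorem inner_weak_of_mem_closure (hS : StationaryState c G M fSt cInf cM) (hm : Model c G M)
    {q : WL2 fSt × WL2 fSt} (hq : q ∈ closure (generatorGraph c G M fSt)) {a z : E d → ℝ}
    (ha : ContDiff ℝ 2 a) (hac : HasCompactSupport a) (hz : ContDiff ℝ 1 z)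
    (hzc : HasCompactSupport z) :
    inner ℝ q.2 (hS.ofMultiplier fun p => a p.2 * z p.1) =
      inner ℝ q.1 (hS.ofMultiplier (productAdjoint c G M a z)) := by
  refine closure_minimal (t := {q : WL2 fSt × WL2 fSt |
    inner ℝ q.2 (hS.ofMultiplier fun p => a p.2 * z p.1) =
      inner ℝ q.1 (hS.ofMultiplier (productAdjoint c G M a z))})
    (fun q hq => inner_weak_of_mem_graph hS hm hq ha hac hz hzc) ?_ hq
  exact isClosed_eq (by fun_prop) (by fun_prop)

theorem inner_one_of_mem_closure (hS : StationaryState c G M fSt cInf cM) (hm : Model c G M)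
    {q : WL2 fSt × WL2 fSt} (hq : q ∈ closure (generatorGraph c G M fSt)) :
    inner ℝ q.2 (hS.ofMultiplier fun _ => 1) = 0 := by
  refine closure_minimal (t := {q : WL2 fSt × WL2 fSt |
    inner ℝ q.2 (hS.ofMultiplier fun _ => 1) = 0})
    (fun q hq => inner_one_of_mem_graph hS hm hq) ?_ hq
  exact isClosed_eq (by fun_prop) (by fun_prop)

end Graph

end

end Kinetic


namespace Kinetic

noncomputable section

/-! ### Dissipation of the energy by collisions -/

section Dissipation

variable {d : ℕ} {c : Collision} {G : E d → E d → E d} {M fSt : E d → E d → ℝ}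
  {cInf cM lam1 : ℝ} {φ : E d → E d → ℝ}

theorem integral_linear_combination {α : Type*} [MeasurableSpace α] {μ : Measure α}
    {f g h : α → ℝ} (hf : Integrable f μ) (hg : Integrable g μ) (hh : Integrable h μ)
    (r s t : ℝ) : ∫ x, (r * f x - s * g x + t * h x) ∂μ =
      r * (∫ x, f x ∂μ) - s * (∫ x, g x ∂μ) + t * ∫ x, h x ∂μ := by
  have h1 : Integrable (fun x => r * f x - s * g x) μ := (hf.const_mul r).sub (hg.const_mul s)
  rw [integral_add h1 (hh.const_mul t), integral_sub (hf.const_mul r) (hg.const_mul s),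
    integral_const_mul, integral_const_mul, integral_const_mul]

/-- The Fokker-Planck dissipation in the velocity variable. -/
theorem integral_collision_dissipation_fp
    (hS : StationaryState Collision.FP G M fSt cInf cM) (hm : Model Collision.FP G M)
    (h : ContDiff ℝ (⊤ : ℕ∞) (Function.uncurry φ)) (hφc : HasCompactSupport (Function.uncurry φ))
    (x : E d) :
    - (∫ v, collision Collision.FP M φ x v * (φ x v / fSt x v)) +
      1 / 2 * ∫ v, collision Collision.FP M fSt x v * (φ x v / fSt x v) ^ 2 =
    ∫ v, ‖gradient (fun u => φ x u / fSt x u) v‖ ^ 2 * fSt x v := by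
  obtain ⟨hM, hpos⟩ := hm.fp_regular rfl
  have hφ2 := contDiff_of_smooth h 2
  have hf2 := hS.fp_regular rfl
  have hx : HasCompactSupport (φ x) := hasCompactSupport_slice_right (F := φ) hφc x
  set g : E d → ℝ := fun v => φ x v / fSt x v with hg
  have hg1 : ContDiff ℝ 1 g :=
    ((contDiff_slice_right hφ2 x).of_le one_le_two).div (contDiff_slice_right hS.regular x)
      fun v => (hS.pos x v).ne'
  have hgc : HasCompactSupport g := hx.mono fun u hu => by
    contrapose! hu
    simp at hu
    simp [hg, hu]
  have hg2 : ContDiff ℝ 1 fun v => g v ^ 2 := hg1.pow 2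
  have hgc2 : HasCompactSupport fun v => g v ^ 2 := hgc.comp_left (g := fun r : ℝ => r ^ 2) (by simp)
  have hMx : ContDiff ℝ 1 (M x) := (contDiff_slice_right hM x).of_le one_le_two
  have hq : ContDiff ℝ 1 fun u => fSt x u / M x u :=
    (contDiff_slice_right hS.regular x).div hMx fun v => (hpos x v).ne'
  have hp : ContDiff ℝ 1 fun u => φ x u / M x u :=
    ((contDiff_slice_right hφ2 x).of_le one_le_two).div hMx fun v => (hpos x v).ne'
  have e1 := integral_divergence_flux_mul hM hpos hφ2 hg1 (x := x) (Or.inr hgc)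
  have e2 := integral_divergence_flux_mul hM hpos hf2 hg2 (x := x) (Or.inr hgc2)
  have cgrad : Continuous (gradient (fun u => φ x u / M x u)) :=
    (InnerProductSpace.toDual ℝ (E d)).symm.continuous.comp (hp.continuous_fderiv one_ne_zero)
  have cgrad2 : Continuous (gradient (fun u => fSt x u / M x u)) :=
    (InnerProductSpace.toDual ℝ (E d)).symm.continuous.comp (hq.continuous_fderiv one_ne_zero)
  have i1 : Integrable fun v => M x v * fderiv ℝ g v (gradient (fun u => φ x u / M x u) v) := by
    refine (hMx.continuous.mul ((hg1.continuous_fderiv one_ne_zero).clm_apply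
      cgrad)).integrable_of_hasCompactSupport ?_
    refine HasCompactSupport.mul_left ((hgc.fderiv (𝕜 := ℝ)).mono fun u hu => ?_)
    contrapose! hu
    simp at hu
    simp [hu]
  have i2 : Integrable fun v => M x v *
      fderiv ℝ (fun v => g v ^ 2) v (gradient (fun u => fSt x u / M x u) v) := by
    refine (hMx.continuous.mul ((hg2.continuous_fderiv one_ne_zero).clm_apply
      cgrad2)).integrable_of_hasCompactSupport ?_
    refine HasCompactSupport.mul_left ((hgc2.fderiv (𝕜 := ℝ)).mono fun u hu => ?_)
    contrapose! hu
    simp only [Function.mem_support, not_not] at hu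
    simp only [Function.mem_support, not_not]
    rw [hu]
    rfl
  calc _ = (∫ v, M x v * fderiv ℝ g v (gradient (fun u => φ x u / M x u) v)) -
      1 / 2 * ∫ v, M x v *
        fderiv ℝ (fun v => g v ^ 2) v (gradient (fun u => fSt x u / M x u) v) := by
        rw [show (∫ v, collision Collision.FP M φ x v * g v) = _ from e1,
          show (∫ v, collision Collision.FP M fSt x v * g v ^ 2) = _ from e2]
        ring
    _ = _ := by
        rw [← integral_const_mul, ← integral_sub i1 (i2.const_mul _)]
        refine integral_congr_ae (.of_forall fun v => ?_)
        have hgd := hg1.differentiable one_ne_zero v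
        have hqd := hq.differentiable one_ne_zero v
        -- Since `φ = g fSt`, one has `M ∇g · ∇(φ/M) = g M ∇g · ∇(fSt/M) + fSt |∇g|²`. The first
        -- term is cancelled by half of `M ∇(g²) · ∇(fSt/M)`, which leaves the square.
        have e3 : (fun u => φ x u / M x u) = fun u => g u * (fSt x u / M x u) := by
          funext u
          have := (hS.pos x u).ne'
          have := (hpos x u).ne'
          simp only [hg]
          field_simp
        have e4 : fderiv ℝ g v (gradient (fun u => φ x u / M x u) v) =
            g v * fderiv ℝ g v (gradient (fun u => fSt x u / M x u) v) +
              fSt x v / M x v * ‖gradient g v‖ ^ 2 := by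
          rw [← inner_gradient_left g, inner_gradient_right, ← inner_gradient_left g,
            inner_gradient_right, e3, fderiv_fun_mul hgd hqd, ← real_inner_self_eq_norm_sq,
            inner_gradient_right]
          simp
        have e5 : fderiv ℝ (fun v => g v ^ 2) v = (2 * g v) • fderiv ℝ g v := by
          rw [fderiv_fun_pow 2 hgd]
          simp
        have := (hpos x v).ne'
        simp only [e4, e5, _root_.smul_apply, smul_eq_mul]
        field_simp
        ring

/-- The BGK dissipation in the velocity variable. -/
theorem integral_collision_dissipation_bgk
    (hS : StationaryState Collision.BGK G M fSt cInf cM) (hm : Model Collision.BGK G M)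
    (h : ContDiff ℝ (⊤ : ℕ∞) (Function.uncurry φ)) (hφc : HasCompactSupport (Function.uncurry φ))
    (x : E d) :
    0 ≤ 2 * (- (∫ v, collision Collision.BGK M φ x v * (φ x v / fSt x v)) +
      1 / 2 * ∫ v, collision Collision.BGK M fSt x v * (φ x v / fSt x v) ^ 2) ∧
    ∫⁻ v, ∫⁻ v', ENNReal.ofReal
      ((φ x v / fSt x v - φ x v' / fSt x v') ^ 2 * (fSt x v * M x v')) =
    ENNReal.ofReal (2 * (- (∫ v, collision Collision.BGK M φ x v * (φ x v / fSt x v)) +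
      1 / 2 * ∫ v, collision Collision.BGK M fSt x v * (φ x v / fSt x v) ^ 2)) := by
  have hx : HasCompactSupport (φ x) := hasCompactSupport_slice_right (F := φ) hφc x
  have hφx : Continuous (φ x) :=
    (contDiff_slice_right (F := φ) (contDiff_of_smooth h 1) x).continuous
  have hfx : Continuous (fSt x) := (contDiff_slice_right hS.regular x).continuous
  set g : E d → ℝ := fun v => φ x v / fSt x v with hg
  have hgcont : Continuous g := hφx.div hfx fun v => (hS.pos x v).ne'
  have hgc : HasCompactSupport g := hx.mono fun u hu => by
    contrapose! hu
    simp at hu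
    simp [hg, hu]
  have hφg : ∀ v, φ x v = g v * fSt x v := fun v => by
    have := (hS.pos x v).ne'
    simp only [hg]
    field_simp
  obtain ⟨B, hB⟩ := hgcont.bounded_above_of_compact_support hgc
  have hB2 : ∀ v, ‖g v ^ 2‖ ≤ B ^ 2 := fun v => by
    rw [norm_pow]; exact pow_le_pow_left₀ (norm_nonneg _) (hB v) 2
  have hMi := hm.integrable x
  have j1 : Integrable fun v => M x v * g v :=
    hMi.mul_bdd (c := B) hgcont.aestronglyMeasurable (.of_forall hB)
  have j2 : Integrable fun v => M x v * g v ^ 2 :=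
    hMi.mul_bdd (c := B ^ 2) (hgcont.pow 2).aestronglyMeasurable (.of_forall hB2)
  have hfi := hS.integrable_velocity x
  have k1 : Integrable fun v => fSt x v * g v :=
    hfi.mul_bdd (c := B) hgcont.aestronglyMeasurable (.of_forall hB)
  have k2 : Integrable fun v => fSt x v * g v ^ 2 :=
    hfi.mul_bdd (c := B ^ 2) (hgcont.pow 2).aestronglyMeasurable (.of_forall hB2)
  set m1 := ∫ v, M x v * g v with hm1
  set m2 := ∫ v, M x v * g v ^ 2 with hm2
  have inner_int : ∀ v, Integrable fun v' => (g v - g v') ^ 2 * (fSt x v * M x v') := by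
    intro v
    have := ((hMi.const_mul (fSt x v * g v ^ 2)).sub (j1.const_mul (2 * fSt x v * g v))).add
      (j2.const_mul (fSt x v))
    refine this.congr (.of_forall fun v' => ?_)
    simp only [Pi.add_apply, Pi.sub_apply]
    ring
  -- Expanding the square leaves only the mass and the two moments `m1`, `m2` of `g` with respect to
  -- `M(x,·)`; they are finite because `g` is bounded.
  have inner_eq : ∀ v, ∫ v', (g v - g v') ^ 2 * (fSt x v * M x v') =
      fSt x v * g v ^ 2 - 2 * m1 * (fSt x v * g v) + m2 * fSt x v := by
    intro v
    have e : (fun v' => (g v - g v') ^ 2 * (fSt x v * M x v')) = fun v' =>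
        ((fSt x v * g v ^ 2) * M x v' - (2 * fSt x v * g v) * (M x v' * g v')) +
          fSt x v * (M x v' * g v' ^ 2) := by
      funext v'; ring
    rw [e, integral_linear_combination hMi j1 j2, hm.mass, ← hm1, ← hm2]
    ring
  have nonneg : ∀ v v', 0 ≤ (g v - g v') ^ 2 * (fSt x v * M x v') := fun v v' =>
    mul_nonneg (sq_nonneg _) (mul_nonneg (hS.pos x v).le (hm.nonneg x v'))
  have outer_int : Integrable fun v =>
      fSt x v * g v ^ 2 - 2 * m1 * (fSt x v * g v) + m2 * fSt x v :=
    (k2.sub (k1.const_mul _)).add (hfi.const_mul _)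
  have c1 : ∫ v, collision Collision.BGK M φ x v * g v =
      density φ x * m1 - ∫ v, fSt x v * g v ^ 2 := by
    rw [hm1, ← integral_const_mul, ← integral_sub (j1.const_mul _) k2]
    refine integral_congr_ae (.of_forall fun v => ?_)
    simp only [collision, hφg]
    ring
  have c2 : ∫ v, collision Collision.BGK M fSt x v * g v ^ 2 =
      density fSt x * m2 - ∫ v, fSt x v * g v ^ 2 := by
    rw [hm2, ← integral_const_mul, ← integral_sub (j2.const_mul _) k2]
    refine integral_congr_ae (.of_forall fun v => ?_)
    simp only [collision]
    ring
  have c3 : density φ x = ∫ v, fSt x v * g v :=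
    integral_congr_ae (.of_forall fun v => by simp only [hφg]; ring)
  have pos' : ∀ v, 0 ≤ fSt x v * g v ^ 2 - 2 * m1 * (fSt x v * g v) + m2 * fSt x v := by
    intro v
    rw [← inner_eq]
    exact integral_nonneg (nonneg v)
  have total : ∫ v, (fSt x v * g v ^ 2 - 2 * m1 * (fSt x v * g v) + m2 * fSt x v) =
      2 * (- (∫ v, collision Collision.BGK M φ x v * g v) +
        1 / 2 * ∫ v, collision Collision.BGK M fSt x v * g v ^ 2) := by
    have := integral_linear_combination k2 k1 hfi 1 (2 * m1) m2
    simp only [one_mul] at this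
    rw [this, c1, c2, c3]
    simp only [density]
    ring
  refine ⟨total ▸ integral_nonneg pos', ?_⟩
  calc ∫⁻ v, ∫⁻ v', ENNReal.ofReal ((g v - g v') ^ 2 * (fSt x v * M x v'))
      = ∫⁻ v, ENNReal.ofReal (fSt x v * g v ^ 2 - 2 * m1 * (fSt x v * g v) + m2 * fSt x v) := by
        refine lintegral_congr fun v => ?_
        rw [← ofReal_integral_eq_lintegral_ofReal (inner_int v) (.of_forall (nonneg v)),
          inner_eq]
    _ = _ := by
        rw [← ofReal_integral_eq_lintegral_ofReal outer_int (.of_forall pos'), total]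

/-- Local coercivity is stated with integrals in `[0,∞]`; for a test function all of them are
finite, and this is its form with real integrals. The term with `fSt` and the square of `φ/fSt` is
the one that the transport operator will supply. -/
theorem integral_collision_dissipation_ge
    (hS : StationaryState c G M fSt cInf cM) (hm : Model c G M)
    (hL : LocalCoercivity c M fSt lam1) (hlam : 0 < lam1)
    (h : ContDiff ℝ (⊤ : ℕ∞) (Function.uncurry φ)) (hφc : HasCompactSupport (Function.uncurry φ))
    (x : E d) :
    ∫ v, (φ x v - density φ x * (fSt x v / density fSt x)) ^ 2 / fSt x v ≤
      lam1 * (- (∫ v, collision c M φ x v * (φ x v / fSt x v)) +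
        1 / 2 * ∫ v, collision c M fSt x v * (φ x v / fSt x v) ^ 2) := by
  have hx : HasCompactSupport (φ x) := hasCompactSupport_slice_right (F := φ) hφc x
  have hφx : ContDiff ℝ (⊤ : ℕ∞) (φ x) := contDiff_slice_right (F := φ) h x
  have hfx : ContDiff ℝ 1 (fSt x) := contDiff_slice_right hS.regular x
  have key := hL x (φ x) hφx hx
  have cont : Continuous fun v =>
      (φ x v - density φ x * (fSt x v / density fSt x)) ^ 2 / fSt x v :=
    ((hφx.continuous.sub (continuous_const.mul (hfx.continuous.div_const _))).pow 2).div
      hfx.continuous fun v => (hS.pos x v).ne'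
  have hpos : ∀ v, 0 ≤ (φ x v - density φ x * (fSt x v / density fSt x)) ^ 2 / fSt x v :=
    fun v => div_nonneg (sq_nonneg _) (hS.pos x v).le
  rw [integral_eq_lintegral_of_nonneg_ae (.of_forall hpos) cont.aestronglyMeasurable]
  cases c with
  | FP =>
    have e := integral_collision_dissipation_fp hS hm h hφc x
    rw [e]
    set D := ∫ v, ‖gradient (fun u => φ x u / fSt x u) v‖ ^ 2 * fSt x v with hD
    have hD0 : 0 ≤ D := integral_nonneg fun v => mul_nonneg (sq_nonneg _) (hS.pos x v).le
    have hg1 : ContDiff ℝ 1 fun u => φ x u / fSt x u :=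
      (hφx.of_le (by exact_mod_cast le_top)).div hfx fun v => (hS.pos x v).ne'
    have hgc : HasCompactSupport fun u => φ x u / fSt x u := hx.mono fun u hu => by
      contrapose! hu
      simp at hu
      simp [hu]
    have hi : Integrable fun v => ‖gradient (fun u => φ x u / fSt x u) v‖ ^ 2 * fSt x v := by
      have cg : Continuous (gradient (fun u => φ x u / fSt x u)) :=
        (InnerProductSpace.toDual ℝ (E d)).symm.continuous.comp
          (hg1.continuous_fderiv one_ne_zero)
      refine ((cg.norm.pow 2).mul hfx.continuous).integrable_of_hasCompactSupport ?_
      refine HasCompactSupport.mul_right ((hgc.fderiv (𝕜 := ℝ)).mono fun u hu => ?_)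
      contrapose! hu
      simp only [Function.mem_support, not_not] at hu
      simp [gradient, hu]
    simp only at key
    rw [← ofReal_integral_eq_lintegral_ofReal hi
      (.of_forall fun v => mul_nonneg (sq_nonneg _) (hS.pos x v).le), ← hD,
      ← ENNReal.ofReal_mul hlam.le] at key
    exact ENNReal.toReal_le_of_le_ofReal (mul_nonneg hlam.le hD0) key
  | BGK =>
    obtain ⟨hD0, e⟩ := integral_collision_dissipation_bgk hS hm h hφc x
    simp only at key
    rw [e, ← ENNReal.ofReal_mul (by positivity)] at key
    -- The double integral is twice the dissipation, which compensates the factor `lam1 / 2` of the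
    -- hypothesis.
    refine (ENNReal.toReal_le_of_le_ofReal (by positivity) key).trans (le_of_eq ?_)
    ring

/-- In `-⟨A φ, φ⟩` the transport term equals `1/2 ∫ L fSt (φ/fSt)²` by stationarity. Together with
the collision term this is the dissipation at each position, and local coercivity is then integrated
over `x`. -/
theorem norm_micro_sq_le_of_mem_graph (hS : StationaryState c G M fSt cInf cM)
    (hm : Model c G M) (hL : LocalCoercivity c M fSt lam1) (hlam : 0 < lam1)
    {q : WL2 fSt × WL2 fSt} (hq : q ∈ generatorGraph c G M fSt) :
    ‖hS.micro q.1‖ ^ 2 ≤ - lam1 * inner ℝ q.2 q.1 := by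
  obtain ⟨φ, h, hφc, h1, h2⟩ := hq
  have h1' : ∀ᵐ p : E d × E d, q.1 p = φ p.1 p.2 := hS.ae_weighted.1 h1
  have hφ := contDiff_of_smooth h 1
  set g : E d → E d → ℝ := fun x v => φ x v / fSt x v with hg
  have hg1 : ContDiff ℝ 1 fun p : E d × E d => g p.1 p.2 :=
    hφ.div hS.regular fun p => (hS.pos _ _).ne'
  have hgc : HasCompactSupport fun p : E d × E d => g p.1 p.2 := hφc.mono fun p hp => by
    contrapose! hp
    simp only [Function.mem_support, not_not, Function.uncurry] at hp
    simp [hg, hp]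
  have hg2 : ContDiff ℝ 1 fun p : E d × E d => g p.1 p.2 ^ 2 := hg1.pow 2
  have hgc2 : HasCompactSupport fun p : E d × E d => g p.1 p.2 ^ 2 :=
    hgc.comp_left (g := fun r : ℝ => r ^ 2) (by simp)
  obtain ⟨B, hB⟩ := hg1.continuous.bounded_above_of_compact_support hgc
  have hmem : MemLp (fun p : E d × E d => g p.1 p.2) 2 (phaseMeasure fSt) :=
    hS.memLp_of_bound hg1.continuous.aestronglyMeasurable hB
  have hq1 : q.1 = hS.ofMultiplier fun p => g p.1 p.2 := by
    refine Lp.ext (hS.ae_weighted.2 ?_)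
    filter_upwards [h1', hS.ofMultiplier_ae hmem] with p hp1 hp2
    have := (hS.pos p.1 p.2).ne'
    rw [hp1, hp2, hg]
    field_simp
  obtain ⟨i2, e⟩ := inner_of_mem_graph hS hm h hφc h2 hmem hg1.continuous
  have i3 : Integrable fun p : E d × E d => collision c M fSt p.1 p.2 * g p.1 p.2 ^ 2 :=
    ((hS.continuous_collision hm).mul hg2.continuous).integrable_of_hasCompactSupport
      hgc2.mul_left
  -- Along characteristics `φ g' = fSt g g' = 1/2 fSt (g²)'` with `g = φ/fSt`. The derivative is
  -- moved back onto `fSt`, whose transport is its collision term.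
  have etr : ∫ p : E d × E d, transport G φ p.1 p.2 * g p.1 p.2 =
      1 / 2 * ∫ p : E d × E d, collision c M fSt p.1 p.2 * g p.1 p.2 ^ 2 := by
    have e1 := integral_transport_mul hm.contDiff_force hφ hg1 (Or.inl hφc)
    have e2 := integral_transport_mul (ψ := fun x v => g x v ^ 2) hm.contDiff_force hS.regular
      hg2 (Or.inr hgc2)
    simp only [hS.stationary] at e2
    rw [e1, e2, mul_neg, ← integral_const_mul]
    congr 1
    refine integral_congr_ae (.of_forall fun p => ?_)
    have d1 := (contDiff_slice_left hg1 p.2).differentiable one_ne_zero p.1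
    have d2 := (contDiff_slice_right hg1 p.1).differentiable one_ne_zero p.2
    have := (hS.pos p.1 p.2).ne'
    simp only [alongField]
    rw [fderiv_fun_pow 2 d1, fderiv_fun_pow 2 d2]
    simp only [Nat.reduceSub, pow_one, _root_.smul_apply, smul_eq_mul, nsmul_eq_mul,
      Nat.cast_ofNat, hg]
    field_simp
  have emic : ∀ᵐ p : E d × E d, hS.micro q.1 p =
      φ p.1 p.2 - density φ p.1 * (fSt p.1 p.2 / density fSt p.1) := by
    have a1 : ∀ᵐ x : E d, density (fun x v => q.1 (x, v)) x = density φ x := by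
      rw [Measure.volume_eq_prod] at h1'
      filter_upwards [Measure.ae_ae_of_ae_prod h1'] with x hx
      exact integral_congr_ae hx
    have a2 : ∀ᵐ x : E d, hS.localDensity q.1 x = density φ x / density fSt x := by
      filter_upwards [a1, hS.localDensity_ae q.1] with x hx1 hx2
      rw [hx2, hx1]
    have a3 : ∀ᵐ p : E d × E d, hS.localDensity q.1 p.1 = density φ p.1 / density fSt p.1 :=
      Measure.quasiMeasurePreserving_fst.ae a2
    have a4 := hS.ae_weighted.1 (Lp.coeFn_sub q.1 (hS.embed (hS.localDensity q.1)))
    filter_upwards [h1', a3, a4, hS.embed_ae (hS.localDensity q.1)] with p p1 p3 p4 p5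
    rw [StationaryState.micro, p4, Pi.sub_apply, p1, p5, p3]
    ring
  have imic : Integrable fun p : E d × E d =>
      (φ p.1 p.2 - density φ p.1 * (fSt p.1 p.2 / density fSt p.1)) ^ 2 / fSt p.1 p.2 := by
    refine ((hS.memLp_weighted.1 (Lp.memLp (hS.micro q.1))).2).congr ?_
    filter_upwards [emic] with p hp
    rw [hp, div_eq_inv_mul _ (fSt p.1 p.2)]
  have enorm : ‖hS.micro q.1‖ ^ 2 = ∫ p : E d × E d,
      (φ p.1 p.2 - density φ p.1 * (fSt p.1 p.2 / density fSt p.1)) ^ 2 / fSt p.1 p.2 := by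
    rw [norm_sq_eq_integral, hS.integral_weighted]
    refine integral_congr_ae ?_
    filter_upwards [emic] with p hp
    rw [hp, div_eq_inv_mul _ (fSt p.1 p.2)]
  have efin : - lam1 * inner ℝ q.2 q.1 = lam1 *
      (- (∫ p : E d × E d, collision c M φ p.1 p.2 * g p.1 p.2) +
        1 / 2 * ∫ p : E d × E d, collision c M fSt p.1 p.2 * g p.1 p.2 ^ 2) := by
    rw [hq1, e, etr]
    ring
  rw [enorm, efin]
  rw [Measure.volume_eq_prod] at imic i2 i3 ⊢
  rw [integral_prod _ imic, integral_prod _ i2, integral_prod _ i3, ← integral_neg,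
    ← integral_const_mul, ← integral_add i2.integral_prod_left.fun_neg
      (i3.integral_prod_left.const_mul _), ← integral_const_mul]
  refine integral_mono imic.integral_prod_left
    ((i2.integral_prod_left.fun_neg.add (i3.integral_prod_left.const_mul _)).const_mul _)
    fun x => ?_
  exact integral_collision_dissipation_ge hS hm hL hlam h hφc x

theorem norm_micro_sq_le_of_mem_closure (hS : StationaryState c G M fSt cInf cM)
    (hm : Model c G M) (hL : LocalCoercivity c M fSt lam1) (hlam : 0 < lam1)
    {q : WL2 fSt × WL2 fSt} (hq : q ∈ closure (generatorGraph c G M fSt)) :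
    ‖hS.micro q.1‖ ^ 2 ≤ - lam1 * inner ℝ q.2 q.1 := by
  refine closure_minimal (t := {q : WL2 fSt × WL2 fSt |
    ‖hS.micro q.1‖ ^ 2 ≤ - lam1 * inner ℝ q.2 q.1})
    (fun q hq => norm_micro_sq_le_of_mem_graph hS hm hL hlam hq) ?_ hq
  have := hS.continuous_micro
  exact isClosed_le (by fun_prop) (by fun_prop)

end Dissipation

end

end Kinetic


namespace Kinetic

noncomputable section

/-! ### Linearity of the graph -/

section Linearity

variable {d : ℕ} {c : Collision} {G : E d → E d → E d} {M fSt : E d → E d → ℝ} {cInf cM : ℝ}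

theorem divergence_sub {V W : E d → E d} {v : E d} (hV : DifferentiableAt ℝ V v)
    (hW : DifferentiableAt ℝ W v) :
    divergence (fun u => V u - W u) v = divergence V v - divergence W v := by
  simp only [divergence, fderiv_fun_sub hV hW, ← Finset.sum_sub_distrib]
  rfl

theorem generator_sub (hm : Model c G M) {φ ψ : E d → E d → ℝ}
    (hφ : ContDiff ℝ 2 (fun p : E d × E d => φ p.1 p.2))
    (hψ : ContDiff ℝ 2 (fun p : E d × E d => ψ p.1 p.2))
    (hφc : HasCompactSupport (fun p : E d × E d => φ p.1 p.2))
    (hψc : HasCompactSupport (fun p : E d × E d => ψ p.1 p.2)) (x v : E d) :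
    generator c G M (fun x v => φ x v - ψ x v) x v =
      generator c G M φ x v - generator c G M ψ x v := by
  have hφ1 := hφ.of_le one_le_two
  have hψ1 := hψ.of_le one_le_two
  have hG := hm.contDiff_force
  have dφ := (contDiff_slice_right (F := fun x v => φ x v • G x v) (hφ1.smul hG) x).differentiable
    one_ne_zero v
  have dψ := (contDiff_slice_right (F := fun x v => ψ x v • G x v) (hψ1.smul hG) x).differentiable
    one_ne_zero v
  have ht : transport G (fun x v => φ x v - ψ x v) x v = transport G φ x v - transport G ψ x v := by
    simp only [transport, inner_gradient_right, sub_smul]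
    rw [divergence_sub dφ dψ, fderiv_fun_sub
      ((contDiff_slice_left hφ1 v).differentiable one_ne_zero x)
      ((contDiff_slice_left hψ1 v).differentiable one_ne_zero x), _root_.sub_apply]
    ring
  have hcol : collision c M (fun x v => φ x v - ψ x v) x v =
      collision c M φ x v - collision c M ψ x v := by
    cases c with
    | FP =>
      obtain ⟨hM, hpos⟩ := hm.fp_regular rfl
      have fφ := (contDiff_slice_right (contDiff_flux hM hpos hφ) x).differentiable one_ne_zero v
      have fψ := (contDiff_slice_right (contDiff_flux hM hpos hψ) x).differentiable one_ne_zero v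
      have hMx := (contDiff_slice_right hM x).of_le (m := 1) one_le_two
      have qφ : Differentiable ℝ fun u => φ x u / M x u := (((contDiff_slice_right hφ1 x).div hMx
        fun v => (hpos x v).ne').differentiable one_ne_zero)
      have qψ : Differentiable ℝ fun u => ψ x u / M x u := (((contDiff_slice_right hψ1 x).div hMx
        fun v => (hpos x v).ne').differentiable one_ne_zero)
      have := divergence_sub fφ fψ
      simp only [collision]
      refine Eq.trans ?_ this
      congr 1
      funext u
      simp only [flux, sub_div, gradient, fderiv_fun_sub (qφ u) (qψ u), map_sub, smul_sub]
    | BGK =>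
      have i1 : Integrable (φ x) := (contDiff_slice_right hφ1 x).continuous
        |>.integrable_of_hasCompactSupport (hasCompactSupport_slice_right hφc x)
      have i2 : Integrable (ψ x) := (contDiff_slice_right hψ1 x).continuous
        |>.integrable_of_hasCompactSupport (hasCompactSupport_slice_right hψc x)
      have : density (fun x v => φ x v - ψ x v) x = density φ x - density ψ x :=
        integral_sub i1 i2
      simp only [collision, this]
      ring
  simp only [generator, ht, hcol]
  ring

/-- Mild solutions are formulated from time `0`; subtracting two elements of the closed graph allows
an arbitrary starting time. -/
theorem sub_mem_closure_graph (hm : Model c G M)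
    {q r : WL2 fSt × WL2 fSt} (hq : q ∈ closure (generatorGraph c G M fSt))
    (hr : r ∈ closure (generatorGraph c G M fSt)) :
    q - r ∈ closure (generatorGraph c G M fSt) := by
  refine map_mem_closure₂ continuous_sub hq hr ?_
  rintro q ⟨φ, h, hc, h1, h2⟩ r ⟨ψ, k, kc, k1, k2⟩
  refine ⟨fun x v => φ x v - ψ x v, h.sub k, hc.sub kc, ?_, ?_⟩
  · filter_upwards [Lp.coeFn_sub q.1 r.1, h1, k1] with p e1 e2 e3
    exact e1.trans (by rw [Pi.sub_apply, e2, e3]; rfl)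
  · filter_upwards [Lp.coeFn_sub q.2 r.2, h2, k2] with p e1 e2 e3
    refine e1.trans ?_
    rw [Pi.sub_apply, e2, e3]
    exact (generator_sub hm (contDiff_of_smooth h 2) (contDiff_of_smooth k 2) hc kc _ _).symm

end Linearity

/-! ### The energy inequality for mild solutions -/

section Energy

open Filter Topology intervalIntegral

variable {H : Type*} [NormedAddCommGroup H] [InnerProductSpace ℝ H] [CompleteSpace H]

/-- The energy inequality for mild solutions, from the dissipation inequality for the time
averages `h⁻¹ ∫_t^{t+h} f`. -/
theorem energy_inequality {f : ℝ → H} {Q : H → H} (hf : Continuous f) (hQ : Continuous Q)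
    (hQs : ∀ (r : ℝ) x, Q (r • x) = r • Q x) {lam : ℝ} (hlam : 0 < lam)
    (hdis : ∀ t h : ℝ, 0 ≤ t → 0 < h →
      ‖Q (∫ τ in t..(t + h), f τ)‖ ^ 2 ≤ - lam * inner ℝ (f (t + h) - f t) (∫ τ in t..(t + h), f τ))
    {s t : ℝ} (hs : 0 ≤ s) (hst : s ≤ t) :
    ‖f t‖ ^ 2 + 2 / lam * ∫ τ in s..t, ‖Q (f τ)‖ ^ 2 ≤ ‖f s‖ ^ 2 := by
  -- The mean of `f` over `[t, t+h]`, written so that it is jointly continuous and makes sense at `h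
  -- = 0`, where it equals `f t`. For `h > 0` it is differentiable in `t`, which `f` need not be.
  set A : ℝ → ℝ → H := fun h t => ∫ r in (0 : ℝ)..1, f (t + h * r) with hA
  have cA : Continuous (Function.uncurry A) := by
    refine continuous_parametric_intervalIntegral_of_continuous'
      (f := fun (p : ℝ × ℝ) r => f (p.2 + p.1 * r)) ?_ 0 1
    simp only [Function.uncurry_def]
    fun_prop
  have A0 : ∀ t, A 0 t = f t := fun t => by simp [hA]
  have AU : ∀ h t, h ≠ 0 → A h t = h⁻¹ • ∫ τ in t..(t + h), f τ := by
    intro h t hh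
    simp only [hA]
    rw [integral_comp_add_mul _ hh]
    simp
  have cAt : ∀ h, Continuous (A h) := fun h => cA.comp (by fun_prop : Continuous fun t => (h, t))
  have ineq : ∀ h : ℝ, 0 < h →
      ‖A h t‖ ^ 2 + 2 / lam * ∫ τ in s..t, ‖Q (A h τ)‖ ^ 2 ≤ ‖A h s‖ ^ 2 := by
    intro h hh
    have dA : ∀ τ, HasDerivAt (A h) (h⁻¹ • (f (τ + h) - f τ)) τ := by
      intro τ
      have e : A h = fun τ => h⁻¹ • ((∫ r in (0 : ℝ)..(τ + h), f r) - ∫ r in (0 : ℝ)..τ, f r) := by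
        funext τ
        rw [AU h τ hh.ne', integral_interval_sub_left (hf.intervalIntegrable _ _)
          (hf.intervalIntegrable _ _)]
      rw [e]
      have d1 : HasDerivAt (fun u => ∫ r in (0 : ℝ)..u, f r) (f (τ + h)) (τ + h) :=
        integral_hasDerivAt_right (hf.intervalIntegrable _ _)
          hf.stronglyMeasurable.stronglyMeasurableAtFilter hf.continuousAt
      have d2 : HasDerivAt (fun u => ∫ r in (0 : ℝ)..u, f r) (f τ) τ :=
        integral_hasDerivAt_right (hf.intervalIntegrable _ _)
          hf.stronglyMeasurable.stronglyMeasurableAtFilter hf.continuousAt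
      exact ((d1.comp_add_const τ h).sub d2).const_smul h⁻¹
    have dN : ∀ τ, HasDerivAt (fun τ => ‖A h τ‖ ^ 2)
        (2 * inner ℝ (A h τ) (h⁻¹ • (f (τ + h) - f τ))) τ := fun τ => (dA τ).norm_sq
    have cD : Continuous fun τ => 2 * inner ℝ (A h τ) (h⁻¹ • (f (τ + h) - f τ)) := by
      have := cAt h
      fun_prop
    have cQ : Continuous fun τ => ‖Q (A h τ)‖ ^ 2 := by
      have := cAt h
      fun_prop
    have e1 := integral_eq_sub_of_hasDerivAt (fun τ _ => dN τ) (cD.intervalIntegrable s t)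
    have e2 : ∫ τ in s..t, 2 / lam * ‖Q (A h τ)‖ ^ 2 ≤
        ∫ τ in s..t, -(2 * inner ℝ (A h τ) (h⁻¹ • (f (τ + h) - f τ))) := by
      refine integral_mono_on hst ((cQ.const_mul _).intervalIntegrable s t)
        (cD.neg.intervalIntegrable s t) fun τ hτ => ?_
      have h3 := hdis τ h (hs.trans hτ.1) hh
      -- Both sides are homogeneous of degree two in `h⁻¹`: the mean carries one factor, and so does
      -- its derivative `h⁻¹ (f(τ+h) - f(τ))`.
      rw [AU h τ hh.ne', hQs, norm_smul, mul_pow, real_inner_smul_left, real_inner_smul_right,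
        real_inner_comm, Real.norm_of_nonneg (inv_pos.2 hh).le]
      have h4 : 0 ≤ h⁻¹ ^ 2 := sq_nonneg _
      have h5 : 2 / lam * (h⁻¹ ^ 2 * ‖Q (∫ τ in τ..(τ + h), f τ)‖ ^ 2) ≤
          2 / lam * (h⁻¹ ^ 2 *
            (- lam * inner ℝ (f (τ + h) - f τ) (∫ τ in τ..(τ + h), f τ))) := by
        gcongr
      refine h5.trans (le_of_eq ?_)
      field_simp
    rw [intervalIntegral.integral_neg, e1, intervalIntegral.integral_const_mul] at e2
    linarith
  -- The inequality holds for every mean with `h > 0` and is passed to the limit `h ↓ 0`.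
  have l1 : Tendsto (fun h => ‖A h t‖ ^ 2 + 2 / lam * ∫ τ in s..t, ‖Q (A h τ)‖ ^ 2) (𝓝[>] 0)
      (𝓝 (‖A 0 t‖ ^ 2 + 2 / lam * ∫ τ in s..t, ‖Q (A 0 τ)‖ ^ 2)) := by
    have c1 : Continuous fun h => A h t := cA.comp (by fun_prop : Continuous fun h => (h, t))
    have c2 : Continuous fun h => ∫ τ in s..t, ‖Q (A h τ)‖ ^ 2 := by
      refine continuous_parametric_intervalIntegral_of_continuous'
        (f := fun h τ => ‖Q (A h τ)‖ ^ 2) ?_ s t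
      exact (hQ.comp cA).norm.pow 2
    exact (((c1.norm.pow 2).add (c2.const_mul _)).tendsto 0).mono_left nhdsWithin_le_nhds
  have l2 : Tendsto (fun h => ‖A h s‖ ^ 2) (𝓝[>] 0) (𝓝 (‖A 0 s‖ ^ 2)) := by
    have c1 : Continuous fun h => A h s := cA.comp (by fun_prop : Continuous fun h => (h, s))
    exact ((c1.norm.pow 2).tendsto 0).mono_left nhdsWithin_le_nhds
  have := le_of_tendsto_of_tendsto l1 l2
    (eventually_nhdsWithin_of_forall fun h hh => ineq h hh)
  simpa only [A0] using this

end Energy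

/-! ### Solutions tested against functions of time, space and velocity -/

section Solutions

open Filter Topology intervalIntegral

variable {d : ℕ} {c : Collision} {G : E d → E d → E d} {M fSt : E d → E d → ℝ}
  {cInf cM lam1 : ℝ}

/-- A continuous path on the whole line that is a mild solution for nonnegative times. -/
structure IsPath (c : Collision) (G : E d → E d → E d) (M fSt : E d → E d → ℝ)
    (f : ℝ → WL2 fSt) : Prop where
  continuous : Continuous f
  mem_closure : ∀ s t, 0 ≤ s → s ≤ t →
    ((∫ τ in s..t, f τ), f t - f s) ∈ closure (generatorGraph c G M fSt)

/-- Freezing the solution at its initial value for negative times gives a path continuous on the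
whole line without changing anything for `t ≥ 0`. -/
theorem IsSolution.isPath (hm : Model c G M)
    {f : ℝ → WL2 fSt} (hf : IsSolution c G M fSt f) :
    IsPath c G M fSt fun t => f (max t 0) := by
  have hcont : Continuous fun t => f (max t 0) :=
    hf.1.comp_continuous (by fun_prop) fun t => Set.mem_Ici.2 (le_max_right _ _)
  refine ⟨hcont, fun s t hs hst => ?_⟩
  have e : ∀ t, 0 ≤ t → ∫ τ in (0 : ℝ)..t, f τ = ∫ τ in (0 : ℝ)..t, f (max τ 0) := by
    intro t ht
    refine integral_congr fun τ hτ => ?_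
    rw [Set.uIcc_of_le ht] at hτ
    simp only [max_eq_left hτ.1]
  have h1 := hf.2 t (hs.trans hst)
  have h2 := hf.2 s hs
  rw [e _ (hs.trans hst)] at h1
  rw [e _ hs] at h2
  have h3 := sub_mem_closure_graph hm h1 h2
  rw [Prod.mk_sub_mk, integral_interval_sub_left (hcont.intervalIntegrable _ _)
    (hcont.intervalIntegrable _ _)] at h3
  simpa only [max_eq_left hs, max_eq_left (hs.trans hst), sub_sub_sub_cancel_right] using h3

theorem StationaryState.micro_smul (hS : StationaryState c G M fSt cInf cM) (r : ℝ)
    (f : WL2 fSt) : hS.micro (r • f) = r • hS.micro f := by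
  simp [StationaryState.micro, smul_sub]

variable {f : ℝ → WL2 fSt}

theorem IsPath.energy (hf : IsPath c G M fSt f) (hS : StationaryState c G M fSt cInf cM)
    (hm : Model c G M) (hL : LocalCoercivity c M fSt lam1) (hlam : 0 < lam1) {s t : ℝ}
    (hs : 0 ≤ s) (hst : s ≤ t) :
    ‖f t‖ ^ 2 + 2 / lam1 * ∫ τ in s..t, ‖hS.micro (f τ)‖ ^ 2 ≤ ‖f s‖ ^ 2 := by
  have hdis : ∀ t h : ℝ, 0 ≤ t → 0 < h → ‖hS.micro (∫ τ in t..(t + h), f τ)‖ ^ 2 ≤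
      - lam1 * inner ℝ (f (t + h) - f t) (∫ τ in t..(t + h), f τ) := fun t h ht hh => by
    have hq := hf.mem_closure t (t + h) ht (by linarith)
    have := norm_micro_sq_le_of_mem_closure hS hm hL hlam hq
    exact this
  exact energy_inequality hf.continuous hS.continuous_micro hS.micro_smul hlam hdis hs hst

theorem IsPath.mass_eq (hf : IsPath c G M fSt f) (hS : StationaryState c G M fSt cInf cM)
    (hm : Model c G M) {t : ℝ} (ht : 0 ≤ t) : ∫ p, f t p = ∫ p, f 0 p := by
  have h := inner_one_of_mem_closure hS hm (hf.mem_closure 0 t le_rfl ht)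
  rw [inner_sub_left, hS.inner_ofMultiplier _ (hS.memLp_const 1),
    hS.inner_ofMultiplier _ (hS.memLp_const 1)] at h
  simp only [mul_one] at h
  linarith

/-- The weak form of the closed graph expresses the pairing as a constant plus the pairing of the
time integral of `f` with the adjoint; the fundamental theorem of calculus does the rest. -/
theorem IsPath.hasDerivAt_inner (hf : IsPath c G M fSt f)
    (hS : StationaryState c G M fSt cInf cM) (hm : Model c G M) {a z : E d → ℝ}
    (ha : ContDiff ℝ 2 a) (hac : HasCompactSupport a) (hz : ContDiff ℝ 1 z)
    (hzc : HasCompactSupport z) {t : ℝ} (ht : 0 < t) :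
    HasDerivAt (fun τ => inner ℝ (f τ) (hS.ofMultiplier fun p => a p.2 * z p.1))
      (inner ℝ (f t) (hS.ofMultiplier (productAdjoint c G M a z))) t := by
  have hc := hf.continuous
  have d1 : HasDerivAt (fun u => ∫ r in (0 : ℝ)..u, f r) (f t) t :=
    integral_hasDerivAt_right (hc.intervalIntegrable _ _)
      hc.stronglyMeasurable.stronglyMeasurableAtFilter hc.continuousAt
  have d2 := (d1.inner ℝ (hasDerivAt_const t (hS.ofMultiplier (productAdjoint c G M a z)))
    ).add_const (inner ℝ (f 0) (hS.ofMultiplier fun p => a p.2 * z p.1))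
  simp only [inner_zero_right, zero_add] at d2
  refine d2.congr_of_eventuallyEq ?_
  filter_upwards [lt_mem_nhds ht] with τ hτ
  have := inner_weak_of_mem_closure hS hm (hf.mem_closure 0 τ le_rfl hτ.le) ha hac hz hzc
  rw [inner_sub_left] at this
  linarith

/-- Dominated convergence: `fSt dx dv` is a finite measure, so uniformly bounded multipliers that
converge pointwise converge in `L²`. -/
theorem StationaryState.tendsto_ofMultiplier (hS : StationaryState c G M fSt cInf cM)
    {ι : Type*} {l : Filter ι} [l.IsCountablyGenerated] {m : ι → E d × E d → ℝ}
    {m' : E d × E d → ℝ} {C : ℝ} (hm : ∀ i, Measurable (m i)) (hm' : Measurable m')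
    (hb : ∀ i p, |m i p| ≤ C) (hb' : ∀ p, |m' p| ≤ C)
    (hlim : ∀ p, Tendsto (fun i => m i p) l (𝓝 (m' p))) :
    Tendsto (fun i => hS.ofMultiplier (m i)) l (𝓝 (hS.ofMultiplier m')) := by
  have k : ∀ i, MemLp (m i) 2 (phaseMeasure fSt) := fun i =>
    hS.memLp_of_bound (hm i).aestronglyMeasurable (hb i)
  have k' : MemLp m' 2 (phaseMeasure fSt) := hS.memLp_of_bound hm'.aestronglyMeasurable hb'
  have key : Tendsto (fun i => ‖hS.ofMultiplier (m i) - hS.ofMultiplier m'‖ ^ 2) l (𝓝 0) := by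
    have e : ∀ i, ‖hS.ofMultiplier (m i) - hS.ofMultiplier m'‖ ^ 2 =
        ∫ p : E d × E d, fSt p.1 p.2 * (m i p - m' p) ^ 2 := fun i => by
      rw [← hS.ofMultiplier_sub (k i) k', hS.norm_ofMultiplier_sq ((k i).sub k')]
      rfl
    simp only [e]
    have := tendsto_integral_filter_of_dominated_convergence (μ := volume) (l := l)
      (F := fun i (p : E d × E d) => fSt p.1 p.2 * (m i p - m' p) ^ 2) (f := fun _ => 0)
      (fun p : E d × E d => fSt p.1 p.2 * (C + C) ^ 2)
      (.of_forall fun i => (hS.measurable.mul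
        (((hm i).sub hm').pow_const 2)).aestronglyMeasurable)
      (.of_forall fun i => .of_forall fun p => by
        rw [Real.norm_of_nonneg (mul_nonneg (hS.pos _ _).le (sq_nonneg _))]
        refine mul_le_mul_of_nonneg_left ?_ (hS.pos _ _).le
        rw [← sq_abs]
        exact pow_le_pow_left₀ (abs_nonneg _)
          ((abs_sub _ _).trans (add_le_add (hb i p) (hb' p))) 2)
      (hS.integrable.mul_const _)
      (.of_forall fun p => by
        have := (((hlim p).sub_const (m' p)).pow 2).const_mul (fSt p.1 p.2)
        simpa using this)
    simpa using this
  rw [tendsto_iff_norm_sub_tendsto_zero]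
  have := key.sqrt
  simpa [Real.sqrt_sq (norm_nonneg _)] using this

/-- The mean value inequality bounds the difference quotients by the bound on the derivative, so a
pointwise derivative is a derivative in `L²`. -/
theorem StationaryState.hasDerivAt_ofMultiplier (hS : StationaryState c G M fSt cInf cM)
    {m m' : ℝ → E d × E d → ℝ} {B C : ℝ} (hm : ∀ t, Measurable (m t))
    (hm' : ∀ t, Measurable (m' t)) (hd : ∀ t p, HasDerivAt (fun t => m t p) (m' t p) t)
    (hB : ∀ t p, |m t p| ≤ B) (hC : ∀ t p, |m' t p| ≤ C) (t : ℝ) :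
    HasDerivAt (fun t => hS.ofMultiplier (m t)) (hS.ofMultiplier (m' t)) t := by
  have k : ∀ t, MemLp (m t) 2 (phaseMeasure fSt) := fun t =>
    hS.memLp_of_bound (hm t).aestronglyMeasurable (hB t)
  rw [hasDerivAt_iff_tendsto_slope]
  have e : slope (fun t => hS.ofMultiplier (m t)) t = fun τ =>
      hS.ofMultiplier ((τ - t)⁻¹ • (m τ - m t)) := by
    funext τ
    rw [slope_def_module, hS.ofMultiplier_const_smul _ ((k τ).sub (k t)),
      hS.ofMultiplier_sub (k τ) (k t)]
  rw [e]
  refine hS.tendsto_ofMultiplier (C := C)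
    (fun τ => ((hm τ).sub (hm t)).const_smul _) (hm' t) (fun τ p => ?_) (hC t) fun p => ?_
  · have h := Convex.norm_image_sub_le_of_norm_hasDerivWithin_le (s := Set.univ)
      (f := fun t => m t p) (f' := fun t => m' t p) (C := C) (x := t) (y := τ)
      (fun x _ => (hd x p).hasDerivWithinAt) (fun x _ => hC x p) convex_univ trivial trivial
    have hC0 : 0 ≤ C := (abs_nonneg _).trans (hC t p)
    simp only [Pi.smul_apply, Pi.sub_apply, smul_eq_mul, abs_mul, abs_inv]
    rw [inv_mul_eq_div]
    exact div_le_of_le_mul₀ (abs_nonneg _) hC0 h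
  · have := hasDerivAt_iff_tendsto_slope.1 (hd t p)
    refine this.congr fun τ => ?_
    rw [slope_def_module]
    rfl

/-- The adjoint equation applied to `a(v) z(t,x)`. -/
def spacetimeAdjoint (c : Collision) (G : E d → E d → E d) (M : E d → E d → ℝ) (a : E d → ℝ)
    (z : ℝ × E d → ℝ) (t : ℝ) (p : E d × E d) : ℝ :=
  a p.2 * fderiv ℝ z (t, p.1) (1, p.2) + z (t, p.1) * velocityAdjoint c G M a p.1 p.2

variable {a : E d → ℝ} {z : ℝ × E d → ℝ}

theorem continuous_spacetimeAdjoint (hS : StationaryState c G M fSt cInf cM) (hm : Model c G M)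
    (ha : ContDiff ℝ 2 a) (hac : HasCompactSupport a) (hz : ContDiff ℝ 1 z) :
    Continuous fun q : ℝ × E d × E d => spacetimeAdjoint c G M a z q.1 q.2 := by
  have h1 := hz.continuous_fderiv one_ne_zero
  have h2 := continuous_velocityAdjoint hS hm ha hac
  have h3 := ha.continuous
  have h4 := hz.continuous
  unfold spacetimeAdjoint
  refine Continuous.add (Continuous.mul (by fun_prop) ?_) (Continuous.mul (by fun_prop) ?_)
  · exact (h1.comp (by fun_prop : Continuous fun q : ℝ × E d × E d => (q.1, q.2.1))).clm_apply
      (by fun_prop)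
  · exact h2.comp continuous_snd

theorem fderiv_eq_zero_of_notMem_tsupport {X W : Type*} [NormedAddCommGroup X] [NormedSpace ℝ X]
    [NormedAddCommGroup W] [NormedSpace ℝ W] {g : X → W} {p : X} (hp : p ∉ tsupport g) :
    fderiv ℝ g p = 0 := by
  by_contra h3
  exact hp (support_fderiv_subset ℝ h3)

/-- The direction `(1,v)` is unbounded, but it only matters on the support of `a`; the zeroth order
term is bounded over the compact set of positions that `z` sees. -/
theorem exists_bound_spacetimeAdjoint (hS : StationaryState c G M fSt cInf cM)
    (hm : Model c G M) (ha : ContDiff ℝ 2 a) (hac : HasCompactSupport a) (hz : ContDiff ℝ 1 z)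
    (hzc : HasCompactSupport z) : ∃ C, ∀ t p, |spacetimeAdjoint c G M a z t p| ≤ C := by
  obtain ⟨A, hA⟩ := ha.continuous.bounded_above_of_compact_support hac
  obtain ⟨B, hB⟩ := hz.continuous.bounded_above_of_compact_support hzc
  obtain ⟨D, hD⟩ := (hz.continuous_fderiv one_ne_zero).bounded_above_of_compact_support
    (hzc.fderiv (𝕜 := ℝ))
  obtain ⟨R, hR⟩ := hac.isCompact.isBounded.exists_norm_le
  obtain ⟨C, hC⟩ := exists_bound_velocityAdjoint hS hm ha hac
    (hzc.isCompact.image continuous_snd)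
  have hA0 := (norm_nonneg _).trans (hA 0)
  have hB0 := (norm_nonneg _).trans (hB 0)
  have hD0 := (norm_nonneg _).trans (hD 0)
  refine ⟨A * (D * max 1 R) + B * max C 0, fun t p => (abs_add_le _ _).trans (add_le_add ?_ ?_)⟩
  · rw [abs_mul]
    by_cases h : p.2 ∈ tsupport a
    · refine mul_le_mul (hA _) ?_ (abs_nonneg _) hA0
      refine ((fderiv ℝ z (t, p.1)).le_opNorm _).trans ?_
      refine mul_le_mul (hD _) ?_ (norm_nonneg _) hD0
      rw [Prod.norm_def]
      exact max_le_max (by simp) (hR _ h)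
    · rw [image_eq_zero_of_notMem_tsupport h, abs_zero, zero_mul]
      positivity
  · rw [abs_mul]
    by_cases h : (t, p.1) ∈ tsupport z
    · exact mul_le_mul (hB _) ((hC _ ⟨_, h, rfl⟩ _).trans (le_max_left _ _)) (abs_nonneg _) hB0
    · rw [image_eq_zero_of_notMem_tsupport h, abs_zero, zero_mul]
      positivity

theorem memLp_spacetimeAdjoint (hS : StationaryState c G M fSt cInf cM) (hm : Model c G M)
    (ha : ContDiff ℝ 2 a) (hac : HasCompactSupport a) (hz : ContDiff ℝ 1 z)
    (hzc : HasCompactSupport z) (t : ℝ) :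
    MemLp (spacetimeAdjoint c G M a z t) 2 (phaseMeasure fSt) := by
  obtain ⟨C, hC⟩ := exists_bound_spacetimeAdjoint hS hm ha hac hz hzc
  exact hS.memLp_of_bound ((continuous_spacetimeAdjoint hS hm ha hac hz).comp
    (by fun_prop : Continuous fun p : E d × E d => (t, p))).aestronglyMeasurable (hC t)

theorem continuous_ofMultiplier_spacetimeAdjoint (hS : StationaryState c G M fSt cInf cM)
    (hm : Model c G M) (ha : ContDiff ℝ 2 a) (hac : HasCompactSupport a) (hz : ContDiff ℝ 1 z)
    (hzc : HasCompactSupport z) :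
    Continuous fun t => hS.ofMultiplier (spacetimeAdjoint c G M a z t) := by
  obtain ⟨C, hC⟩ := exists_bound_spacetimeAdjoint hS hm ha hac hz hzc
  have hcont := continuous_spacetimeAdjoint hS hm ha hac hz
  have hmeas : ∀ t, Measurable (spacetimeAdjoint c G M a z t) := fun t =>
    (hcont.comp (by fun_prop : Continuous fun p : E d × E d => (t, p))).measurable
  refine continuous_iff_continuousAt.2 fun t => ?_
  refine hS.tendsto_ofMultiplier hmeas (hmeas t) hC (hC t) fun p => ?_
  exact (hcont.comp (by fun_prop : Continuous fun t : ℝ => (t, p))).tendsto t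

/-- The weak form of the evolution equation in time, space and velocity. -/
theorem IsPath.integral_inner_spacetimeAdjoint (hf : IsPath c G M fSt f)
    (hS : StationaryState c G M fSt cInf cM) (hm : Model c G M) (ha : ContDiff ℝ 2 a)
    (hac : HasCompactSupport a) (hz : ContDiff ℝ 1 z) (hzc : HasCompactSupport z)
    {α β : ℝ} (hα : 0 ≤ α) (hαβ : α ≤ β) (h0 : ∀ x, z (α, x) = 0) (h1 : ∀ x, z (β, x) = 0) :
    ∫ t in α..β, inner ℝ (f t) (hS.ofMultiplier (spacetimeAdjoint c G M a z t)) = 0 := by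
  have hzt : ∀ t, ContDiff ℝ 1 fun x => z (t, x) := fun t =>
    hz.comp (contDiff_const.prodMk contDiff_id)
  have hzct : ∀ t, HasCompactSupport fun x => z (t, x) := fun t =>
    hasCompactSupport_slice_right (F := fun t x => z (t, x)) hzc t
  set m : ℝ → E d × E d → ℝ := fun t p => a p.2 * z (t, p.1) with hmdef
  set m' : ℝ → E d × E d → ℝ := fun t p => a p.2 * fderiv ℝ z (t, p.1) (1, 0) with hm'def
  have cm : ∀ t, Continuous (m t) := fun t =>
    (ha.continuous.comp continuous_snd).mul (hz.continuous.comp (by fun_prop))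
  have cm' : ∀ t, Continuous (m' t) := fun t =>
    (ha.continuous.comp continuous_snd).mul (((hz.continuous_fderiv one_ne_zero).comp
      (by fun_prop : Continuous fun p : E d × E d => (t, p.1))).clm_apply continuous_const)
  obtain ⟨A, hA⟩ := ha.continuous.bounded_above_of_compact_support hac
  obtain ⟨B, hB⟩ := hz.continuous.bounded_above_of_compact_support hzc
  have cz' : Continuous fun q : ℝ × E d => fderiv ℝ z q (1, 0) :=
    (hz.continuous_fderiv one_ne_zero).clm_apply continuous_const
  obtain ⟨D, hD⟩ := cz'.bounded_above_of_compact_support (hzc.fderiv_apply (𝕜 := ℝ) (1, 0))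
  have hA0 := (norm_nonneg _).trans (hA 0)
  have bm : ∀ t p, |m t p| ≤ A * B := fun t p => by
    rw [hmdef, abs_mul]
    exact mul_le_mul (hA _) (hB _) (abs_nonneg _) hA0
  have bm' : ∀ t p, |m' t p| ≤ A * D := fun t p => by
    rw [hm'def, abs_mul]
    exact mul_le_mul (hA _) (hD (t, p.1)) (abs_nonneg _) hA0
  have dm : ∀ t p, HasDerivAt (fun t => m t p) (m' t p) t := by
    intro t p
    have d1 : HasDerivAt (fun t : ℝ => (t, p.1)) ((1 : ℝ), (0 : E d)) t :=
      (hasDerivAt_id t).prodMk (hasDerivAt_const t p.1)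
    exact ((hz.differentiable one_ne_zero (t, p.1)).hasFDerivAt.comp_hasDerivAt t d1).const_mul _
  have dψ := hS.hasDerivAt_ofMultiplier (fun t => (cm t).measurable) (fun t => (cm' t).measurable)
    dm bm bm'
  have split : ∀ t, hS.ofMultiplier (spacetimeAdjoint c G M a z t) =
      hS.ofMultiplier (m' t) + hS.ofMultiplier (productAdjoint c G M a fun x => z (t, x)) := by
    intro t
    rw [← hS.ofMultiplier_add (hS.memLp_of_bound (cm' t).aestronglyMeasurable (bm' t))
      (memLp_productAdjoint hS hm ha hac (hzt t) (hzct t))]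
    congr 1
    funext p
    have e : fderiv ℝ (fun x => z (t, x)) p.1 p.2 = fderiv ℝ z (t, p.1) (0, p.2) := by
      rw [(hasFDerivAt_slice_right (F := fun t x => z (t, x))
        (hz.differentiable one_ne_zero (t, p.1))).fderiv]
      simp
    have e2 : ((1 : ℝ), p.2) = (1, 0) + (0, p.2) := by simp
    simp only [spacetimeAdjoint, Pi.add_apply, hm'def, productAdjoint, e]
    rw [e2, map_add]
    ring
  have hF : ∀ t, 0 < t → HasDerivAt (fun τ => inner ℝ (f τ) (hS.ofMultiplier (m τ)))
      (inner ℝ (f t) (hS.ofMultiplier (spacetimeAdjoint c G M a z t))) t := by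
    intro t ht
    have d1 := hf.hasDerivAt_inner hS hm ha hac (hzt t) (hzct t) ht
    rw [split, inner_add_right]
    -- The product rule is carried out on difference quotients because `f` is only weakly
    -- differentiable: the increment of the test function is paired with `f τ`, and the increment of
    -- `f` with the test function at the fixed time `t`.
    rw [hasDerivAt_iff_tendsto_slope] at d1 ⊢
    have d2 := hasDerivAt_iff_tendsto_slope.1 (dψ t)
    have d3 := ((hf.continuous.tendsto t).mono_left nhdsWithin_le_nhds).inner (𝕜 := ℝ) d2
    refine (d3.add d1).congr fun τ => ?_
    simp only [slope_def_module, inner_smul_right, smul_eq_mul, inner_sub_right, hmdef]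
    ring
  have cF : Continuous fun τ => inner ℝ (f τ) (hS.ofMultiplier (m τ)) :=
    hf.continuous.inner (𝕜 := ℝ) (continuous_iff_continuousAt.2 fun t => (dψ t).continuousAt)
  have cF' : Continuous fun t =>
      inner ℝ (f t) (hS.ofMultiplier (spacetimeAdjoint c G M a z t)) :=
    hf.continuous.inner (𝕜 := ℝ)
      (continuous_ofMultiplier_spacetimeAdjoint hS hm ha hac hz hzc)
  -- Differentiability is needed only inside the interval, so `α = 0` is allowed; the two end values
  -- vanish with `z`.
  rw [integral_eq_sub_of_hasDerivAt_of_le hαβ cF.continuousOn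
    (fun t ht => hF t (hα.trans_lt ht.1)) (cF'.intervalIntegrable _ _)]
  have z0 : m α = fun _ => 0 := by funext p; simp [hmdef, h0]
  have z1 : m β = fun _ => 0 := by funext p; simp [hmdef, h1]
  have e0 : hS.ofMultiplier (fun _ => 0) = 0 := by
    rw [hS.ofMultiplier_eq (hS.memLp_const 0)]
    have : (hS.memLp_const 0).toLp = 0 := MemLp.toLp_zero _
    rw [this, map_zero]
  simp only [z0, z1, e0, inner_zero_right, sub_zero]

end Solutions

end

end Kinetic


namespace Kinetic

noncomputable section

/-! ### Differentiation under the velocity integral -/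

section ParametricIntegral

variable {d : ℕ} {X W : Type*} [NormedAddCommGroup X] [NormedSpace ℝ X] [ProperSpace X]
  [NormedAddCommGroup W] [NormedSpace ℝ W]

theorem hasFDerivAt_integral_smul {F : X → E d → ℝ}
    (hF : ContDiff ℝ 1 fun p : X × E d => F p.1 p.2) {k : E d → W} (hk : Continuous k)
    (hc : HasCompactSupport k) (x : X) :
    Integrable (fun v => (fderiv ℝ (fun y => F y v) x).smulRight (k v)) ∧
    HasFDerivAt (fun y => ∫ v, F y v • k v)
      (∫ v, (fderiv ℝ (fun y => F y v) x).smulRight (k v)) x := by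
  have cF' := continuous_fderiv_slice_left hF
  have cF := hF.continuous
  have cS : Continuous fun p : X × E d =>
      (fderiv ℝ (fun y => F y p.2) p.1).smulRight (k p.2) :=
    ((ContinuousLinearMap.smulRightL ℝ X W).continuous₂).comp
      (cF'.prodMk (hk.comp continuous_snd))
  obtain ⟨C, hC⟩ := ((isCompact_closedBall x 1).prod hc.isCompact).exists_bound_of_continuousOn
    cS.continuousOn
  have slice : ∀ (y : X), Continuous fun v => (fderiv ℝ (fun y => F y v) y).smulRight (k v) :=
    fun y => cS.comp (by fun_prop : Continuous fun v : E d => (y, v))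
  have sliceF : ∀ (y : X), Continuous fun v => F y v • k v := fun y =>
    (cF.comp (by fun_prop : Continuous fun v : E d => (y, v))).smul hk
  have supp : ∀ v ∉ tsupport k, k v = 0 := fun v hv => image_eq_zero_of_notMem_tsupport hv
  have hi : Integrable (fun v => (fderiv ℝ (fun y => F y v) x).smulRight (k v)) := by
    refine (slice x).integrable_of_hasCompactSupport (HasCompactSupport.intro hc.isCompact
      fun v hv => ?_)
    simp [supp v hv]
  refine ⟨hi, ?_⟩
  refine hasFDerivAt_integral_of_dominated_of_fderiv_le (s := Metric.closedBall x 1)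
    (F' := fun y v => (fderiv ℝ (fun y => F y v) y).smulRight (k v))
    (bound := (tsupport k).indicator fun _ => C)
    (Metric.closedBall_mem_nhds x one_pos) (.of_forall fun y => (sliceF y).aestronglyMeasurable)
    ((sliceF x).integrable_of_hasCompactSupport hc.smul_left) (slice x).aestronglyMeasurable
    (.of_forall fun v y hy => ?_) ?_ (.of_forall fun v y hy => ?_)
  · by_cases hv : v ∈ tsupport k
    · rw [Set.indicator_of_mem hv]
      exact hC (y, v) ⟨hy, hv⟩
    · rw [Set.indicator_of_notMem hv]
      simp [supp v hv]
  · exact (integrable_indicator_iff (isClosed_tsupport k).measurableSet).2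
      (integrableOn_const hc.isCompact.measure_lt_top.ne)
  · exact (((contDiff_slice_left hF v).differentiable one_ne_zero y).hasFDerivAt).smul_const (k v)

theorem fderiv_integral_smul {F : X → E d → ℝ}
    (hF : ContDiff ℝ 1 fun p : X × E d => F p.1 p.2) {k : E d → W} (hk : Continuous k)
    (hc : HasCompactSupport k) (x e : X) :
    fderiv ℝ (fun y => ∫ v, F y v • k v) x e = ∫ v, fderiv ℝ (fun y => F y v) x e • k v := by
  obtain ⟨hi, h⟩ := hasFDerivAt_integral_smul hF hk hc x
  rw [h.fderiv, ContinuousLinearMap.integral_apply hi]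
  rfl

theorem contDiff_integral_smul {F : X → E d → ℝ}
    (hF : ContDiff ℝ 1 fun p : X × E d => F p.1 p.2) {k : E d → W} (hk : Continuous k)
    (hc : HasCompactSupport k) : ContDiff ℝ 1 fun y => ∫ v, F y v • k v := by
  rw [contDiff_one_iff_fderiv]
  refine ⟨fun x => (hasFDerivAt_integral_smul hF hk hc x).2.differentiableAt, ?_⟩
  have e : fderiv ℝ (fun y => ∫ v, F y v • k v) = fun x =>
      ∫ v, (fderiv ℝ (fun y => F y v) x).smulRight (k v) := by
    funext x
    exact (hasFDerivAt_integral_smul hF hk hc x).2.fderiv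
  rw [e]
  have cS : Continuous fun p : X × E d =>
      (fderiv ℝ (fun y => F y p.2) p.1).smulRight (k p.2) :=
    ((ContinuousLinearMap.smulRightL ℝ X W).continuous₂).comp
      ((continuous_fderiv_slice_left hF).prodMk (hk.comp continuous_snd))
  have h := continuous_parametric_integral_of_continuous (μ := (volume : Measure (E d)))
    (f := fun x v => (fderiv ℝ (fun y => F y v) x).smulRight (k v)) cS hc.isCompact
  refine h.congr fun x => ?_
  refine setIntegral_eq_integral_of_forall_compl_eq_zero fun v hv => ?_
  simp [image_eq_zero_of_notMem_tsupport hv]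

end ParametricIntegral

/-! ### Velocity profiles -/

section Profiles

variable {d : ℕ}

/-- The Euclidean space of time-space directions. -/
abbrev E1 (d : ℕ) : Type := EuclideanSpace ℝ (Fin (d + 1))

/-- The vector `(1, v)`. -/
def vbar (v : E d) : E1 d := WithLp.toLp 2 (Fin.cons 1 v.ofLp)

@[simp] theorem vbar_zero (v : E d) : vbar v 0 = 1 := rfl

@[simp] theorem vbar_succ (v : E d) (i : Fin d) : vbar v i.succ = v i := rfl

theorem contDiff_vbar {n : WithTop ℕ∞} : ContDiff ℝ n (vbar (d := d)) := by
  rw [contDiff_euclidean]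
  intro i
  refine Fin.cases ?_ (fun i => ?_) i
  · exact contDiff_const
  · exact (EuclideanSpace.proj (𝕜 := ℝ) i).contDiff

theorem norm_vbar_sq (v : E d) : ‖vbar v‖ ^ 2 = 1 + ‖v‖ ^ 2 := by
  simp [EuclideanSpace.norm_sq_eq, Fin.sum_univ_succ]

theorem inner_vbar (v : E d) (ξ : E1 d) :
    inner ℝ (vbar v) ξ = ξ 0 + ∑ i : Fin d, v i * ξ i.succ := by
  simp [PiLp.inner_apply, Fin.sum_univ_succ, mul_comm]

theorem sum_vbar_smul_direction (v : E d) :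
    ∑ j, vbar v j • (direction j : ℝ × E d) = (1, v) := by
  rw [Fin.sum_univ_succ]
  simp only [direction, Fin.cases_zero, Fin.cases_succ, vbar_zero, vbar_succ, one_smul]
  have h : ∑ i : Fin d, v i • ((0 : ℝ), (EuclideanSpace.single i 1 : E d)) = (0, v) := by
    refine Prod.ext ?_ ?_
    · simp [Prod.fst_sum]
    · rw [Prod.snd_sum]
      simpa using (EuclideanSpace.basisFun (Fin d) ℝ).sum_repr v
  rw [h]
  simp

theorem norm_direction_snd_le (j : Fin (d + 1)) : ‖(direction j : ℝ × E d).2‖ ≤ 1 := by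
  refine Fin.cases ?_ (fun i => ?_) j
  · simp [direction]
  · simp [direction]

theorem map_one_vbar {W : Type*} [NormedAddCommGroup W] [NormedSpace ℝ W]
    (L : ℝ × E d →L[ℝ] W) (v : E d) : L (1, v) = ∑ j, vbar v j • L (direction j) := by
  rw [← sum_vbar_smul_direction, map_sum]
  simp

/-- The velocity cutoff. -/
def velocityBump (d : ℕ) : ContDiffBump (0 : E d) where
  rIn := 1 / 2
  rOut := 1
  rIn_pos := by norm_num
  rIn_lt_rOut := by norm_num

theorem tsupport_velocityBump : tsupport (velocityBump d) = Metric.closedBall (0 : E d) 1 :=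
  (velocityBump d).tsupport_eq

/-- The velocity profiles `χ(v) (1, v)`. -/
def profile (j : Fin (d + 1)) (v : E d) : ℝ := velocityBump d v * vbar v j

theorem contDiff_profile {n : ℕ∞} (j : Fin (d + 1)) : ContDiff ℝ n (profile (d := d) j) :=
  (velocityBump d).contDiff.mul ((contDiff_euclidean.1 contDiff_vbar) j)

theorem contDiff_two_profile (j : Fin (d + 1)) : ContDiff ℝ 2 (profile (d := d) j) :=
  contDiff_profile (n := 2) j

theorem hasCompactSupport_profile (j : Fin (d + 1)) : HasCompactSupport (profile (d := d) j) :=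
  (velocityBump d).hasCompactSupport.mul_right

theorem tsupport_profile_subset (j : Fin (d + 1)) :
    tsupport (profile (d := d) j) ⊆ Metric.closedBall 0 1 :=
  (closure_mono (Function.support_mul_subset_left _ _)).trans tsupport_velocityBump.subset

/-- The rank one operator `χ(v) (1,v) ⊗ (1,v)`. -/
def profileOperator (v : E d) : E1 d →L[ℝ] E1 d :=
  velocityBump d v • (innerSL ℝ (vbar v)).smulRight (vbar v)

theorem continuous_profileOperator : Continuous (profileOperator (d := d)) := by
  have h : Continuous (vbar (d := d)) := (contDiff_vbar (n := 0)).continuous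
  have h2 := (velocityBump d).continuous
  refine h2.smul ?_
  exact ((ContinuousLinearMap.smulRightL ℝ (E1 d) (E1 d)).continuous₂).comp
    (((innerSL ℝ).continuous.comp h).prodMk h)

theorem hasCompactSupport_profileOperator : HasCompactSupport (profileOperator (d := d)) :=
  (velocityBump d).hasCompactSupport.mono fun v hv => by
    contrapose! hv
    rw [Function.mem_support, not_not] at hv ⊢
    rw [profileOperator, hv, zero_smul]

theorem profileOperator_apply (v : E d) (ξ : E1 d) :
    profileOperator v ξ = (velocityBump d v * inner ℝ (vbar v) ξ) • vbar v := by
  simp [profileOperator, smul_smul]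

theorem velocityBump_eq_zero {v : E d} (hv : ¬ ‖v‖ ≤ 1) : velocityBump d v = 0 := by
  refine image_eq_zero_of_notMem_tsupport ?_
  rw [tsupport_velocityBump]
  simpa using hv

theorem norm_profileOperator_le (v : E d) : ‖profileOperator v‖ ≤ 2 := by
  by_cases hv : ‖v‖ ≤ 1
  · rw [profileOperator, norm_smul, ContinuousLinearMap.norm_smulRight_apply, innerSL_apply_norm,
      ← sq, norm_vbar_sq, Real.norm_of_nonneg (velocityBump d).nonneg]
    have h1 : velocityBump d v ≤ 1 := (velocityBump d).le_one
    have h0 : 0 ≤ velocityBump d v := (velocityBump d).nonneg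
    nlinarith [norm_nonneg v]
  · simp [profileOperator, velocityBump_eq_zero hv]

attribute [irreducible] profileOperator

/-- The integral is a continuous quadratic form in `ξ`, positive off the origin, so its minimum on
the unit sphere is positive and serves as `c0` by homogeneity. The constant depends on the dimension
alone. -/
theorem exists_profile_coercive (d : ℕ) : ∃ c0 : ℝ, 0 < c0 ∧ ∀ ξ : E1 d,
    c0 * ‖ξ‖ ^ 2 ≤ ∫ v : E d, velocityBump d v * inner ℝ (vbar v) ξ ^ 2 := by
  have hvb : Continuous (vbar (d := d)) := (contDiff_vbar (n := 0)).continuous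
  have hχ := (velocityBump d).continuous
  have cint : ∀ ξ : E1 d, Continuous fun v : E d => velocityBump d v * inner ℝ (vbar v) ξ ^ 2 :=
    fun ξ => by fun_prop
  have kint : ∀ ξ : E1 d,
      HasCompactSupport fun v : E d => velocityBump d v * inner ℝ (vbar v) ξ ^ 2 :=
    fun ξ => (velocityBump d).hasCompactSupport.mul_right
  have hcont : Continuous fun ξ : E1 d =>
      ∫ v : E d, velocityBump d v * inner ℝ (vbar v) ξ ^ 2 := by
    have h := continuous_integral_mul_of_hasCompactSupport (d := d)
      (F := fun (ξ : E1 d) v => inner ℝ (vbar v) ξ ^ 2) (by fun_prop) hχ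
      (velocityBump d).hasCompactSupport
    refine h.congr fun ξ => integral_congr_ae (.of_forall fun v => ?_)
    simp only [smul_eq_mul]
    ring
  have hpos : ∀ ξ : E1 d, ξ ≠ 0 → 0 < ∫ v : E d, velocityBump d v * inner ℝ (vbar v) ξ ^ 2 := by
    intro ξ hξ
    -- Where the cutoff equals one, the vectors `(1,v)` span: `v = 0` detects the time component of
    -- `ξ`, and half a unit vector detects each space component.
    obtain ⟨v, hv, hvξ⟩ : ∃ v : E d, ‖v‖ ≤ 1 / 2 ∧ inner ℝ (vbar v) ξ ≠ 0 := by
      by_contra! h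
      have e0 := h 0 (by simp)
      simp only [inner_vbar, PiLp.zero_apply, zero_mul, Finset.sum_const_zero, add_zero] at e0
      refine hξ (PiLp.ext fun j => ?_)
      refine Fin.cases e0 (fun i => ?_) j
      have e1 := h (EuclideanSpace.single i (1 / 2)) (by simp)
      rw [inner_vbar, e0] at e1
      simpa [PiLp.single_apply] using e1
    refine (cint ξ).integral_pos_of_hasCompactSupport_nonneg_nonzero (kint ξ)
      (fun v => mul_nonneg (velocityBump d).nonneg (sq_nonneg _)) (x := v) ?_
    have : velocityBump d v = 1 := (velocityBump d).one_of_mem_closedBall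
      (by simpa [velocityBump] using hv)
    rw [this, one_mul]
    exact pow_ne_zero 2 hvξ
  obtain ⟨ξ0, h0, hmin⟩ := (isCompact_sphere (0 : E1 d) 1).exists_isMinOn
    (NormedSpace.sphere_nonempty.2 zero_le_one) hcont.continuousOn
  have hξ0 : ξ0 ≠ 0 := by
    rintro rfl
    simp at h0
  refine ⟨_, hpos ξ0 hξ0, fun ξ => ?_⟩
  by_cases hξ : ξ = 0
  · simp [hξ]
  have hn : ‖ξ‖ ≠ 0 := norm_ne_zero_iff.2 hξ
  have hu : ‖ξ‖⁻¹ • ξ ∈ Metric.sphere (0 : E1 d) 1 := by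
    simp [norm_smul, hn]
  have h1 := hmin hu
  have h2 : ∫ v : E d, velocityBump d v * inner ℝ (vbar v) (‖ξ‖⁻¹ • ξ) ^ 2 =
      (‖ξ‖⁻¹) ^ 2 * ∫ v : E d, velocityBump d v * inner ℝ (vbar v) ξ ^ 2 := by
    rw [← integral_const_mul]
    refine integral_congr_ae (.of_forall fun v => ?_)
    simp only [inner_smul_right]
    ring
  simp only [Set.mem_ofPred_eq, h2] at h1
  calc _ ≤ ((‖ξ‖⁻¹) ^ 2 * ∫ v : E d, velocityBump d v * inner ℝ (vbar v) ξ ^ 2) * ‖ξ‖ ^ 2 := by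
        gcongr
    _ = _ := by field_simp

end Profiles

end

end Kinetic


namespace Kinetic

noncomputable section

/-! ### The moment matrix and its inverse -/

section MomentOperator

variable {d : ℕ} {c : Collision} {G : E d → E d → E d} {M fSt : E d → E d → ℝ} {cInf cM : ℝ}

/-- The operator `∫ χ(v) (1,v) ⊗ (1,v) fSt(x,v) dv`. -/
def momentOperator (fSt : E d → E d → ℝ) (x : E d) : E1 d →L[ℝ] E1 d :=
  ∫ v, fSt x v • profileOperator v

theorem contDiff_momentOperator (hS : StationaryState c G M fSt cInf cM) :
    ContDiff ℝ 1 (momentOperator fSt) :=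
  contDiff_integral_smul hS.regular continuous_profileOperator hasCompactSupport_profileOperator

theorem hasCompactSupport_smul_right {W : Type*} [NormedAddCommGroup W] [NormedSpace ℝ W]
    (g : E d → ℝ) {k : E d → W} (hk : HasCompactSupport k) :
    HasCompactSupport fun v => g v • k v := hk.mono fun v hv => by
  contrapose! hv
  rw [Function.mem_support, not_not] at hv ⊢
  rw [hv, smul_zero]

theorem integrable_smul_of_hasCompactSupport {W : Type*} [NormedAddCommGroup W]
    [NormedSpace ℝ W] {g : E d → ℝ} (hg : Continuous g) {k : E d → W} (hk : Continuous k)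
    (hc : HasCompactSupport k) : Integrable fun v => g v • k v :=
  (hg.smul hk).integrable_of_hasCompactSupport (hasCompactSupport_smul_right g hc)

theorem integrable_smul_profileOperator {g : E d → ℝ} (hg : Continuous g) :
    Integrable fun v => g v • profileOperator (d := d) v :=
  integrable_smul_of_hasCompactSupport hg continuous_profileOperator
    hasCompactSupport_profileOperator

theorem norm_integral_smul_profileOperator_le {g : E d → ℝ} (hg : Continuous g) :
    ‖∫ v, g v • profileOperator (d := d) v‖ ≤
      2 * ∫ v in Metric.closedBall (0 : E d) 1, ‖g v‖ := by
  have ig : Integrable ((Metric.closedBall (0 : E d) 1).indicator fun v => ‖g v‖) :=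
    (integrable_indicator_iff measurableSet_closedBall).2
      (hg.norm.continuousOn.integrableOn_compact (isCompact_closedBall _ _))
  have key : ∀ v, ‖g v • profileOperator (d := d) v‖ ≤
      2 * (Metric.closedBall (0 : E d) 1).indicator (fun v => ‖g v‖) v := by
    intro v
    by_cases hv : ‖v‖ ≤ 1
    · rw [Set.indicator_of_mem (by simpa using hv), norm_smul, mul_comm]
      exact mul_le_mul_of_nonneg_right (norm_profileOperator_le v) (norm_nonneg _)
    · rw [Set.indicator_of_notMem (by simpa using hv), profileOperator, velocityBump_eq_zero hv,
        zero_smul, mul_zero, norm_smul, norm_zero, mul_zero]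
  have h := norm_integral_le_of_norm_le (ig.const_mul 2) (.of_forall key)
  rwa [integral_const_mul, integral_indicator measurableSet_closedBall] at h

theorem integral_smul_profileOperator_apply {g : E d → ℝ} (hg : Continuous g) (ξ η : E1 d) :
    inner ℝ η ((∫ v, g v • profileOperator (d := d) v) ξ) =
      ∫ v, g v * (velocityBump d v * inner ℝ (vbar v) ξ * inner ℝ (vbar v) η) := by
  have hi := integrable_smul_profileOperator hg
  rw [ContinuousLinearMap.integral_apply hi, ← integral_inner (hi.apply_continuousLinearMap ξ)]
  refine integral_congr_ae (.of_forall fun v => ?_)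
  simp only [_root_.smul_apply, profileOperator_apply, inner_smul_right,
    real_inner_comm η (vbar v)]

theorem StationaryState.continuous_slice (hS : StationaryState c G M fSt cInf cM) (x : E d) :
    Continuous (fSt x) := (contDiff_slice_right hS.regular x).continuous

/-- On the support of the cutoff `fSt` is at least `cInf ⟨fSt⟩`, which reduces the form to the model
one with constant `c0`. -/
theorem momentOperator_coercive (hS : StationaryState c G M fSt cInf cM) {c0 : ℝ}
    (hc0 : ∀ ξ : E1 d, c0 * ‖ξ‖ ^ 2 ≤ ∫ v : E d, velocityBump d v * inner ℝ (vbar v) ξ ^ 2)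
    (hcInf : 0 < cInf) (x : E d) (ξ : E1 d) :
    cInf * c0 * density fSt x * ‖ξ‖ ^ 2 ≤ inner ℝ ξ (momentOperator fSt x ξ) := by
  have hvb : Continuous (vbar (d := d)) := (contDiff_vbar (n := 0)).continuous
  have hχ := (velocityBump d).continuous
  have hf := hS.continuous_slice x
  have hρ := hS.density_pos x
  rw [momentOperator, integral_smul_profileOperator_apply hf]
  calc cInf * c0 * density fSt x * ‖ξ‖ ^ 2 = cInf * density fSt x * (c0 * ‖ξ‖ ^ 2) := by ring
    _ ≤ cInf * density fSt x * ∫ v : E d, velocityBump d v * inner ℝ (vbar v) ξ ^ 2 := by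
      have := hc0 ξ
      gcongr
    _ = ∫ v : E d, cInf * density fSt x * (velocityBump d v * inner ℝ (vbar v) ξ ^ 2) := by
      rw [integral_const_mul]
    _ ≤ _ := by
      refine integral_mono ?_ ?_ fun v => ?_
      · exact (by fun_prop : Continuous fun v : E d => cInf * density fSt x *
          (velocityBump d v * inner ℝ (vbar v) ξ ^ 2)).integrable_of_hasCompactSupport
          ((velocityBump d).hasCompactSupport.mul_right).mul_left
      · exact (by fun_prop : Continuous fun v : E d => fSt x v *
          (velocityBump d v * inner ℝ (vbar v) ξ * inner ℝ (vbar v) ξ)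
          ).integrable_of_hasCompactSupport
          ((velocityBump d).hasCompactSupport.mul_right.mul_right).mul_left
      · by_cases hv : ‖v‖ ≤ 1
        · have h1 := hS.lower_bound x v hv
          rw [le_div_iff₀ hρ] at h1
          have h2 : 0 ≤ velocityBump d v * inner ℝ (vbar v) ξ ^ 2 :=
            mul_nonneg (velocityBump d).nonneg (sq_nonneg _)
          calc _ ≤ fSt x v * (velocityBump d v * inner ℝ (vbar v) ξ ^ 2) :=
                mul_le_mul_of_nonneg_right h1 h2
            _ = _ := by ring
        · simp [velocityBump_eq_zero hv]

theorem le_norm_momentOperator (hS : StationaryState c G M fSt cInf cM) {c0 : ℝ}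
    (hc0 : ∀ ξ : E1 d, c0 * ‖ξ‖ ^ 2 ≤ ∫ v : E d, velocityBump d v * inner ℝ (vbar v) ξ ^ 2)
    (hcInf : 0 < cInf) (x : E d) (ξ : E1 d) :
    cInf * c0 * density fSt x * ‖ξ‖ ≤ ‖momentOperator fSt x ξ‖ := by
  by_cases hξ : ξ = 0
  · simp [hξ]
  have hn : 0 < ‖ξ‖ := norm_pos_iff.2 hξ
  have h1 := (momentOperator_coercive hS hc0 hcInf x ξ).trans (real_inner_le_norm _ _)
  refine le_of_mul_le_mul_left ?_ hn
  calc _ = cInf * c0 * density fSt x * ‖ξ‖ ^ 2 := by ring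
    _ ≤ _ := h1

theorem isUnit_momentOperator (hS : StationaryState c G M fSt cInf cM) {c0 : ℝ} (h0 : 0 < c0)
    (hc0 : ∀ ξ : E1 d, c0 * ‖ξ‖ ^ 2 ≤ ∫ v : E d, velocityBump d v * inner ℝ (vbar v) ξ ^ 2)
    (hcInf : 0 < cInf) (x : E d) : IsUnit (momentOperator fSt x) := by
  have hinj : Function.Injective (momentOperator fSt x) := by
    rw [injective_iff_map_eq_zero]
    intro ξ hξ
    have h1 := le_norm_momentOperator hS hc0 hcInf x ξ
    rw [hξ, norm_zero] at h1
    have h2 : 0 < cInf * c0 * density fSt x := mul_pos (mul_pos hcInf h0) (hS.density_pos x)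
    exact norm_le_zero_iff.1 (nonpos_of_mul_nonpos_right h1 h2)
  rw [ContinuousLinearMap.isUnit_iff_bijective]
  exact ⟨hinj, (LinearMap.injective_iff_surjective (f := (momentOperator fSt x).toLinearMap)).1 hinj⟩

/-- The roles of `w`: the force term enters the norm of the adjoint, the two gradient terms bound
the derivative of `momentOperator`, and `w ≥ 1` makes the weight of a field dominate that of its
derivatives. -/
theorem weight_ge (hS : StationaryState c G M fSt cInf cM) (x : E d) :
    1 + (∫ v in Metric.closedBall (0 : E d) 1, fSt x v * ‖G x v‖ ^ 2) / density fSt x ≤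
      weight G fSt x ∧
    (∫ v in Metric.closedBall (0 : E d) 1,
        ‖gradient (fun y => fSt y v / density fSt y) x‖) ^ 2
      + (‖gradient (density fSt) x‖ / density fSt x) ^ 2 ≤ weight G fSt x ∧
    1 ≤ weight G fSt x := by
  have h1 : 0 ≤ (∫ v in Metric.closedBall (0 : E d) 1, fSt x v * ‖G x v‖ ^ 2) / density fSt x :=
    div_nonneg (integral_nonneg fun v => mul_nonneg (hS.pos x v).le (sq_nonneg _))
      (hS.density_pos x).le
  unfold weight
  refine ⟨?_, ?_, ?_⟩ <;> nlinarith [sq_nonneg (∫ v in Metric.closedBall (0 : E d) 1,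
        ‖gradient (fun y => fSt y v / density fSt y) x‖),
        sq_nonneg (‖gradient (density fSt) x‖ / density fSt x)]

theorem contDiff_relative (hS : StationaryState c G M fSt cInf cM) :
    ContDiff ℝ 1 fun p : E d × E d => fSt p.1 p.2 / density fSt p.1 :=
  hS.regular.div (hS.density_regular.comp contDiff_fst) fun p => (hS.density_pos p.1).ne'

theorem continuous_norm_gradient_relative (hS : StationaryState c G M fSt cInf cM) :
    Continuous fun p : E d × E d =>
      ‖gradient (fun y => fSt y p.2 / density fSt y) p.1‖ := by
  simp only [norm_gradient]
  exact (continuous_fderiv_slice_left (F := fun x v => fSt x v / density fSt x)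
    (contDiff_relative hS)).norm

theorem continuous_weight (hS : StationaryState c G M fSt cInf cM) (hm : Model c G M) :
    Continuous (weight G fSt) := by
  have hρ := hS.density_regular
  have h1 : Continuous fun x => ∫ v in Metric.closedBall (0 : E d) 1, fSt x v * ‖G x v‖ ^ 2 :=
    continuous_parametric_integral_of_continuous (f := fun x v => fSt x v * ‖G x v‖ ^ 2)
      (show Continuous fun p : E d × E d => fSt p.1 p.2 * ‖G p.1 p.2‖ ^ 2 from
        hS.regular.continuous.mul (hm.contDiff_force.continuous.norm.pow 2))
      (isCompact_closedBall 0 1)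
  have h2 : Continuous fun x => ∫ v in Metric.closedBall (0 : E d) 1,
        ‖gradient (fun y => fSt y v / density fSt y) x‖ :=
    continuous_parametric_integral_of_continuous
      (f := fun x v => ‖gradient (fun y => fSt y v / density fSt y) x‖)
      (continuous_norm_gradient_relative hS) (isCompact_closedBall 0 1)
  have h3 : Continuous fun x => ‖gradient (density fSt) x‖ := by
    simp only [norm_gradient]
    exact (hρ.continuous_fderiv one_ne_zero).norm
  have hne : ∀ x, density fSt x ≠ 0 := fun x => (hS.density_pos x).ne'
  unfold weight
  exact ((continuous_const.add (h1.div hρ.continuous hne)).add (h2.pow 2)).add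
    ((h3.div hρ.continuous hne).pow 2)

/-- Factoring out `⟨fSt⟩` separates the logarithmic derivative of the density from the derivative of
the normalised profile; the two last terms of `w` are the squares of exactly these quantities. -/
theorem norm_fderiv_momentOperator_sq_le (hS : StationaryState c G M fSt cInf cM) (x e : E d) :
    ‖fderiv ℝ (momentOperator fSt) x e‖ ^ 2 ≤
      8 * density fSt x ^ 2 * weight G fSt x * ‖e‖ ^ 2 := by
  have hρ := hS.density_pos x
  have hrel := contDiff_relative hS
  set b : E d → (E1 d →L[ℝ] E1 d) := fun x =>
    ∫ v, (fSt x v / density fSt x) • profileOperator v with hb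
  have hb1 : ContDiff ℝ 1 b := contDiff_integral_smul (F := fun x v => fSt x v / density fSt x)
    hrel continuous_profileOperator hasCompactSupport_profileOperator
  have eB : momentOperator fSt = fun x => density fSt x • b x := by
    funext y
    have := (hS.density_pos y).ne'
    rw [momentOperator, hb, ← integral_smul]
    refine integral_congr_ae (.of_forall fun v => ?_)
    simp only [smul_smul]
    congr 1
    field_simp
  have e1 : fderiv ℝ (momentOperator fSt) x e =
      density fSt x • fderiv ℝ b x e + (fderiv ℝ (density fSt) x e) • b x := by
    rw [eB, fderiv_fun_smul (hS.density_regular.differentiable one_ne_zero x)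
      (hb1.differentiable one_ne_zero x)]
    rfl
  have b1 : ‖b x‖ ≤ 2 := by
    refine (norm_integral_smul_profileOperator_le
      ((hS.continuous_slice x).div_const (density fSt x))).trans ?_
    have hi := (hS.integrable_velocity x).div_const (density fSt x)
    have h1 : ∫ v in Metric.closedBall (0 : E d) 1, ‖fSt x v / density fSt x‖ ≤ 1 := by
      calc ∫ v in Metric.closedBall (0 : E d) 1, ‖fSt x v / density fSt x‖
          ≤ ∫ v, ‖fSt x v / density fSt x‖ :=
            setIntegral_le_integral hi.norm (.of_forall fun v => norm_nonneg _)
        _ = ∫ v, fSt x v / density fSt x := integral_congr_ae (.of_forall fun v =>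
            Real.norm_of_nonneg (div_nonneg (hS.pos x v).le hρ.le))
        _ = 1 := by
            rw [integral_div]
            exact div_self hρ.ne'
    linarith
  set I := ∫ v in Metric.closedBall (0 : E d) 1,
        ‖gradient (fun y => fSt y v / density fSt y) x‖ with hI
  have hI0 : 0 ≤ I := integral_nonneg fun v => norm_nonneg _
  have b2 : ‖fderiv ℝ b x e‖ ≤ 2 * I * ‖e‖ := by
    have cd : Continuous fun v => fderiv ℝ (fun y => fSt y v / density fSt y) x :=
      (continuous_fderiv_slice_left (F := fun x v => fSt x v / density fSt x) hrel).comp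
        (by fun_prop : Continuous fun v : E d => (x, v))
    have cg : Continuous fun v => ‖gradient (fun y => fSt y v / density fSt y) x‖ := by
      simp only [norm_gradient]
      exact cd.norm
    have e2 := fderiv_integral_smul (F := fun x v => fSt x v / density fSt x)
      hrel continuous_profileOperator hasCompactSupport_profileOperator x e
    rw [hb, e2]
    refine (norm_integral_smul_profileOperator_le (cd.clm_apply continuous_const)).trans ?_
    rw [mul_assoc, hI, ← integral_mul_const]
    refine mul_le_mul_of_nonneg_left ?_ zero_le_two
    refine integral_mono
      ((cd.clm_apply continuous_const).norm.continuousOn.integrableOn_compact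
        (isCompact_closedBall _ _))
      ((cg.mul continuous_const).continuousOn.integrableOn_compact (isCompact_closedBall _ _))
      fun v => ?_
    simp only [norm_gradient]
    exact ContinuousLinearMap.le_opNorm _ _
  have h3 : ‖fderiv ℝ (density fSt) x e‖ ≤ ‖gradient (density fSt) x‖ * ‖e‖ := by
    rw [norm_gradient]
    exact ContinuousLinearMap.le_opNorm _ _
  set J := ‖gradient (density fSt) x‖ / density fSt x with hJ
  have hJ0 : 0 ≤ J := div_nonneg (norm_nonneg _) hρ.le
  have hJ1 : ‖gradient (density fSt) x‖ = density fSt x * J := by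
    rw [hJ]; field_simp
  have h4 : ‖fderiv ℝ (momentOperator fSt) x e‖ ≤ density fSt x * (2 * (I + J) * ‖e‖) := by
    rw [e1]
    refine (norm_add_le _ _).trans ?_
    rw [norm_smul, norm_smul, Real.norm_of_nonneg hρ.le]
    rw [hJ1] at h3
    calc _ ≤ density fSt x * (2 * I * ‖e‖) + density fSt x * J * ‖e‖ * 2 := by
          gcongr
      _ = _ := by ring
  have h5 := (weight_ge hS x).2.1
  rw [← hI, ← hJ] at h5
  -- Here `I² + J² ≤ w`. This factor `2`, with the square of the `2` that bounds the profile
  -- operator, gives the `8` of the statement.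
  have h6 : (I + J) ^ 2 ≤ 2 * weight G fSt x := by nlinarith [sq_nonneg (I - J)]
  calc ‖fderiv ℝ (momentOperator fSt) x e‖ ^ 2 ≤ (density fSt x * (2 * (I + J) * ‖e‖)) ^ 2 := by
        gcongr
    _ = 4 * density fSt x ^ 2 * (I + J) ^ 2 * ‖e‖ ^ 2 := by ring
    _ ≤ 4 * density fSt x ^ 2 * (2 * weight G fSt x) * ‖e‖ ^ 2 := by gcongr
    _ = _ := by ring

/-- The coefficients `Z` solving `momentOperator Z = Φ`. -/
def invertMoments (fSt : E d → E d → ℝ) (Φ : ℝ × E d → E1 d) (p : ℝ × E d) : E1 d :=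
  Ring.inverse (momentOperator fSt p.2) (Φ p)

variable {Φ : ℝ × E d → E1 d}

theorem hasCompactSupport_invertMoments (hc : HasCompactSupport Φ) :
    HasCompactSupport (invertMoments fSt Φ) := hc.mono fun p hp => by
  contrapose! hp
  rw [Function.mem_support, not_not] at hp ⊢
  rw [invertMoments, hp, map_zero]

/-- Inversion is smooth at units of the algebra of operators. The moment operator is a unit at every
`x`, so the default value of `Ring.inverse` never occurs. -/
theorem contDiff_invertMoments (hS : StationaryState c G M fSt cInf cM) {c0 : ℝ} (h0 : 0 < c0)
    (hc0 : ∀ ξ : E1 d, c0 * ‖ξ‖ ^ 2 ≤ ∫ v : E d, velocityBump d v * inner ℝ (vbar v) ξ ^ 2)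
    (hcInf : 0 < cInf) (hΦ : ContDiff ℝ 1 Φ) : ContDiff ℝ 1 (invertMoments fSt Φ) := by
  unfold invertMoments
  refine ContDiff.clm_apply ?_ hΦ
  rw [contDiff_iff_contDiffAt]
  intro p
  obtain ⟨u, hu⟩ := isUnit_momentOperator hS h0 hc0 hcInf p.2
  have h1 : ContDiffAt ℝ 1 (Ring.inverse : (E1 d →L[ℝ] E1 d) → (E1 d →L[ℝ] E1 d))
      (momentOperator fSt p.2) := by
    rw [← hu]
    exact contDiffAt_ringInverse ℝ u
  exact h1.comp p ((contDiff_momentOperator hS).comp contDiff_snd).contDiffAt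

theorem momentOperator_invertMoments (hS : StationaryState c G M fSt cInf cM) {c0 : ℝ}
    (h0 : 0 < c0)
    (hc0 : ∀ ξ : E1 d, c0 * ‖ξ‖ ^ 2 ≤ ∫ v : E d, velocityBump d v * inner ℝ (vbar v) ξ ^ 2)
    (hcInf : 0 < cInf) (p : ℝ × E d) :
    momentOperator fSt p.2 (invertMoments fSt Φ p) = Φ p := by
  have h := Ring.mul_inverse_cancel _ (isUnit_momentOperator hS h0 hc0 hcInf p.2)
  exact congrArg (fun L : E1 d →L[ℝ] E1 d => L (Φ p)) h

theorem fderiv_momentOperator_invertMoments (hS : StationaryState c G M fSt cInf cM) {c0 : ℝ}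
    (h0 : 0 < c0)
    (hc0 : ∀ ξ : E1 d, c0 * ‖ξ‖ ^ 2 ≤ ∫ v : E d, velocityBump d v * inner ℝ (vbar v) ξ ^ 2)
    (hcInf : 0 < cInf) (hΦ : ContDiff ℝ 1 Φ) (p e : ℝ × E d) :
    fderiv ℝ Φ p e = momentOperator fSt p.2 (fderiv ℝ (invertMoments fSt Φ) p e) +
      fderiv ℝ (momentOperator fSt) p.2 e.2 (invertMoments fSt Φ p) := by
  have hZ := (contDiff_invertMoments hS h0 hc0 hcInf hΦ).differentiable one_ne_zero p
  have hB := ((contDiff_momentOperator hS).differentiable one_ne_zero p.2).hasFDerivAt.comp p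
    (hasFDerivAt_snd (𝕜 := ℝ) (E := ℝ) (F := E d) (p := p))
  have h := hB.clm_apply hZ.hasFDerivAt
  have h2 := h.congr_of_eventuallyEq (f₁ := Φ)
    (.of_forall fun q => (momentOperator_invertMoments hS h0 hc0 hcInf q).symm)
  rw [h2.fderiv]
  rfl

/-- Bounds on the coefficients in terms of `Φ`. -/
theorem invertMoments_bounds (hS : StationaryState c G M fSt cInf cM) {c0 : ℝ}
    (h0 : 0 < c0)
    (hc0 : ∀ ξ : E1 d, c0 * ‖ξ‖ ^ 2 ≤ ∫ v : E d, velocityBump d v * inner ℝ (vbar v) ξ ^ 2)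
    (hcInf : 0 < cInf) (hΦ : ContDiff ℝ 1 Φ) (p : ℝ × E d) :
    ‖invertMoments fSt Φ p‖ ^ 2 ≤ ((cInf * c0) ^ 2)⁻¹ * (‖Φ p‖ ^ 2 / density fSt p.2 ^ 2) ∧
    ∀ j, ‖fderiv ℝ (invertMoments fSt Φ) p (direction j)‖ ^ 2 ≤
      ((cInf * c0) ^ 2)⁻¹ * (2 + 16 * ((cInf * c0) ^ 2)⁻¹) *
        ((‖fderiv ℝ Φ p (direction j)‖ ^ 2 + ‖Φ p‖ ^ 2 * weight G fSt p.2) /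
          density fSt p.2 ^ 2) := by
  set κ := cInf * c0 with hκ
  have hκ0 : 0 < κ := mul_pos hcInf h0
  set ρ := density fSt p.2 with hρ
  have hρ0 : 0 < ρ := hS.density_pos p.2
  set w := weight G fSt p.2 with hw
  have hw1 : 1 ≤ w := (weight_ge hS p.2).2.2
  set Z := invertMoments fSt Φ p with hZ
  have hZ1 : ‖Z‖ ^ 2 ≤ (κ ^ 2)⁻¹ * (‖Φ p‖ ^ 2 / ρ ^ 2) := by
    have h1 := le_norm_momentOperator hS hc0 hcInf p.2 Z
    rw [hZ, momentOperator_invertMoments hS h0 hc0 hcInf, ← hZ, ← hκ, ← hρ] at h1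
    have h2 : (κ * ρ * ‖Z‖) ^ 2 ≤ ‖Φ p‖ ^ 2 := by gcongr
    rw [inv_mul_eq_div, div_div, le_div_iff₀ (by positivity)]
    calc _ = (κ * ρ * ‖Z‖) ^ 2 := by ring
      _ ≤ _ := h2
  refine ⟨hZ1, fun j => ?_⟩
  set D := fderiv ℝ (invertMoments fSt Φ) p (direction j) with hD
  have h1 := le_norm_momentOperator hS hc0 hcInf p.2 D
  have h2 := fderiv_momentOperator_invertMoments hS h0 hc0 hcInf hΦ p (direction j)
  rw [← hD, ← hZ] at h2
  -- Differentiating `B Z = Φ` gives `B Z' = Φ' - B' Z`, to which the lower bound on `B` applies.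
  have h3 : momentOperator fSt p.2 D = fderiv ℝ Φ p (direction j) -
      fderiv ℝ (momentOperator fSt) p.2 (direction j : ℝ × E d).2 Z := by
    rw [h2, add_sub_cancel_right]
  set P := ‖fderiv ℝ Φ p (direction j)‖ with hP
  set R := ‖fderiv ℝ (momentOperator fSt) p.2 (direction j : ℝ × E d).2‖ with hR
  have h4 : κ * ρ * ‖D‖ ≤ P + R * ‖Z‖ := by
    refine h1.trans ?_
    rw [h3]
    exact (norm_sub_le _ _).trans (add_le_add le_rfl (ContinuousLinearMap.le_opNorm _ _))
  have h5 : R ^ 2 ≤ 8 * ρ ^ 2 * w := by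
    refine (norm_fderiv_momentOperator_sq_le hS p.2 _).trans ?_
    have := norm_direction_snd_le (d := d) j
    calc _ ≤ 8 * ρ ^ 2 * w * 1 ^ 2 := by gcongr
      _ = _ := by ring
  have h6 : (κ * ρ * ‖D‖) ^ 2 ≤ 2 * P ^ 2 + 2 * (R ^ 2 * ‖Z‖ ^ 2) := by
    have : (κ * ρ * ‖D‖) ^ 2 ≤ (P + R * ‖Z‖) ^ 2 := by gcongr
    nlinarith [sq_nonneg (P - R * ‖Z‖)]
  have h7 : R ^ 2 * ‖Z‖ ^ 2 ≤ 8 * ρ ^ 2 * w * ((κ ^ 2)⁻¹ * (‖Φ p‖ ^ 2 / ρ ^ 2)) := by gcongr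
  have h8 : 8 * ρ ^ 2 * w * ((κ ^ 2)⁻¹ * (‖Φ p‖ ^ 2 / ρ ^ 2)) =
      8 * (κ ^ 2)⁻¹ * (‖Φ p‖ ^ 2 * w) := by field_simp
  have h9 : (κ * ρ * ‖D‖) ^ 2 ≤ (2 + 16 * (κ ^ 2)⁻¹) * (P ^ 2 + ‖Φ p‖ ^ 2 * w) := by
    have e1 : 0 ≤ ‖Φ p‖ ^ 2 * w := by positivity
    have e2 : 0 ≤ (κ ^ 2)⁻¹ * P ^ 2 := by positivity
    nlinarith
  rw [mul_assoc, inv_mul_eq_div, le_div_iff₀ (by positivity), ← mul_div_assoc,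
    le_div_iff₀ (by positivity)]
  calc _ = (κ * ρ * ‖D‖) ^ 2 := by ring
    _ ≤ _ := h9

end MomentOperator

end

end Kinetic


namespace Kinetic

noncomputable section

/-! ### Local equilibria see the divergence of the field -/

section MomentIdentity

variable {d : ℕ} {c : Collision} {G : E d → E d → E d} {M fSt : E d → E d → ℝ} {cInf cM : ℝ}

/-- Stationarity tested against a velocity profile. -/
theorem integral_mul_velocityAdjoint (hS : StationaryState c G M fSt cInf cM) (hm : Model c G M)
    {a : E d → ℝ} (ha : ContDiff ℝ 2 a) (hac : HasCompactSupport a) (x : E d) :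
    ∫ v, fSt x v * velocityAdjoint c G M a x v = ∫ v, fderiv ℝ (fun y => fSt y v) x v * a v := by
  have ha1 : ContDiff ℝ 1 a := ha.of_le one_le_two
  have hfx := hS.continuous_slice x
  have hGx : ContDiff ℝ 1 (G x) := contDiff_slice_right hm.contDiff_force x
  have hfG : ContDiff ℝ 1 fun v => fSt x v • G x v := (contDiff_slice_right hS.regular x).smul hGx
  obtain ⟨A, hA⟩ := ha.continuous.bounded_above_of_compact_support hac
  have i1 : Integrable fun v => fderiv ℝ (fun y => fSt y v) x v * a v :=
    ((((continuous_fderiv_slice_left hS.regular).comp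
      (by fun_prop : Continuous fun v : E d => (x, v))).clm_apply continuous_id).mul
      ha.continuous).integrable_of_hasCompactSupport hac.mul_left
  have i2 : Integrable fun v => divergence (fun u => fSt x u • G x u) v * a v :=
    ((continuous_divergence hfG).mul ha.continuous).integrable_of_hasCompactSupport hac.mul_left
  have i3 : Integrable fun v => fSt x v * fderiv ℝ a v (G x v) := by
    refine (hfx.mul ((ha1.continuous_fderiv one_ne_zero).clm_apply
      hGx.continuous)).integrable_of_hasCompactSupport (HasCompactSupport.intro hac.isCompact
      fun v hv => ?_)
    show fSt x v * fderiv ℝ a v (G x v) = 0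
    rw [fderiv_eq_zero_of_notMem_tsupport hv]
    simp
  have i4 : Integrable fun v => fSt x v * collisionAdjoint c M a x v := by
    obtain ⟨C, hC⟩ := exists_bound_collisionAdjoint hS hm ha hac (isCompact_singleton (x := x))
    exact (hS.integrable_velocity x).mul_bdd (c := C)
      ((continuous_collisionAdjoint hS hm ha hac).comp
        (by fun_prop : Continuous fun v : E d => (x, v))).aestronglyMeasurable
      (.of_forall fun v => hC x rfl v)
  have e1 : ∫ v, divergence (fun u => fSt x u • G x u) v * a v =
      - ∫ v, fSt x v * fderiv ℝ a v (G x v) := by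
    rw [integral_divergence_mul hfG ha1 (Or.inr hac)]
    simp
  have e2 : ∫ v, collision c M fSt x v * a v = ∫ v, fSt x v * collisionAdjoint c M a x v := by
    cases c with
    | FP =>
      obtain ⟨hM, hpos⟩ := hm.fp_regular rfl
      exact integral_collision_mul_fp hM hpos (hS.fp_regular rfl) ha (Or.inr hac)
    | BGK =>
      exact integral_collision_mul_bgk hm.integrable (hS.integrable_velocity x) ha.continuous hA
  -- The stationary equation itself: the collision term equals `v · ∇_x fSt` plus the force
  -- divergence, so only the spatial transport term survives in the end.
  have e3 : ∫ v, collision c M fSt x v * a v =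
      (∫ v, fderiv ℝ (fun y => fSt y v) x v * a v) +
        ∫ v, divergence (fun u => fSt x u • G x u) v * a v := by
    rw [← integral_add i1 i2]
    refine integral_congr_ae (.of_forall fun v => ?_)
    simp only [← hS.stationary, transport, inner_gradient_right, add_mul]
  calc ∫ v, fSt x v * velocityAdjoint c G M a x v
      = (∫ v, fSt x v * fderiv ℝ a v (G x v)) + ∫ v, fSt x v * collisionAdjoint c M a x v := by
        rw [← integral_add i3 i4]
        refine integral_congr_ae (.of_forall fun v => ?_)
        simp only [velocityAdjoint, mul_add]
    _ = _ := by linarith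

/-- The adjoint equation applied to `χ(v) (1,v) · Z(t,x)`. -/
def vectorAdjoint (c : Collision) (G : E d → E d → E d) (M : E d → E d → ℝ)
    (Z : ℝ × E d → E1 d) (t : ℝ) (p : E d × E d) : ℝ :=
  ∑ j, spacetimeAdjoint c G M (profile j) (fun q => Z q j) t p

variable {Z : ℝ × E d → E1 d}

theorem contDiff_coord (hZ : ContDiff ℝ 1 Z) (j : Fin (d + 1)) : ContDiff ℝ 1 fun q => Z q j :=
  (contDiff_euclidean.1 hZ) j

theorem hasCompactSupport_coord (hZc : HasCompactSupport Z) (j : Fin (d + 1)) :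
    HasCompactSupport fun q => Z q j :=
  hZc.comp_left (g := fun ξ : E1 d => ξ j) rfl

theorem fderiv_coord (hZ : ContDiff ℝ 1 Z) (j : Fin (d + 1)) (p e : ℝ × E d) :
    fderiv ℝ (fun q => Z q j) p e = (fderiv ℝ Z p e) j := by
  have h : HasFDerivAt (fun q => Z q j)
      ((EuclideanSpace.proj (𝕜 := ℝ) j).comp (fderiv ℝ Z p)) p :=
    (EuclideanSpace.proj (𝕜 := ℝ) j).hasFDerivAt.comp p
      (hZ.differentiable one_ne_zero p).hasFDerivAt
  rw [h.fderiv]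
  rfl

theorem sum_profile_mul (v : E d) (ξ : E1 d) :
    ∑ j, profile j v * ξ j = velocityBump d v * inner ℝ (vbar v) ξ := by
  simp only [profile, PiLp.inner_apply, Finset.mul_sum]
  refine Finset.sum_congr rfl fun j _ => ?_
  simp only [RCLike.inner_apply, conj_trivial]
  ring

/-- The right-hand side is the time-space divergence of `momentOperator` applied to `Z`. Derivatives
of `Z` come directly from the first order part of the adjoint; the derivative falling on the
operator is produced by the zeroth order part through stationarity. -/
theorem integral_mul_vectorAdjoint (hS : StationaryState c G M fSt cInf cM) (hm : Model c G M)
    (hZ : ContDiff ℝ 1 Z) (t : ℝ) (x : E d) :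
    ∫ v, fSt x v * vectorAdjoint c G M Z t (x, v) =
      ∑ i, (momentOperator fSt x (fderiv ℝ Z (t, x) (direction i)) +
        fderiv ℝ (momentOperator fSt) x (direction i : ℝ × E d).2 (Z (t, x))) i := by
  have hvb : Continuous (vbar (d := d)) := (contDiff_vbar (n := 0)).continuous
  have hvbi : ∀ i, Continuous fun v : E d => vbar v i := fun i =>
    (contDiff_euclidean.1 (contDiff_vbar (n := 0)) i).continuous
  have hχ := (velocityBump d).continuous
  have hf := hS.continuous_slice x
  set L := fderiv ℝ Z (t, x) with hL
  set ζ := Z (t, x) with hζ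
  have hfd : ∀ e : E d, Continuous fun v => fderiv ℝ (fun y => fSt y v) x e := fun e =>
    ((continuous_fderiv_slice_left hS.regular).comp
      (by fun_prop : Continuous fun v : E d => (x, v))).clm_apply continuous_const
  have hfv : Continuous fun v => fderiv ℝ (fun y => fSt y v) x v :=
    ((continuous_fderiv_slice_left hS.regular).comp
      (by fun_prop : Continuous fun v : E d => (x, v))).clm_apply continuous_id
  have comp : ∀ (η : E1 d) i, η i = inner ℝ (EuclideanSpace.single i (1 : ℝ)) η := fun η i => by
    simp [EuclideanSpace.inner_single_left]
  have compv : ∀ (v : E d) i, inner ℝ (vbar v) (EuclideanSpace.single i (1 : ℝ)) = vbar v i :=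
    fun v i => by simp [EuclideanSpace.inner_single_right]
  have bint : ∀ g : E d → ℝ, Continuous g → Integrable fun v => velocityBump d v * g v :=
    fun g hg => (hχ.mul hg).integrable_of_hasCompactSupport
      (velocityBump d).hasCompactSupport.mul_right
  -- the first family of terms
  have A1 : ∑ i, (momentOperator fSt x (L (direction i))) i =
      ∫ v, fSt x v * (velocityBump d v * inner ℝ (vbar v) (L (1, v))) := by
    have : ∀ i, (momentOperator fSt x (L (direction i))) i =
        ∫ v, velocityBump d v * (fSt x v * inner ℝ (vbar v) (L (direction i)) * vbar v i) := by
      intro i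
      rw [comp, momentOperator, integral_smul_profileOperator_apply hf]
      refine integral_congr_ae (.of_forall fun v => ?_)
      simp only [compv]
      ring
    simp only [this]
    rw [← integral_finsetSum _ fun i _ => bint _ (by have := hvbi i; fun_prop)]
    refine integral_congr_ae (.of_forall fun v => ?_)
    simp only [map_one_vbar, inner_sum, inner_smul_right, Finset.mul_sum]
    refine Finset.sum_congr rfl fun i _ => ?_
    ring
  -- The time direction has zero spatial component, so summing `(1,v)` against the directions leaves
  -- only `v · ∇_x fSt`.
  have A2 : ∑ i, (fderiv ℝ (momentOperator fSt) x (direction i : ℝ × E d).2 ζ) i =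
      ∫ v, fderiv ℝ (fun y => fSt y v) x v * (velocityBump d v * inner ℝ (vbar v) ζ) := by
    have : ∀ i, (fderiv ℝ (momentOperator fSt) x (direction i : ℝ × E d).2 ζ) i =
        ∫ v, velocityBump d v * (fderiv ℝ (fun y => fSt y v) x (direction i : ℝ × E d).2 *
          inner ℝ (vbar v) ζ * vbar v i) := by
      intro i
      have e : fderiv ℝ (momentOperator fSt) x (direction i : ℝ × E d).2 =
          ∫ v, fderiv ℝ (fun y => fSt y v) x (direction i : ℝ × E d).2 • profileOperator v :=
        fderiv_integral_smul hS.regular continuous_profileOperator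
          hasCompactSupport_profileOperator _ _
      rw [comp, e, integral_smul_profileOperator_apply (hfd _)]
      refine integral_congr_ae (.of_forall fun v => ?_)
      simp only [compv]
      ring
    simp only [this]
    rw [← integral_finsetSum _ fun i _ => bint _ (by
      have := hvbi i; have := hfd (direction i : ℝ × E d).2; fun_prop)]
    refine integral_congr_ae (.of_forall fun v => ?_)
    have e2 : v = ∑ i, vbar v i • (direction i : ℝ × E d).2 := by
      have := congrArg Prod.snd (sum_vbar_smul_direction v)
      rw [Prod.snd_sum] at this
      exact this.symm
    have e3 : fderiv ℝ (fun y => fSt y v) x v =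
        ∑ i, vbar v i * fderiv ℝ (fun y => fSt y v) x (direction i : ℝ × E d).2 := by
      generalize fderiv ℝ (fun y => fSt y v) x = Λ
      conv_lhs => rw [e2, map_sum]
      simp
    simp only [e3, Finset.sum_mul]
    refine Finset.sum_congr rfl fun i _ => ?_
    ring
  -- By stationarity the zeroth order terms give the same integral as in `A2`.
  have B2 : ∑ j, ζ j * ∫ v, fSt x v * velocityAdjoint c G M (profile j) x v =
      ∫ v, fderiv ℝ (fun y => fSt y v) x v * (velocityBump d v * inner ℝ (vbar v) ζ) := by
    simp only [fun j => integral_mul_velocityAdjoint hS hm (contDiff_two_profile j)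
      (hasCompactSupport_profile j) x, ← integral_const_mul]
    rw [← integral_finsetSum _ fun j _ => ?_]
    · refine integral_congr_ae (.of_forall fun v => ?_)
      simp only [← sum_profile_mul, Finset.mul_sum]
      refine Finset.sum_congr rfl fun i _ => ?_
      ring
    · exact ((hfv.mul (contDiff_two_profile j).continuous).integrable_of_hasCompactSupport
        (hasCompactSupport_profile j).mul_left).const_mul _
  have i4 : ∀ j, Integrable fun v => fSt x v * velocityAdjoint c G M (profile j) x v := by
    intro j
    obtain ⟨C, hC⟩ := exists_bound_velocityAdjoint hS hm (contDiff_two_profile j)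
      (hasCompactSupport_profile j) (isCompact_singleton (x := x))
    exact (hS.integrable_velocity x).mul_bdd (c := C)
      ((continuous_velocityAdjoint hS hm (contDiff_two_profile j)
        (hasCompactSupport_profile j)).comp
        (by fun_prop : Continuous fun v : E d => (x, v))).aestronglyMeasurable
      (.of_forall fun v => hC x rfl v)
  have i5 : Integrable fun v => fSt x v * (velocityBump d v * inner ℝ (vbar v) (L (1, v))) := by
    have : Continuous fun v : E d => L (1, v) := by fun_prop
    refine (bint (fun v => fSt x v * inner ℝ (vbar v) (L (1, v))) (by fun_prop)).congr
      (.of_forall fun v => ?_)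
    simp only
    ring
  have split : ∀ v, fSt x v * vectorAdjoint c G M Z t (x, v) =
      fSt x v * (velocityBump d v * inner ℝ (vbar v) (L (1, v))) +
        ∑ j, ζ j * (fSt x v * velocityAdjoint c G M (profile j) x v) := by
    intro v
    simp only [vectorAdjoint, spacetimeAdjoint, fderiv_coord hZ]
    rw [Finset.sum_add_distrib, sum_profile_mul, mul_add, Finset.mul_sum]
    congr 1
    refine Finset.sum_congr rfl fun j _ => ?_
    simp only [hζ]
    ring
  simp only [PiLp.add_apply, Finset.sum_add_distrib]
  rw [A1, A2, ← B2]
  simp only [split]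
  rw [integral_add i5 (integrable_finsetSum _ fun j _ => (i4 j).const_mul _),
    integral_finsetSum _ fun j _ => (i4 j).const_mul _]
  simp only [integral_const_mul]

end MomentIdentity

/-! ### Pointwise bounds on the adjoint -/

section MicroPart

variable {d : ℕ} {c : Collision} {G : E d → E d → E d} {M fSt : E d → E d → ℝ} {cInf cM : ℝ}

/-- The part of `collisionAdjoint` that is supported where the profile is. -/
def collisionAdjointLocal (c : Collision) (M : E d → E d → ℝ) (a : E d → ℝ) (x v : E d) : ℝ :=
  match c with
  | Collision.FP => divergence (fun u => M x u • gradient a u) v / M x v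
  | Collision.BGK => - a v

/-- The part of `collisionAdjoint` that does not depend on the velocity. -/
def collisionAdjointMean (c : Collision) (M : E d → E d → ℝ) (a : E d → ℝ) (x : E d) : ℝ :=
  match c with
  | Collision.FP => 0
  | Collision.BGK => ∫ u, M x u * a u

theorem collisionAdjoint_eq (a : E d → ℝ) (x v : E d) : collisionAdjoint c M a x v =
    collisionAdjointLocal c M a x v + collisionAdjointMean c M a x := by
  cases c with
  | FP => simp [collisionAdjoint, collisionAdjointLocal, collisionAdjointMean]
  | BGK => simp only [collisionAdjoint, collisionAdjointLocal, collisionAdjointMean]; ring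

/-- `vectorAdjoint` up to a function of time and space. -/
def microAdjoint (c : Collision) (G : E d → E d → E d) (M : E d → E d → ℝ)
    (Z : ℝ × E d → E1 d) (t : ℝ) (p : E d × E d) : ℝ :=
  ∑ j, (profile j p.2 * fderiv ℝ (fun q => Z q j) (t, p.1) (1, p.2) + Z (t, p.1) j *
    (fderiv ℝ (profile j) p.2 (G p.1 p.2) + collisionAdjointLocal c M (profile j) p.1 p.2))

/-- The velocity independent part of `vectorAdjoint`. -/
def meanAdjoint (c : Collision) (M : E d → E d → ℝ) (Z : ℝ × E d → E1 d) (t : ℝ) (x : E d) : ℝ :=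
  ∑ j, Z (t, x) j * collisionAdjointMean c M (profile j) x

/-- For BGK the adjoint has a part constant in `v`, which is not confined to `|v| ≤ 1`. Being a
function of `(t,x)` it is orthogonal to `micro f` and can be dropped; what remains is supported
where the hypotheses on `M` and `fSt` are available. -/
theorem vectorAdjoint_eq (Z : ℝ × E d → E1 d) (t : ℝ) :
    vectorAdjoint c G M Z t = microAdjoint c G M Z t + fun p => meanAdjoint c M Z t p.1 := by
  funext p
  simp only [vectorAdjoint, microAdjoint, meanAdjoint, Pi.add_apply, ← Finset.sum_add_distrib]
  refine Finset.sum_congr rfl fun j _ => ?_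
  simp only [spacetimeAdjoint, velocityAdjoint, collisionAdjoint_eq]
  ring

theorem exists_profile_bound (d : ℕ) : ∃ L : ℝ, 1 ≤ L ∧ ∀ (j : Fin (d + 1)) (v : E d),
    |profile j v| ≤ L ∧ ‖fderiv ℝ (profile j) v‖ ≤ L ∧
      |divergence (gradient (profile (d := d) j)) v| ≤ L := by
  have h : ∀ j : Fin (d + 1), ∃ L : ℝ, 0 ≤ L ∧ ∀ v : E d,
      |profile j v| ≤ L ∧ ‖fderiv ℝ (profile j) v‖ ≤ L ∧
      |divergence (gradient (profile (d := d) j)) v| ≤ L := by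
    intro j
    have h2 := contDiff_two_profile (d := d) j
    have hc := hasCompactSupport_profile (d := d) j
    obtain ⟨A, hA⟩ := h2.continuous.bounded_above_of_compact_support hc
    obtain ⟨B, hB⟩ := (h2.continuous_fderiv two_ne_zero).bounded_above_of_compact_support
      (hc.fderiv (𝕜 := ℝ))
    have hd := continuous_divergence (contDiff_gradient h2)
    have hdc : HasCompactSupport (divergence (gradient (profile (d := d) j))) := by
      refine HasCompactSupport.intro hc.isCompact fun v hv => ?_
      refine divergence_eq_zero_of_notMem fun h => hv ?_
      refine closure_minimal ?_ (isClosed_tsupport _) h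
      intro u hu
      by_contra h0
      simp [gradient, fderiv_eq_zero_of_notMem_tsupport h0] at hu
    obtain ⟨D, hD⟩ := hd.bounded_above_of_compact_support hdc
    have hA0 := (norm_nonneg _).trans (hA 0)
    have hB0 := (norm_nonneg _).trans (hB 0)
    have hD0 := (norm_nonneg _).trans (hD 0)
    exact ⟨A + B + D, by positivity, fun v =>
      ⟨(hA v).trans (by linarith), (hB v).trans (by linarith), (hD v).trans (by linarith)⟩⟩
  choose L hL0 hL using h
  have hs : ∀ j, L j ≤ 1 + ∑ i, L i := fun j =>
    (Finset.single_le_sum (fun i _ => hL0 i) (Finset.mem_univ j)).trans (by linarith)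
  refine ⟨1 + ∑ i, L i, by linarith [Finset.sum_nonneg fun i (_ : i ∈ Finset.univ) => hL0 i],
    fun j v => ?_⟩
  obtain ⟨h1, h2, h3⟩ := hL j v
  exact ⟨h1.trans (hs j), h2.trans (hs j), h3.trans (hs j)⟩

/-- For Fokker-Planck, `∇·(M ∇a)/M = Δa + ∇M·∇a/M`, and `cM` bounds the logarithmic derivative of
`M`. The absolute value of `cM` avoids a sign assumption. -/
theorem abs_collisionAdjointLocal_le (hS : StationaryState c G M fSt cInf cM)
    (hm : Model c G M) {L : ℝ} (hL : ∀ (j : Fin (d + 1)) (v : E d),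
      |profile j v| ≤ L ∧ ‖fderiv ℝ (profile j) v‖ ≤ L ∧
      |divergence (gradient (profile (d := d) j)) v| ≤ L) (j : Fin (d + 1)) (x : E d) {v : E d}
    (hv : ‖v‖ ≤ 1) : |collisionAdjointLocal c M (profile j) x v| ≤ L * (1 + |cM|) := by
  obtain ⟨h1, h2, h3⟩ := hL j v
  have hL0 : 0 ≤ L := (abs_nonneg _).trans h1
  cases c with
  | FP =>
    obtain ⟨hM, hpos⟩ := hm.fp_regular rfl
    have hb := hS.fp_bound rfl x v hv
    rw [norm_gradient] at hb
    have e : collisionAdjointLocal Collision.FP M (profile j) x v =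
        divergence (gradient (profile j)) v +
          fderiv ℝ (fun u => M x u) v (gradient (profile j) v) / M x v := by
      have := (hpos x v).ne'
      rw [collisionAdjointLocal, divergence_smul
        ((contDiff_slice_right hM x).differentiable two_ne_zero v)
        ((contDiff_gradient (contDiff_two_profile j)).differentiable one_ne_zero v)]
      field_simp
    have h4 : |fderiv ℝ (fun u => M x u) v (gradient (profile j) v) / M x v| ≤ |cM| * L := by
      rw [abs_div, abs_of_pos (hpos x v)]
      calc _ ≤ (‖fderiv ℝ (fun u => M x u) v‖ * ‖gradient (profile (d := d) j) v‖) / M x v := by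
            exact div_le_div_of_nonneg_right
              ((fderiv ℝ (fun u => M x u) v).le_opNorm _) (hpos x v).le
        _ = (‖fderiv ℝ (fun u => M x u) v‖ / M x v) * ‖gradient (profile (d := d) j) v‖ := by ring
        _ ≤ |cM| * L := by
            rw [norm_gradient]
            exact mul_le_mul (hb.trans (le_abs_self _)) h2 (norm_nonneg _) (abs_nonneg _)
    rw [e]
    refine (abs_add_le _ _).trans ((add_le_add h3 h4).trans (le_of_eq (by ring)))
  | BGK =>
    simp only [collisionAdjointLocal, abs_neg]
    refine h1.trans ?_
    nlinarith [abs_nonneg cM]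

variable {Z : ℝ × E d → E1 d}

theorem abs_vbar_le {v : E d} (hv : ‖v‖ ≤ 1) (i : Fin (d + 1)) : |vbar v i| ≤ 1 := by
  refine Fin.cases ?_ (fun i => ?_) i
  · simp
  · exact (PiLp.norm_apply_le v i).trans hv

theorem collisionAdjointLocal_profile_eq_zero (j : Fin (d + 1)) (x : E d) {v : E d}
    (hv : ¬ ‖v‖ ≤ 1) : collisionAdjointLocal c M (profile j) x v = 0 := by
  have hv' : v ∉ tsupport (profile (d := d) j) := fun h => hv (by
    simpa using tsupport_profile_subset j h)
  cases c with
  | FP => simp [collisionAdjointLocal, divergence_smul_gradient_eq_zero hv']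
  | BGK => simp [collisionAdjointLocal, image_eq_zero_of_notMem_tsupport hv']

theorem microAdjoint_eq_zero (t : ℝ) {p : E d × E d} (hv : ¬ ‖p.2‖ ≤ 1) :
    microAdjoint c G M Z t p = 0 := by
  refine Finset.sum_eq_zero fun j _ => ?_
  have hv' : p.2 ∉ tsupport (profile (d := d) j) := fun h => hv (by
    simpa using tsupport_profile_subset j h)
  rw [collisionAdjointLocal_profile_eq_zero j _ hv, fderiv_eq_zero_of_notMem_tsupport hv',
    image_eq_zero_of_notMem_tsupport hv']
  simp

theorem sum_abs_sq_le (ξ : E1 d) : (∑ j, |ξ j|) ^ 2 ≤ (d + 1) * ‖ξ‖ ^ 2 := by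
  have h := sq_sum_le_card_mul_sum_sq (s := Finset.univ) (f := fun j => |ξ j|)
  simp only [Finset.card_univ, Fintype.card_fin, sq_abs, Nat.cast_add, Nat.cast_one] at h
  rw [EuclideanSpace.norm_sq_eq]
  simpa using h

/-- The force enters only through `|G|²` multiplied by `|Z|²`, since it differentiates the profile
and not `Z`. This is why `w` contains `∫ fSt |G|²` and no derivative of `G`. -/
theorem microAdjoint_sq_le (hS : StationaryState c G M fSt cInf cM)
    (hm : Model c G M) {L : ℝ} (hL1 : 1 ≤ L) (hL : ∀ (j : Fin (d + 1)) (v : E d),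
      |profile j v| ≤ L ∧ ‖fderiv ℝ (profile j) v‖ ≤ L ∧
      |divergence (gradient (profile (d := d) j)) v| ≤ L) (hZ : ContDiff ℝ 1 Z) (t : ℝ)
    {p : E d × E d} (hv : ‖p.2‖ ≤ 1) :
    microAdjoint c G M Z t p ^ 2 ≤ 4 * L ^ 2 * (d + 1) ^ 2 * (1 + |cM|) ^ 2 *
      ((∑ i, ‖fderiv ℝ Z (t, p.1) (direction i)‖ ^ 2) +
        ‖Z (t, p.1)‖ ^ 2 * (‖G p.1 p.2‖ ^ 2 + 1)) := by
  have hL0 : 0 ≤ L := zero_le_one.trans hL1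
  set ζ := Z (t, p.1) with hζ
  set D : Fin (d + 1) → E1 d := fun i => fderiv ℝ Z (t, p.1) (direction i) with hD
  set g := ‖G p.1 p.2‖ with hg
  have hg0 : 0 ≤ g := norm_nonneg _
  have hterm : ∀ j, |profile j p.2 * fderiv ℝ (fun q => Z q j) (t, p.1) (1, p.2) + ζ j *
      (fderiv ℝ (profile j) p.2 (G p.1 p.2) + collisionAdjointLocal c M (profile j) p.1 p.2)| ≤
      L * (∑ i, |D i j|) + L * (g + (1 + |cM|)) * |ζ j| := by
    intro j
    obtain ⟨h1, h2, h3⟩ := hL j p.2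
    refine (abs_add_le _ _).trans (add_le_add ?_ ?_)
    · rw [abs_mul]
      refine mul_le_mul h1 ?_ (abs_nonneg _) hL0
      rw [map_one_vbar]
      refine (Finset.abs_sum_le_sum_abs _ _).trans (Finset.sum_le_sum fun i _ => ?_)
      rw [smul_eq_mul, abs_mul, fderiv_coord hZ]
      exact mul_le_of_le_one_left (abs_nonneg _) (abs_vbar_le hv i)
    · rw [abs_mul, mul_comm]
      refine mul_le_mul_of_nonneg_right ?_ (abs_nonneg _)
      refine (abs_add_le _ _).trans ?_
      have h4 := abs_collisionAdjointLocal_le hS hm hL j p.1 hv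
      have h5 : |fderiv ℝ (profile j) p.2 (G p.1 p.2)| ≤ L * g :=
        (ContinuousLinearMap.le_opNorm _ _).trans (mul_le_mul_of_nonneg_right h2 hg0)
      calc _ ≤ L * g + L * (1 + |cM|) := add_le_add h5 h4
        _ = _ := by ring
  set P := ∑ i, ∑ j, |D i j| with hP
  set R := ∑ j, |ζ j| with hR
  have hP0 : 0 ≤ P := Finset.sum_nonneg fun i _ => Finset.sum_nonneg fun j _ => abs_nonneg _
  have hR0 : 0 ≤ R := Finset.sum_nonneg fun j _ => abs_nonneg _
  set m := 1 + |cM| with hmdef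
  have hm1 : 1 ≤ m := by rw [hmdef]; linarith [abs_nonneg cM]
  have habs : |microAdjoint c G M Z t p| ≤ L * P + L * (g + m) * R := by
    refine (Finset.abs_sum_le_sum_abs _ _).trans
      ((Finset.sum_le_sum fun j _ => hterm j).trans (le_of_eq ?_))
    rw [Finset.sum_add_distrib, ← Finset.mul_sum, ← Finset.mul_sum, Finset.sum_comm]
  have hP2 : P ^ 2 ≤ (d + 1) ^ 2 * ∑ i, ‖D i‖ ^ 2 := by
    have h := sq_sum_le_card_mul_sum_sq (s := Finset.univ) (f := fun i => ∑ j, |D i j|)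
    simp only [Finset.card_univ, Fintype.card_fin, Nat.cast_add, Nat.cast_one] at h
    refine h.trans ?_
    calc ((d : ℝ) + 1) * ∑ i, (∑ j, |D i j|) ^ 2 ≤ (d + 1) * ∑ i, (d + 1) * ‖D i‖ ^ 2 := by
          gcongr with i
          exact sum_abs_sq_le _
      _ = _ := by rw [← Finset.mul_sum]; ring
  have hR2 : R ^ 2 ≤ (d + 1) * ‖ζ‖ ^ 2 := sum_abs_sq_le ζ
  have hd1 : (1 : ℝ) ≤ d + 1 := by linarith [(Nat.cast_nonneg d : (0 : ℝ) ≤ d)]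
  have hS0 : 0 ≤ ∑ i, ‖D i‖ ^ 2 := Finset.sum_nonneg fun i _ => sq_nonneg _
  have hgm : (g + m) ^ 2 ≤ 2 * m ^ 2 * (g ^ 2 + 1) := by
    have h1 : (g + m) ^ 2 ≤ 2 * g ^ 2 + 2 * m ^ 2 := by nlinarith [sq_nonneg (g - m)]
    have h2 : 1 ≤ m ^ 2 := one_le_pow₀ hm1
    nlinarith [sq_nonneg g]
  have hm2 : 1 ≤ m ^ 2 := one_le_pow₀ hm1
  calc microAdjoint c G M Z t p ^ 2 = |microAdjoint c G M Z t p| ^ 2 := (sq_abs _).symm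
    _ ≤ (L * P + L * (g + m) * R) ^ 2 := by gcongr
    _ ≤ 2 * L ^ 2 * P ^ 2 + 2 * L ^ 2 * ((g + m) ^ 2 * R ^ 2) := by
        nlinarith [sq_nonneg (L * P - L * (g + m) * R)]
    _ ≤ 2 * L ^ 2 * ((d + 1) ^ 2 * ∑ i, ‖D i‖ ^ 2) +
        2 * L ^ 2 * ((2 * m ^ 2 * (g ^ 2 + 1)) * ((d + 1) * ‖ζ‖ ^ 2)) := by gcongr
    -- Factors at least one are inserted so that both terms carry the same constant.
    _ ≤ 2 * L ^ 2 * ((d + 1) ^ 2 * ∑ i, ‖D i‖ ^ 2) * (2 * m ^ 2) +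
        2 * L ^ 2 * ((2 * m ^ 2 * (g ^ 2 + 1)) * ((d + 1) * ‖ζ‖ ^ 2)) * (d + 1) := by
        refine add_le_add (le_mul_of_one_le_right (by positivity) (by linarith))
          (le_mul_of_one_le_right (by positivity) hd1)
    _ = _ := by ring

end MicroPart

end

end Kinetic


namespace Kinetic

noncomputable section

/-! ### The divergence estimate for regular fields -/

section DivergenceEstimate

variable {d : ℕ} {c : Collision} {G : E d → E d → E d} {M fSt : E d → E d → ℝ} {cInf cM : ℝ}
  {Z Φ : ℝ × E d → E1 d}

theorem memLp_vectorAdjoint (hS : StationaryState c G M fSt cInf cM) (hm : Model c G M)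
    (hZ : ContDiff ℝ 1 Z) (hZc : HasCompactSupport Z) (t : ℝ) :
    MemLp (vectorAdjoint c G M Z t) 2 (phaseMeasure fSt) :=
  memLp_finsetSum _ fun j _ => memLp_spacetimeAdjoint hS hm (contDiff_two_profile j)
    (hasCompactSupport_profile j) (contDiff_coord hZ j) (hasCompactSupport_coord hZc j) t

theorem vectorAdjoint_eq_sum (Z : ℝ × E d → E1 d) (t : ℝ) : vectorAdjoint c G M Z t =
    ∑ j, spacetimeAdjoint c G M (profile j) (fun q => Z q j) t := by
  funext p
  simp [vectorAdjoint]

theorem ofMultiplier_vectorAdjoint (hS : StationaryState c G M fSt cInf cM) (hm : Model c G M)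
    (hZ : ContDiff ℝ 1 Z) (hZc : HasCompactSupport Z) (t : ℝ) :
    hS.ofMultiplier (vectorAdjoint c G M Z t) =
      ∑ j, hS.ofMultiplier (spacetimeAdjoint c G M (profile j) (fun q => Z q j) t) := by
  rw [vectorAdjoint_eq_sum]
  exact hS.ofMultiplier_sum _ fun j => memLp_spacetimeAdjoint hS hm (contDiff_two_profile j)
    (hasCompactSupport_profile j) (contDiff_coord hZ j) (hasCompactSupport_coord hZc j) t

theorem continuous_ofMultiplier_vectorAdjoint (hS : StationaryState c G M fSt cInf cM)
    (hm : Model c G M) (hZ : ContDiff ℝ 1 Z) (hZc : HasCompactSupport Z) :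
    Continuous fun t => hS.ofMultiplier (vectorAdjoint c G M Z t) := by
  simp only [fun t => ofMultiplier_vectorAdjoint hS hm hZ hZc t]
  exact continuous_finsetSum _ fun j _ => continuous_ofMultiplier_spacetimeAdjoint hS hm
    (contDiff_two_profile j) (hasCompactSupport_profile j) (contDiff_coord hZ j)
    (hasCompactSupport_coord hZc j)

theorem IsPath.integral_inner_vectorAdjoint {f : ℝ → WL2 fSt} (hf : IsPath c G M fSt f)
    (hS : StationaryState c G M fSt cInf cM) (hm : Model c G M) (hZ : ContDiff ℝ 1 Z)
    (hZc : HasCompactSupport Z) {α β : ℝ} (hα : 0 ≤ α) (hαβ : α ≤ β)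
    (h0 : ∀ x, Z (α, x) = 0) (h1 : ∀ x, Z (β, x) = 0) :
    ∫ t in α..β, inner ℝ (f t) (hS.ofMultiplier (vectorAdjoint c G M Z t)) = 0 := by
  simp only [fun t => ofMultiplier_vectorAdjoint hS hm hZ hZc t, inner_sum]
  rw [intervalIntegral.integral_finsetSum fun j _ => (hf.continuous.inner (𝕜 := ℝ)
    (continuous_ofMultiplier_spacetimeAdjoint hS hm (contDiff_two_profile j)
      (hasCompactSupport_profile j) (contDiff_coord hZ j)
      (hasCompactSupport_coord hZc j))).intervalIntegrable _ _]
  refine Finset.sum_eq_zero fun j _ => ?_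
  exact hf.integral_inner_spacetimeAdjoint hS hm (contDiff_two_profile j)
    (hasCompactSupport_profile j) (contDiff_coord hZ j) (hasCompactSupport_coord hZc j) hα hαβ
    (fun x => by simp [h0]) (fun x => by simp [h1])

/-- For BGK the mean is the adjoint at `v = 0` plus the profile at `0`, so continuity is inherited
from `collisionAdjoint`. -/
theorem continuous_collisionAdjointMean (hS : StationaryState c G M fSt cInf cM)
    (hm : Model c G M) (j : Fin (d + 1)) :
    Continuous (collisionAdjointMean c M (profile (d := d) j)) := by
  have h : Continuous fun x => collisionAdjoint c M (profile (d := d) j) x 0 :=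
    (continuous_collisionAdjoint hS hm (contDiff_two_profile j)
      (hasCompactSupport_profile j)).comp (by fun_prop : Continuous fun x : E d => (x, (0 : E d)))
  cases c with
  | FP => exact continuous_const
  | BGK =>
    have h' : Continuous fun x : E d => collisionAdjoint Collision.BGK M (profile j) x 0 +
        profile (d := d) j 0 :=
      Continuous.add h continuous_const
    refine h'.congr fun x => ?_
    rw [collisionAdjoint_eq]
    simp [collisionAdjointLocal]

theorem memLp_meanAdjoint (hS : StationaryState c G M fSt cInf cM) (hm : Model c G M)
    (hZ : ContDiff ℝ 1 Z) (hZc : HasCompactSupport Z) (t : ℝ) :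
    MemLp (meanAdjoint c M Z t) 2 (spaceMeasure fSt) := by
  have := hS.isProbabilityMeasure_space
  have hZt : ∀ j, Continuous fun x => Z (t, x) j := fun j =>
    (contDiff_coord hZ j).continuous.comp (by fun_prop : Continuous fun x : E d => (t, x))
  refine memLp_finsetSum Finset.univ fun j _ => ?_
  have hcont := (hZt j).mul (continuous_collisionAdjointMean hS hm j)
  have hc : HasCompactSupport fun x => Z (t, x) j * collisionAdjointMean c M (profile j) x :=
    (hasCompactSupport_slice_right (F := fun t x => Z (t, x) j)
      (hasCompactSupport_coord hZc j) t).mul_right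
  obtain ⟨C, hC⟩ := hcont.bounded_above_of_compact_support hc
  exact MemLp.of_bound hcont.aestronglyMeasurable C (.of_forall hC)

theorem memLp_microAdjoint (hS : StationaryState c G M fSt cInf cM) (hm : Model c G M)
    (hZ : ContDiff ℝ 1 Z) (hZc : HasCompactSupport Z) (t : ℝ) :
    MemLp (microAdjoint c G M Z t) 2 (phaseMeasure fSt) := by
  have h := (memLp_vectorAdjoint hS hm hZ hZc t).sub
    (hS.memLp_comp_fst (memLp_meanAdjoint hS hm hZ hZc t))
  rw [vectorAdjoint_eq] at h
  simpa using h

/-- Local equilibria do not see the function of time and space that separates `vectorAdjoint`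
from `microAdjoint`. -/
theorem inner_micro_vectorAdjoint (hS : StationaryState c G M fSt cInf cM) (hm : Model c G M)
    (hZ : ContDiff ℝ 1 Z) (hZc : HasCompactSupport Z) (t : ℝ) (f : WL2 fSt) :
    inner ℝ (hS.micro f) (hS.ofMultiplier (vectorAdjoint c G M Z t)) =
      inner ℝ (hS.micro f) (hS.ofMultiplier (microAdjoint c G M Z t)) := by
  have hk := memLp_meanAdjoint hS hm hZ hZc t
  rw [vectorAdjoint_eq, hS.ofMultiplier_add (memLp_microAdjoint hS hm hZ hZc t)
    (hS.memLp_comp_fst hk), inner_add_right, ← hS.embed_toLp hk, hS.inner_micro_embed, add_zero]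

theorem inner_embed_ofMultiplier (hS : StationaryState c G M fSt cInf cM) (u : SL2 fSt)
    {m : E d × E d → ℝ} (hmm : MemLp m 2 (phaseMeasure fSt)) :
    inner ℝ (hS.embed u) (hS.ofMultiplier m) = ∫ x, u x * ∫ v, fSt x v * m (x, v) := by
  have h := hS.integrable_mul (hS.embed u) hmm
  have e : ∀ᵐ p : E d × E d, hS.embed u p * m p = u p.1 * (fSt p.1 p.2 * m p) := by
    filter_upwards [hS.embed_ae u] with p hp
    rw [hp]
    ring
  rw [hS.inner_ofMultiplier _ hmm, integral_congr_ae e]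
  have h2 := h.congr e
  rw [Measure.volume_eq_prod] at h2 ⊢
  rw [integral_prod _ h2]
  refine integral_congr_ae (.of_forall fun x => ?_)
  exact integral_const_mul (u x) _

/-- The weighted square of a field and of its derivatives. -/
def fieldEnergy (G : E d → E d → E d) (fSt : E d → E d → ℝ) (Φ : ℝ × E d → E1 d)
    (p : ℝ × E d) : ℝ :=
  ((∑ i, ‖fderiv ℝ Φ p (direction i)‖ ^ 2) + ‖Φ p‖ ^ 2 * weight G fSt p.2) / density fSt p.2

theorem continuous_fieldEnergy (hS : StationaryState c G M fSt cInf cM) (hm : Model c G M)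
    (hΦ : ContDiff ℝ 1 Φ) : Continuous (fieldEnergy G fSt Φ) := by
  have h1 := hΦ.continuous_fderiv one_ne_zero
  have h2 := continuous_weight hS hm
  have h3 := hS.density_regular.continuous
  have h4 := hΦ.continuous
  refine Continuous.div (Continuous.add ?_ (by fun_prop)) (by fun_prop)
    fun p => (hS.density_pos p.2).ne'
  exact continuous_finsetSum _ fun i _ => (h1.clm_apply continuous_const).norm.pow 2

theorem hasCompactSupport_fieldEnergy (hΦc : HasCompactSupport Φ) :
    HasCompactSupport (fieldEnergy G fSt Φ) := by
  refine HasCompactSupport.intro hΦc.isCompact fun p hp => ?_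
  simp [fieldEnergy, fderiv_eq_zero_of_notMem_tsupport hp, image_eq_zero_of_notMem_tsupport hp]

theorem integrable_fieldEnergy (hS : StationaryState c G M fSt cInf cM) (hm : Model c G M)
    (hΦ : ContDiff ℝ 1 Φ) (hΦc : HasCompactSupport Φ) :
    Integrable (fieldEnergy G fSt Φ) :=
  (continuous_fieldEnergy hS hm hΦ).integrable_of_hasCompactSupport
    (hasCompactSupport_fieldEnergy hΦc)

theorem integrable_fieldEnergy_slice (hS : StationaryState c G M fSt cInf cM) (hm : Model c G M)
    (hΦ : ContDiff ℝ 1 Φ) (hΦc : HasCompactSupport Φ) (t : ℝ) :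
    Integrable fun x => fieldEnergy G fSt Φ (t, x) :=
  ((continuous_fieldEnergy hS hm hΦ).comp
    (by fun_prop : Continuous fun x : E d => (t, x))).integrable_of_hasCompactSupport
    (hasCompactSupport_slice_right (F := fun t x => fieldEnergy G fSt Φ (t, x))
      (hasCompactSupport_fieldEnergy hΦc) t)

/-- Integrating the pointwise bound against `fSt` produces `⟨fSt⟩ + ∫ fSt |G|² dv` over `|v| ≤ 1`,
which is at most `⟨fSt⟩ w` by the form of the weight. -/
theorem integral_mul_sq_le (hS : StationaryState c G M fSt cInf cM) (hm : Model c G M)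
    {C D z : ℝ} (hC0 : 0 ≤ C) (hD0 : 0 ≤ D) (hz0 : 0 ≤ z) (x : E d) {m : E d → ℝ}
    (hm0 : ∀ v, ¬ ‖v‖ ≤ 1 → m v = 0)
    (hm1 : ∀ v, ‖v‖ ≤ 1 → m v ^ 2 ≤ C * (D + z * (‖G x v‖ ^ 2 + 1))) :
    ∫ v, fSt x v * m v ^ 2 ≤ C * (density fSt x * (D + z * weight G fSt x)) := by
  have hρ := hS.density_pos x
  set B := Metric.closedBall (0 : E d) 1 with hB
  have hGf : Continuous fun v => fSt x v * ‖G x v‖ ^ 2 :=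
    (hS.continuous_slice x).mul
      ((contDiff_slice_right hm.contDiff_force x).continuous.norm.pow 2)
  have iG : IntegrableOn (fun v => fSt x v * ‖G x v‖ ^ 2) B :=
    hGf.continuousOn.integrableOn_compact (isCompact_closedBall _ _)
  have iD : Integrable fun v => (C * (D + z)) * fSt x v + B.indicator
      (fun v => (C * z) * (fSt x v * ‖G x v‖ ^ 2)) v :=
    ((hS.integrable_velocity x).const_mul _).add
      ((integrable_indicator_iff measurableSet_closedBall).2 (iG.const_mul _))
  have hw := (weight_ge (G := G) hS x).1
  rw [← hB] at hw
  have hwρ : density fSt x + ∫ v in B, fSt x v * ‖G x v‖ ^ 2 ≤ density fSt x * weight G fSt x := by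
    have := mul_le_mul_of_nonneg_left hw hρ.le
    rwa [mul_add, mul_one, mul_div_cancel₀ _ hρ.ne'] at this
  calc ∫ v, fSt x v * m v ^ 2
      ≤ ∫ v, ((C * (D + z)) * fSt x v + B.indicator
          (fun v => (C * z) * (fSt x v * ‖G x v‖ ^ 2)) v) := by
        refine integral_mono_of_nonneg (.of_forall fun v => mul_nonneg (hS.pos x v).le
          (sq_nonneg _)) iD (.of_forall fun v => ?_)
        have hf := (hS.pos x v).le
        by_cases hv : ‖v‖ ≤ 1
        · simp only
          rw [Set.indicator_of_mem (by simpa [hB] using hv)]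
          exact (mul_le_mul_of_nonneg_left (hm1 v hv) hf).trans (le_of_eq (by ring))
        · simp only
          rw [Set.indicator_of_notMem (by simpa [hB] using hv), hm0 v hv]
          have : 0 ≤ C * (D + z) * fSt x v := by positivity
          simpa using this
    _ = C * (D + z) * density fSt x + C * z * ∫ v in B, fSt x v * ‖G x v‖ ^ 2 := by
        rw [integral_add ((hS.integrable_velocity x).const_mul _)
          ((integrable_indicator_iff measurableSet_closedBall).2 (iG.const_mul _)),
          integral_const_mul, integral_indicator measurableSet_closedBall, integral_const_mul]
        rfl
    _ = C * (density fSt x * D + z * (density fSt x + ∫ v in B, fSt x v * ‖G x v‖ ^ 2)) := by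
        ring
    _ ≤ C * (density fSt x * D + z * (density fSt x * weight G fSt x)) := by gcongr
    _ = _ := by ring

/-- The estimate of the spatial density by the distance to local equilibria, tested against the
divergence of a regular field. -/
theorem exists_divergence_estimate (d : ℕ) {cInf : ℝ} (hcInf : 0 < cInf) (cM : ℝ) :
    ∃ K : ℝ, 0 < K ∧ ∀ (c : Collision) (G : E d → E d → E d) (M fSt : E d → E d → ℝ)
      (hS : StationaryState c G M fSt cInf cM), Model c G M → ∀ f : ℝ → WL2 fSt,
      IsPath c G M fSt f → ∀ Φ : ℝ × E d → E1 d, ContDiff ℝ 1 Φ → HasCompactSupport Φ →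
      ∀ α β : ℝ, 0 ≤ α → α ≤ β → (∀ x, Φ (α, x) = 0) → (∀ x, Φ (β, x) = 0) →
      ∀ ε : ℝ, 0 < ε →
      ∫ t in α..β, ∫ x, hS.localDensity (f t) x * ∑ i, (fderiv ℝ Φ (t, x) (direction i)) i ≤
        ε * (∫ t in α..β, ‖hS.micro (f t)‖ ^ 2) +
          ε⁻¹ * K * ∫ t in α..β, ∫ x, fieldEnergy G fSt Φ (t, x) := by
  obtain ⟨c0, h0, hc0⟩ := exists_profile_coercive d
  obtain ⟨L, hL1, hL⟩ := exists_profile_bound d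
  set κ := ((cInf * c0) ^ 2)⁻¹ with hκ
  have hκ0 : 0 < κ := by positivity
  set C1 := 4 * L ^ 2 * (d + 1) ^ 2 * (1 + |cM|) ^ 2 with hC1
  have hC10 : 0 < C1 := by
    have := abs_nonneg cM
    positivity
  -- `C1` is the constant of `microAdjoint_sq_le`; the bracket collects the bounds of
  -- `invertMoments_bounds`, its first summand for the `d + 1` derivatives of `Z` and its second for
  -- `Z` itself.
  set K := C1 * (κ * (2 + 16 * κ) * (d + 1) + κ) with hK
  refine ⟨K, by positivity, ?_⟩
  intro c G M fSt hS hm f hf Φ hΦ hΦc α β hα hαβ hΦ0 hΦ1 ε hε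
  set Z := invertMoments fSt Φ with hZdef
  have hZ : ContDiff ℝ 1 Z := contDiff_invertMoments hS h0 hc0 hcInf hΦ
  have hZc : HasCompactSupport Z := hasCompactSupport_invertMoments hΦc
  have hZ0 : ∀ x, Z (α, x) = 0 := fun x => by simp [hZdef, invertMoments, hΦ0]
  have hZ1 : ∀ x, Z (β, x) = 0 := fun x => by simp [hZdef, invertMoments, hΦ1]
  -- As `B Z = Φ`, the divergence seen by local equilibria is that of the prescribed field.
  have hdiv : ∀ t x, ∫ v, fSt x v * vectorAdjoint c G M Z t (x, v) =
      ∑ i, (fderiv ℝ Φ (t, x) (direction i)) i := by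
    intro t x
    rw [integral_mul_vectorAdjoint hS hm hZ]
    refine Finset.sum_congr rfl fun i _ => ?_
    rw [fderiv_momentOperator_invertMoments hS h0 hc0 hcInf hΦ (t, x) (direction i)]
  have hmicro : ∀ t, ‖hS.ofMultiplier (microAdjoint c G M Z t)‖ ^ 2 ≤
      K * ∫ x, fieldEnergy G fSt Φ (t, x) := by
    intro t
    have hmem := memLp_microAdjoint hS hm hZ hZc t
    have hint := (hS.memLp_phase.1 hmem).2
    rw [hS.norm_ofMultiplier_sq hmem]
    rw [Measure.volume_eq_prod] at hint ⊢
    rw [integral_prod _ hint, ← integral_const_mul]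
    refine integral_mono hint.integral_prod_left
      ((integrable_fieldEnergy_slice hS hm hΦ hΦc t).const_mul _) fun x => ?_
    refine (integral_mul_sq_le hS hm hC10.le
      (D := ∑ i, ‖fderiv ℝ Z (t, x) (direction i)‖ ^ 2) (z := ‖Z (t, x)‖ ^ 2)
      (Finset.sum_nonneg fun i _ => sq_nonneg _) (sq_nonneg _) x
      (fun v hv => microAdjoint_eq_zero t (p := (x, v)) hv)
      (fun v hv => microAdjoint_sq_le hS hm hL1 hL hZ t (p := (x, v)) hv)).trans ?_
    obtain ⟨b1, b2⟩ := invertMoments_bounds hS h0 hc0 hcInf hΦ (t, x)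
    simp only [← hκ, ← hZdef] at b1 b2
    set ρ := density fSt x with hρ
    have hρ0 : 0 < ρ := hS.density_pos x
    set w := weight G fSt x with hw
    have hw1 : 1 ≤ w := (weight_ge hS x).2.2
    set D := ∑ i, ‖fderiv ℝ Φ (t, x) (direction i)‖ ^ 2 with hD
    set q := ‖Φ (t, x)‖ ^ 2 with hq
    have hq0 : 0 ≤ q := sq_nonneg _
    have hD0 : 0 ≤ D := Finset.sum_nonneg fun i _ => sq_nonneg _
    have s1 : ∑ i, ‖fderiv ℝ Z (t, x) (direction i)‖ ^ 2 ≤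
        κ * (2 + 16 * κ) * ((D + (d + 1) * (q * w)) / ρ ^ 2) := by
      refine (Finset.sum_le_sum fun i _ => b2 i).trans (le_of_eq ?_)
      rw [← Finset.mul_sum, ← Finset.sum_div, Finset.sum_add_distrib]
      simp [hD]
    have hd1 : (1 : ℝ) ≤ d + 1 := by linarith [(Nat.cast_nonneg d : (0 : ℝ) ≤ d)]
    calc C1 * (ρ * ((∑ i, ‖fderiv ℝ Z (t, x) (direction i)‖ ^ 2) + ‖Z (t, x)‖ ^ 2 * w))
        ≤ C1 * (ρ * (κ * (2 + 16 * κ) * ((D + (d + 1) * (q * w)) / ρ ^ 2) +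
            κ * (q / ρ ^ 2) * w)) := by gcongr
      _ ≤ C1 * (ρ * (κ * (2 + 16 * κ) * (((d + 1) * D + (d + 1) * (q * w)) / ρ ^ 2) +
            κ * ((D + q * w) / ρ ^ 2))) := by
          have s2 : D ≤ (d + 1) * D := le_mul_of_one_le_left hD0 hd1
          have s3 : κ * (q / ρ ^ 2) * w ≤ κ * ((D + q * w) / ρ ^ 2) := by
            rw [mul_assoc, div_mul_eq_mul_div]
            gcongr
            linarith
          exact mul_le_mul_of_nonneg_left (mul_le_mul_of_nonneg_left (add_le_add
            (by gcongr) s3) hρ0.le) hC10.le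
      _ = K * fieldEnergy G fSt Φ (t, x) := by
          simp only [fieldEnergy, ← hD, ← hq, ← hρ, ← hw, hK]
          field_simp
  -- The pairing with `f` integrates to zero over the window because `Z` vanishes at both ends. The
  -- local equilibrium part is therefore minus the microscopic part, which Young's inequality
  -- bounds.
  have hsplit : ∀ t, inner ℝ (f t) (hS.ofMultiplier (vectorAdjoint c G M Z t)) =
      inner ℝ (hS.micro (f t)) (hS.ofMultiplier (microAdjoint c G M Z t)) +
      inner ℝ (hS.embed (hS.localDensity (f t)))
        (hS.ofMultiplier (vectorAdjoint c G M Z t)) := by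
    intro t
    rw [← inner_micro_vectorAdjoint hS hm hZ hZc, ← inner_add_left]
    congr 1
    simp [StationaryState.micro]
  have hu : ∀ t, inner ℝ (hS.embed (hS.localDensity (f t)))
        (hS.ofMultiplier (vectorAdjoint c G M Z t)) =
      ∫ x, hS.localDensity (f t) x * ∑ i, (fderiv ℝ Φ (t, x) (direction i)) i := by
    intro t
    rw [inner_embed_ofMultiplier hS _ (memLp_vectorAdjoint hS hm hZ hZc t)]
    simp only [hdiv]
  have hpt : ∀ t, inner ℝ (hS.embed (hS.localDensity (f t)))
        (hS.ofMultiplier (vectorAdjoint c G M Z t)) ≤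
      inner ℝ (f t) (hS.ofMultiplier (vectorAdjoint c G M Z t)) +
        (ε * ‖hS.micro (f t)‖ ^ 2 + ε⁻¹ * K * ∫ x, fieldEnergy G fSt Φ (t, x)) := by
    intro t
    have h1 := abs_real_inner_le_norm (hS.micro (f t))
      (hS.ofMultiplier (microAdjoint c G M Z t))
    have h2 := hmicro t
    have h3 := hsplit t
    set a := ‖hS.micro (f t)‖
    set b := ‖hS.ofMultiplier (microAdjoint c G M Z t)‖
    have h4 : a * b ≤ ε * a ^ 2 + ε⁻¹ * b ^ 2 := by
      have e1 : ε * a ^ 2 + ε⁻¹ * b ^ 2 - a * b = ε * (a - ε⁻¹ * b) ^ 2 + a * b := by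
        field_simp
        ring
      have ha : 0 ≤ a := norm_nonneg _
      have hb : 0 ≤ b := norm_nonneg _
      nlinarith [mul_nonneg hε.le (sq_nonneg (a - ε⁻¹ * b)), mul_nonneg ha hb]
    have h5 : ε⁻¹ * b ^ 2 ≤ ε⁻¹ * K * ∫ x, fieldEnergy G fSt Φ (t, x) := by
      rw [mul_assoc]
      exact mul_le_mul_of_nonneg_left h2 (inv_nonneg.2 hε.le)
    have h6 := (abs_le.1 h1).1
    linarith
  have c1 : Continuous fun t => inner ℝ (hS.embed (hS.localDensity (f t)))
        (hS.ofMultiplier (vectorAdjoint c G M Z t)) :=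
    (hS.embed.continuous.comp (hS.localDensity.continuous.comp hf.continuous)).inner (𝕜 := ℝ)
      (continuous_ofMultiplier_vectorAdjoint hS hm hZ hZc)
  have c2 : Continuous fun t => inner ℝ (f t) (hS.ofMultiplier (vectorAdjoint c G M Z t)) :=
    hf.continuous.inner (𝕜 := ℝ) (continuous_ofMultiplier_vectorAdjoint hS hm hZ hZc)
  have c3 : Continuous fun t => ‖hS.micro (f t)‖ ^ 2 :=
    (hS.continuous_micro.comp hf.continuous).norm.pow 2
  have i4 : IntervalIntegrable (fun t => ∫ x, fieldEnergy G fSt Φ (t, x)) volume α β := by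
    have h := integrable_fieldEnergy hS hm hΦ hΦc
    rw [Measure.volume_eq_prod] at h
    exact h.integral_prod_left.intervalIntegrable
  have i3 := c3.intervalIntegrable (μ := volume) α β
  simp only [← hu]
  refine (intervalIntegral.integral_mono_on hαβ (c1.intervalIntegrable _ _)
    ((c2.intervalIntegrable _ _).add ((i3.const_mul ε).add (i4.const_mul (ε⁻¹ * K))))
    fun t _ => hpt t).trans (le_of_eq ?_)
  rw [intervalIntegral.integral_add (c2.intervalIntegrable _ _)
    ((i3.const_mul ε).add (i4.const_mul (ε⁻¹ * K))),
    intervalIntegral.integral_add (i3.const_mul ε) (i4.const_mul (ε⁻¹ * K)),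
    hf.integral_inner_vectorAdjoint hS hm hZ hZc hα hαβ hZ0 hZ1,
    intervalIntegral.integral_const_mul, intervalIntegral.integral_const_mul, zero_add]

end DivergenceEstimate

end

end Kinetic


namespace Kinetic

noncomputable section

/-! ### Weighted squares -/

section WeightedSquare

open Filter Topology ENNReal

variable {α : Type*} [MeasurableSpace α] {μ : Measure α}

theorem enorm_sq_eq_ofReal (x : ℝ) : ‖x‖ₑ ^ 2 = ENNReal.ofReal (x ^ 2) := by
  rw [← sq_abs, ENNReal.ofReal_pow (abs_nonneg x), ← Real.norm_eq_abs, ofReal_norm]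

theorem lintegral_mul_sq_le {f g : α → ℝ≥0∞} (hf : AEMeasurable f μ) (hg : AEMeasurable g μ) :
    (∫⁻ a, f a * g a ∂μ) ^ 2 ≤ (∫⁻ a, f a ^ 2 ∂μ) * ∫⁻ a, g a ^ 2 ∂μ := by
  have h := ENNReal.lintegral_mul_le_Lp_mul_Lq μ Real.HolderConjugate.two_two hf hg
  simp only [Pi.mul_apply, ENNReal.rpow_two] at h
  calc _ ≤ ((∫⁻ a, f a ^ 2 ∂μ) ^ (1 / 2 : ℝ) * (∫⁻ a, g a ^ 2 ∂μ) ^ (1 / 2 : ℝ)) ^ 2 := by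
        gcongr
    _ = _ := by
        rw [mul_pow, ← ENNReal.rpow_two, ← ENNReal.rpow_two, ← ENNReal.rpow_mul,
          ← ENNReal.rpow_mul]
        norm_num

/-- The square of the norm of `f` in `L²(W μ)`. -/
def weightedSq (μ : Measure α) (W f : α → ℝ) : ℝ≥0∞ := ∫⁻ p, ENNReal.ofReal (f p ^ 2 * W p) ∂μ

theorem weightedSq_add_le {W f g : α → ℝ} (hW : ∀ p, 0 ≤ W p) (hWm : Measurable W)
    (hf : Measurable f) :
    weightedSq μ W (f + g) ≤ 2 * weightedSq μ W f + 2 * weightedSq μ W g := by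
  have h2 : (2 : ℝ≥0∞) = ENNReal.ofReal 2 := by simp
  have hm : Measurable fun p => 2 * ENNReal.ofReal (f p ^ 2 * W p) := by fun_prop
  unfold weightedSq
  rw [← lintegral_const_mul' _ _ (by simp), ← lintegral_const_mul' _ _ (by simp),
    ← lintegral_add_left hm]
  refine lintegral_mono fun p => ?_
  have hw := hW p
  rw [h2, ← ENNReal.ofReal_mul zero_le_two, ← ENNReal.ofReal_mul zero_le_two,
    ← ENNReal.ofReal_add (by positivity) (by positivity)]
  refine ENNReal.ofReal_le_ofReal ?_
  simp only [Pi.add_apply]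
  nlinarith [mul_nonneg (sq_nonneg (f p - g p)) hw]

theorem weightedSq_mono {V W f g : α → ℝ}
    (h : ∀ p, f p ^ 2 * V p ≤ g p ^ 2 * W p) : weightedSq μ V f ≤ weightedSq μ W g :=
  lintegral_mono fun p => ENNReal.ofReal_le_ofReal (h p)

theorem tendsto_weightedSq {W f : α → ℝ} {u : ℕ → α → ℝ} {C : ℝ} (hW : ∀ p, 0 ≤ W p)
    (hWm : Measurable W) (hu : ∀ n, Measurable (u n)) (hb : ∀ n p, |u n p| ≤ C * |f p|)
    (hf : weightedSq μ W f ≠ ⊤) (hlim : ∀ p, Tendsto (fun n => u n p) atTop (𝓝 0)) :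
    Tendsto (fun n => weightedSq μ W (u n)) atTop (𝓝 0) := by
  have h := tendsto_lintegral_of_dominated_convergence (μ := μ) (f := fun _ => 0)
    (F := fun n p => ENNReal.ofReal (u n p ^ 2 * W p))
    (fun p => ENNReal.ofReal (C ^ 2) * ENNReal.ofReal (f p ^ 2 * W p))
    (fun n => (((hu n).pow_const 2).mul hWm).ennreal_ofReal)
    (fun n => .of_forall fun p => by
      beta_reduce
      rw [← ENNReal.ofReal_mul (sq_nonneg C), ← mul_assoc, ← mul_pow]
      refine ENNReal.ofReal_le_ofReal (mul_le_mul_of_nonneg_right ?_ (hW p))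
      rw [← sq_abs]
      refine (pow_le_pow_left₀ (abs_nonneg _) (hb n p) 2).trans (le_of_eq ?_)
      rw [mul_pow, mul_pow, sq_abs])
    (by
      rw [lintegral_const_mul' _ _ (by simp)]
      exact ENNReal.mul_ne_top (by simp) hf)
    (.of_forall fun p => by
      have := ((hlim p).pow 2).mul_const (W p)
      simpa using ENNReal.tendsto_ofReal this)
  simpa [weightedSq] using h

/-- Jensen's inequality for the square. -/
theorem ofReal_integral_mul_sq_le {ψ h : α → ℝ} (hψ : ∀ y, 0 ≤ ψ y) (hψm : Measurable ψ)
    (hψi : Integrable ψ μ) (hψ1 : ∫ y, ψ y ∂μ = 1) (hh : Measurable h) :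
    ENNReal.ofReal ((∫ y, ψ y * h y ∂μ) ^ 2) ≤
      ∫⁻ y, ENNReal.ofReal (ψ y) * ENNReal.ofReal (h y ^ 2) ∂μ := by
  rw [← enorm_sq_eq_ofReal]
  calc ‖∫ y, ψ y * h y ∂μ‖ₑ ^ 2 ≤ (∫⁻ y, ‖ψ y * h y‖ₑ ∂μ) ^ 2 := by
        gcongr
        exact enorm_integral_le_lintegral_enorm _
    -- Splitting `ψ = √ψ √ψ` lets Cauchy-Schwarz use that `ψ` has integral one.
    _ = (∫⁻ y, ‖√(ψ y)‖ₑ * ‖√(ψ y) * h y‖ₑ ∂μ) ^ 2 := by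
        congr 2 with y
        rw [← enorm_mul, ← mul_assoc, Real.mul_self_sqrt (hψ y)]
    _ ≤ (∫⁻ y, ‖√(ψ y)‖ₑ ^ 2 ∂μ) * ∫⁻ y, ‖√(ψ y) * h y‖ₑ ^ 2 ∂μ :=
        lintegral_mul_sq_le (by fun_prop) (by fun_prop)
    _ = _ := by
        have e1 : ∀ y, ‖√(ψ y)‖ₑ ^ 2 = ENNReal.ofReal (ψ y) := fun y => by
          rw [enorm_sq_eq_ofReal, Real.sq_sqrt (hψ y)]
        have e2 : ∀ y, ‖√(ψ y) * h y‖ₑ ^ 2 = ENNReal.ofReal (ψ y) * ENNReal.ofReal (h y ^ 2) :=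
          fun y => by rw [enorm_mul, mul_pow, e1, enorm_sq_eq_ofReal]
        simp only [e1, e2]
        rw [← ofReal_integral_eq_lintegral_ofReal hψi (.of_forall hψ), hψ1, ENNReal.ofReal_one,
          one_mul]

theorem memLp_two_iff_weightedSq {f : α → ℝ} (hf : Measurable f) :
    MemLp f 2 μ ↔ weightedSq μ (fun _ => 1) f ≠ ⊤ := by
  rw [memLp_two_iff_integrable_sq hf.aestronglyMeasurable, weightedSq]
  simp only [mul_one]
  have := lintegral_ofReal_ne_top_iff_integrable (μ := μ) (f := fun p => f p ^ 2)
    (hf.pow_const 2).aestronglyMeasurable (.of_forall fun p => sq_nonneg _)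
  exact this.symm

end WeightedSquare

/-! ### Mollification -/

section Mollification

open Filter Topology ENNReal

variable {X : Type*} [NormedAddCommGroup X] [NormedSpace ℝ X] [FiniteDimensional ℝ X]
  [MeasurableSpace X] [BorelSpace X] {μ : Measure X} [μ.IsAddHaarMeasure]

/-- Continuity of translations in `L²`, read off from the continuity of the additive action of the
group on `Lp`. -/
theorem exists_weightedSq_translation_le {f : X → ℝ} (hf : MemLp f 2 μ)
    {ε : ℝ} (hε : 0 < ε) : ∃ δ > 0, ∀ y : X, ‖y‖ < δ →
      weightedSq μ (fun _ => 1) (fun x => f (x - y) - f x) ≤ ENNReal.ofReal ε := by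
  have : Fact ((2 : ℝ≥0∞) ≠ ∞) := ⟨by simp⟩
  have hc : Continuous fun y : X => (DomAddAct.mk (-y)) +ᵥ hf.toLp := by
    have h1 : Continuous fun y : X => (DomAddAct.mk (-y) : Xᵈᵃᵃ) :=
      DomAddAct.continuous_mk.comp continuous_neg
    exact h1.vadd (continuous_const (y := hf.toLp))
  have h0 := hc.tendsto 0
  rw [neg_zero, Metric.tendsto_nhds_nhds] at h0
  obtain ⟨δ, hδ, h⟩ := h0 (√ε) (Real.sqrt_pos.2 hε)
  refine ⟨δ, hδ, fun y hy => ?_⟩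
  have h1 := h (x := y) (by simpa using hy)
  have hfy : MemLp (fun x => f (x - y)) 2 μ := hf.comp_measurePreserving
    (measurePreserving_sub_right μ y)
  have e : (DomAddAct.mk (-y)) +ᵥ hf.toLp = hfy.toLp := by
    rw [DomAddAct.mk_vadd_toLp]
    simp [sub_eq_add_neg, add_comm]
  have e0 : (DomAddAct.mk (0 : X)) +ᵥ hf.toLp = hf.toLp := by
    rw [DomAddAct.mk_vadd_toLp]
    simp
  rw [e, e0, dist_eq_norm, ← MemLp.toLp_sub] at h1
  have h2 : ‖(hfy.sub hf).toLp‖ ^ 2 ≤ ε := by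
    rw [← Real.sq_sqrt hε.le]
    gcongr
  rw [norm_sq_eq_integral] at h2
  have h3 : ∫ x, (f (x - y) - f x) ^ 2 ∂μ ≤ ε := by
    refine le_trans (le_of_eq (integral_congr_ae ?_)) h2
    filter_upwards [(hfy.sub hf).coeFn_toLp] with x hx
    rw [hx]
    rfl
  unfold weightedSq
  simp only [mul_one]
  have hi : Integrable (fun x => (f (x - y) - f x) ^ 2) μ := (hfy.sub hf).integrable_sq
  rw [← ofReal_integral_eq_lintegral_ofReal hi
    (.of_forall fun p => sq_nonneg _)]
  exact ENNReal.ofReal_le_ofReal h3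

/-- Convolution with a normalised bump function. -/
def mollify (μ : Measure X) (b : ContDiffBump (0 : X)) (f : X → ℝ) (x : X) : ℝ :=
  ∫ y, b.normed μ y * f (x - y) ∂μ

variable {b : ContDiffBump (0 : X)} {f : X → ℝ}

theorem mollify_eq : mollify μ b f =
    convolution (b.normed μ) f (ContinuousLinearMap.lsmul ℝ ℝ) μ := by
  funext x
  rfl

theorem contDiff_mollify (hf : LocallyIntegrable f μ) : ContDiff ℝ (⊤ : ℕ∞) (mollify μ b f) := by
  rw [mollify_eq]
  exact (b.hasCompactSupport_normed).contDiff_convolution_left _ b.contDiff_normed hf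

theorem mollify_eq_zero {x : X} (h : ∀ z, ‖z - x‖ ≤ b.rOut → f z = 0) : mollify μ b f x = 0 := by
  refine integral_eq_zero_of_ae (.of_forall fun y => ?_)
  by_cases hy : ‖y‖ ≤ b.rOut
  · simp [h (x - y) (by simpa using hy)]
  · have : b.normed μ y = 0 := by
      rw [← Function.notMem_support, b.support_normed_eq]
      simp only [Metric.mem_ball, dist_zero_right, not_lt]
      exact (not_le.1 hy).le
    simp [this]

/-- The error is an average of `f(x - y) - f(x)` over small `y`; Jensen and Tonelli bound its square
by the largest translation error. -/
theorem weightedSq_mollify_sub_le (hfm : Measurable f) (hf : MemLp f 2 μ) {ε : ℝ≥0∞}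
    (hb : ∀ y : X, ‖y‖ < b.rOut →
      weightedSq μ (fun _ => 1) (fun x => f (x - y) - f x) ≤ ε) :
    weightedSq μ (fun _ => 1) (mollify μ b f - f) ≤ ε := by
  have hψm : Measurable (b.normed μ) := b.continuous_normed.measurable
  have hfl : LocallyIntegrable f μ := hf.locallyIntegrable one_le_two
  have key : ∀ x, ENNReal.ofReal ((mollify μ b f - f) x ^ 2 * 1) ≤
      ∫⁻ y, ENNReal.ofReal (b.normed μ y) * ENNReal.ofReal ((f (x - y) - f x) ^ 2) ∂μ := by
    intro x
    have i1 : Integrable (fun y => b.normed μ y * f (x - y)) μ := by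
      have := (b.hasCompactSupport_normed (μ := μ)).convolutionExists_left
        (ContinuousLinearMap.lsmul ℝ ℝ) b.continuous_normed hfl x
      exact this
    have e : (mollify μ b f - f) x = ∫ y, b.normed μ y * (f (x - y) - f x) ∂μ := by
      simp only [mul_sub]
      rw [integral_sub i1 (b.integrable_normed.mul_const _), integral_mul_const,
        b.integral_normed, one_mul]
      rfl
    rw [mul_one, e]
    exact ofReal_integral_mul_sq_le b.nonneg_normed hψm b.integrable_normed b.integral_normed
      (by fun_prop)
  calc weightedSq μ (fun _ => 1) (mollify μ b f - f)
      ≤ ∫⁻ x, ∫⁻ y, ENNReal.ofReal (b.normed μ y) *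
          ENNReal.ofReal ((f (x - y) - f x) ^ 2) ∂μ ∂μ := lintegral_mono key
    _ = ∫⁻ y, ∫⁻ x, ENNReal.ofReal (b.normed μ y) *
          ENNReal.ofReal ((f (x - y) - f x) ^ 2) ∂μ ∂μ := by
        refine lintegral_lintegral_swap (Measurable.aemeasurable ?_)
        simp only [Function.uncurry_def]
        fun_prop
    _ ≤ ∫⁻ y, ENNReal.ofReal (b.normed μ y) * ε ∂μ := by
        refine lintegral_mono fun y => ?_
        rw [lintegral_const_mul' _ _ (by simp)]
        by_cases hy : ‖y‖ < b.rOut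
        · gcongr
          simpa [weightedSq] using hb y hy
        · have : b.normed μ y = 0 := by
            rw [← Function.notMem_support, b.support_normed_eq]
            simpa using hy
          simp [this]
    _ = ε := by
        rw [lintegral_mul_const _ hψm.ennreal_ofReal,
          ← ofReal_integral_eq_lintegral_ofReal b.integrable_normed
            (.of_forall b.nonneg_normed), b.integral_normed, ENNReal.ofReal_one, one_mul]

/-- `D` is the weak derivative of `f` in the direction `e`. -/
def IsWeakDeriv (μ : Measure X) (f D : X → ℝ) (e : X) : Prop :=
  ∀ φ : X → ℝ, ContDiff ℝ (⊤ : ℕ∞) φ → HasCompactSupport φ →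
    ∫ p, f p * fderiv ℝ φ p e ∂μ = - ∫ p, D p * φ p ∂μ

theorem fderiv_mollify {D : X → ℝ} {e : X} (h : IsWeakDeriv μ f D e)
    (hf : LocallyIntegrable f μ) (x : X) : fderiv ℝ (mollify μ b f) x e = mollify μ b D x := by
  have hb1 : ContDiff ℝ 1 (b.normed μ) := (b.contDiff_normed (n := 1))
  have hb := (b.hasCompactSupport_normed (μ := μ)).hasFDerivAt_convolution_left
    (ContinuousLinearMap.lsmul ℝ ℝ) hb1 hf x
  rw [mollify_eq, hb.fderiv]
  have hex : ConvolutionExistsAt (fderiv ℝ (b.normed μ)) f x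
      ((ContinuousLinearMap.lsmul ℝ ℝ).precompL X) μ :=
    ((b.hasCompactSupport_normed (μ := μ)).fderiv ℝ).convolutionExists_left _
      (hb1.continuous_fderiv one_ne_zero) hf x
  have e1 : (convolution (fderiv ℝ (b.normed μ)) f
      ((ContinuousLinearMap.lsmul ℝ ℝ).precompL X) μ x) e =
      ∫ y, fderiv ℝ (b.normed μ) y e * f (x - y) ∂μ := by
    rw [convolution, ContinuousLinearMap.integral_apply hex]
    rfl
  rw [e1, mollify]
  -- The reflected and translated bump is the test function in the definition of the weak
  -- derivative. The sign from the reflection cancels the one from the integration by parts.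
  set φ : X → ℝ := fun z => b.normed μ (x - z) with hφ
  have hφs : ContDiff ℝ (⊤ : ℕ∞) φ := b.contDiff_normed.comp (contDiff_const.sub contDiff_id)
  have hφc : HasCompactSupport φ :=
    (b.hasCompactSupport_normed (μ := μ)).comp_homeomorph (Homeomorph.subLeft x)
  have hd : ∀ z, fderiv ℝ φ z e = - fderiv ℝ (b.normed μ) (x - z) e := by
    intro z
    have h1 : HasFDerivAt (fun z : X => x - z) (-ContinuousLinearMap.id ℝ X) z :=
      (hasFDerivAt_id z).const_sub x
    have h2 := (hb1.differentiable one_ne_zero (x - z)).hasFDerivAt.comp z h1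
    have h3 : HasFDerivAt φ ((fderiv ℝ (b.normed μ) (x - z)).comp
      (-ContinuousLinearMap.id ℝ X)) z := h2
    rw [h3.fderiv]
    simp
  have h4 := h φ hφs hφc
  have e2 : ∫ y, fderiv ℝ (b.normed μ) y e * f (x - y) ∂μ =
      ∫ z, fderiv ℝ (b.normed μ) (x - z) e * f z ∂μ := by
    rw [← integral_sub_left_eq_self _ μ x]
    simp only [_root_.sub_sub_cancel]
  have e3 : ∫ y, b.normed μ y * D (x - y) ∂μ = ∫ z, b.normed μ (x - z) * D z ∂μ := by
    rw [← integral_sub_left_eq_self _ μ x]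
    simp only [_root_.sub_sub_cancel]
  rw [e2, e3]
  simp only [hd, mul_neg, integral_neg, neg_inj] at h4
  simp only [mul_comm (fderiv ℝ (b.normed μ) _ e), mul_comm (b.normed μ _)]
  exact h4

end Mollification

end

end Kinetic


namespace Kinetic

noncomputable section

/-! ### Density of smooth functions in weighted Sobolev spaces -/

section SmoothApproximation

open Filter Topology ENNReal

variable {X : Type*} [NormedAddCommGroup X] [NormedSpace ℝ X] [FiniteDimensional ℝ X]
  [MeasurableSpace X] [BorelSpace X] {μ : Measure X} [μ.IsAddHaarMeasure]
  {f D W V : X → ℝ}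

/-- A continuous positive weight is bounded below on compact sets, so finiteness of the weighted
square is local square integrability. -/
theorem memLp_restrict_of_weightedSq (hW : Continuous W) (hW0 : ∀ p, 0 < W p) (hf : Measurable f)
    (h : weightedSq μ W f ≠ ⊤) {K : Set X} (hK : IsCompact K) : MemLp f 2 (μ.restrict K) := by
  rw [memLp_two_iff_weightedSq hf]
  obtain ⟨B, hB⟩ := hK.exists_bound_of_continuousOn (hW.inv₀ fun p => (hW0 p).ne').continuousOn
  refine ne_top_of_le_ne_top (ENNReal.mul_ne_top (ENNReal.ofReal_ne_top (r := B)) h) ?_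
  calc weightedSq (μ.restrict K) (fun _ => 1) f
      ≤ ∫⁻ p in K, ENNReal.ofReal B * ENNReal.ofReal (f p ^ 2 * W p) ∂μ := by
        refine setLIntegral_mono' hK.measurableSet fun p hp => ?_
        have h1 := (le_abs_self _).trans (hB p hp)
        have h2 := hW0 p
        have h3 : 1 ≤ B * W p := by
          rwa [Pi.inv_apply, inv_le_iff_one_le_mul₀ h2] at h1
        rw [← ENNReal.ofReal_mul' (mul_nonneg (sq_nonneg _) h2.le)]
        refine ENNReal.ofReal_le_ofReal ?_
        nlinarith [sq_nonneg (f p)]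
    _ ≤ ∫⁻ p, ENNReal.ofReal B * ENNReal.ofReal (f p ^ 2 * W p) ∂μ :=
        setLIntegral_le_lintegral _ _
    _ = _ := by rw [lintegral_const_mul' _ _ (by simp)]; rfl

theorem locallyIntegrable_of_weightedSq (hW : Continuous W) (hW0 : ∀ p, 0 < W p)
    (hf : Measurable f) (h : weightedSq μ W f ≠ ⊤) : LocallyIntegrable f μ := by
  refine (locallyIntegrable_iff).2 fun K hK => ?_
  have : IsFiniteMeasure (μ.restrict K) := ⟨by simpa using hK.measure_lt_top⟩
  exact (memLp_restrict_of_weightedSq hW hW0 hf h hK).integrable one_le_two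

theorem IsWeakDeriv.smooth_mul {e : X} (h : IsWeakDeriv μ f D e) (hf : LocallyIntegrable f μ)
    (hD : LocallyIntegrable D μ) {χ : X → ℝ} (hχ : ContDiff ℝ (⊤ : ℕ∞) χ) :
    IsWeakDeriv μ (fun p => χ p * f p) (fun p => χ p * D p + fderiv ℝ χ p e * f p) e := by
  intro φ hφ hφc
  have h1 := h (fun p => χ p * φ p) (hχ.mul hφ) hφc.mul_left
  have dχ := hχ.differentiable (by simp)
  have dφ := hφ.differentiable (by simp)
  have cχ' : Continuous fun p => fderiv ℝ χ p e :=
    (hχ.continuous_fderiv (by simp)).clm_apply continuous_const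
  have cφ' : Continuous fun p => fderiv ℝ φ p e :=
    (hφ.continuous_fderiv (by simp)).clm_apply continuous_const
  have e1 : ∀ p, fderiv ℝ (fun p => χ p * φ p) p e =
      χ p * fderiv ℝ φ p e + fderiv ℝ χ p e * φ p := by
    intro p
    rw [fderiv_fun_mul (dχ p) (dφ p)]
    simp
    ring
  have loc : ∀ {g u : X → ℝ}, LocallyIntegrable g μ → Continuous u → HasCompactSupport u →
      Integrable (fun p => u p * g p) μ := fun hg hu huc => by
    simpa using hg.integrable_smul_left_of_hasCompactSupport hu huc
  have i1 := loc hf (hχ.continuous.mul cφ') (hφc.fderiv_apply (𝕜 := ℝ) e).mul_left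
  have i2 := loc hf (cχ'.mul hφ.continuous) hφc.mul_left
  have i3 := loc hD (hχ.continuous.mul hφ.continuous) hφc.mul_left
  simp only [Pi.mul_apply] at i1 i2 i3
  have e2 : ∫ p, f p * fderiv ℝ (fun p => χ p * φ p) p e ∂μ =
      (∫ p, χ p * f p * fderiv ℝ φ p e ∂μ) + ∫ p, fderiv ℝ χ p e * φ p * f p ∂μ := by
    have i1' : Integrable (fun p => χ p * f p * fderiv ℝ φ p e) μ :=
      i1.congr (.of_forall fun p => by ring)
    rw [← integral_add i1' i2]
    refine integral_congr_ae (.of_forall fun p => ?_)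
    simp only [e1]
    ring
  have e3 : ∫ p, (χ p * D p + fderiv ℝ χ p e * f p) * φ p ∂μ =
      (∫ p, D p * (χ p * φ p) ∂μ) + ∫ p, fderiv ℝ χ p e * φ p * f p ∂μ := by
    have i3' : Integrable (fun p => D p * (χ p * φ p)) μ :=
      i3.congr (.of_forall fun p => by ring)
    rw [← integral_add i3' i2]
    refine integral_congr_ae (.of_forall fun p => ?_)
    simp only
    ring
  rw [e2] at h1
  rw [e3]
  linarith

/-- Smooth cutoff functions on larger and larger balls. -/
theorem exists_cutoff : ∃ (χ : ℕ → X → ℝ) (A : ℝ), 0 ≤ A ∧ (∀ n, ContDiff ℝ (⊤ : ℕ∞) (χ n)) ∧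
    (∀ n, HasCompactSupport (χ n)) ∧ (∀ n p, |χ n p - 1| ≤ 1) ∧
    (∀ n p e, |fderiv ℝ (χ n) p e| ≤ A * ‖e‖ * ((n : ℝ) + 1)⁻¹) ∧
    ∀ p, Tendsto (fun n => χ n p) atTop (𝓝 1) := by
  let η : ContDiffBump (0 : X) := ⟨1, 2, one_pos, one_lt_two⟩
  have hη : ContDiff ℝ (⊤ : ℕ∞) η := η.contDiff
  obtain ⟨A, hA⟩ := (hη.continuous_fderiv (by simp)).bounded_above_of_compact_support
    (η.hasCompactSupport.fderiv (𝕜 := ℝ))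
  have hA0 := (norm_nonneg _).trans (hA 0)
  have hn : ∀ n : ℕ, 0 < ((n : ℝ) + 1)⁻¹ := fun n => by positivity
  refine ⟨fun n p => η (((n : ℝ) + 1)⁻¹ • p), A, hA0, fun n => hη.comp (contDiff_const_smul _),
    fun n => η.hasCompactSupport.comp_smul (hn n).ne', fun n p => ?_, fun n p e => ?_,
    fun p => ?_⟩
  · have h0 : 0 ≤ η (((n : ℝ) + 1)⁻¹ • p) := η.nonneg
    have h1 : η (((n : ℝ) + 1)⁻¹ • p) ≤ 1 := η.le_one
    rw [abs_le]
    constructor <;> linarith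
  · have h1 : HasFDerivAt (fun p : X => ((n : ℝ) + 1)⁻¹ • p)
        (((n : ℝ) + 1)⁻¹ • ContinuousLinearMap.id ℝ X) p :=
      (hasFDerivAt_id p).const_smul _
    have h2 := (hη.differentiable (by simp) (((n : ℝ) + 1)⁻¹ • p)).hasFDerivAt.comp p h1
    have h3 : HasFDerivAt (fun p => η (((n : ℝ) + 1)⁻¹ • p)) _ p := h2
    rw [h3.fderiv]
    simp only [ContinuousLinearMap.comp_apply, _root_.smul_apply, ContinuousLinearMap.id_apply,
      map_smul, smul_eq_mul, abs_mul, abs_of_pos (hn n)]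
    rw [mul_comm]
    refine mul_le_mul_of_nonneg_right ?_ (hn n).le
    exact ((fderiv ℝ η (((n : ℝ) + 1)⁻¹ • p)).le_opNorm e).trans
      (mul_le_mul_of_nonneg_right (hA _) (norm_nonneg _))
  · refine tendsto_const_nhds.congr' ?_
    obtain ⟨N, hN⟩ := exists_nat_ge ‖p‖
    filter_upwards [eventually_ge_atTop N] with n hnN
    refine (η.one_of_mem_closedBall ?_).symm
    rw [mem_closedBall_zero_iff, norm_smul, Real.norm_of_nonneg (hn n).le]
    show ((n : ℝ) + 1)⁻¹ * ‖p‖ ≤ 1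
    rw [inv_mul_le_iff₀ (by positivity)]
    have : (N : ℝ) ≤ n := by exact_mod_cast hnN
    linarith

variable {ι : Type*} [Finite ι] {e : ι → X} {D : ι → X → ℝ}

/-- Truncation converges by dominated convergence. The commutator `∇χ f` has bounded coefficients
that tend to zero, and `V ≤ W` makes `f` square integrable for the weight of the derivatives. -/
theorem exists_cutoff_approx (hW : Continuous W) (hV : Continuous V) (hV0 : ∀ p, 0 ≤ V p)
    (hVW : ∀ p, V p ≤ W p) (hf : Measurable f) (hD : ∀ i, Measurable (D i))
    (hfW : weightedSq μ W f ≠ ⊤) (hDV : ∀ i, weightedSq μ V (D i) ≠ ⊤) {ε : ℝ≥0∞} (hε : 0 < ε) :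
    ∃ χ : X → ℝ, ContDiff ℝ (⊤ : ℕ∞) χ ∧ HasCompactSupport χ ∧
      weightedSq μ W (fun p => χ p * f p - f p) ≤ ε ∧
      ∀ i, weightedSq μ V
        (fun p => (χ p * D i p + fderiv ℝ χ p (e i) * f p) - D i p) ≤ ε := by
  obtain ⟨χ, A, hA0, hχ, hχc, hχ1, hχd, hχl⟩ := exists_cutoff (X := X)
  have hW0 : ∀ p, 0 ≤ W p := fun p => (hV0 p).trans (hVW p)
  have hχm : ∀ n, Measurable (χ n) := fun n => (hχ n).continuous.measurable
  have hdm : ∀ n v, Measurable fun p => fderiv ℝ (χ n) p v := fun n v =>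
    (((hχ n).continuous_fderiv (by simp)).clm_apply continuous_const).measurable
  have l1 : ∀ {g U : X → ℝ}, Measurable g → Continuous U → (∀ p, 0 ≤ U p) →
      weightedSq μ U g ≠ ⊤ →
      Tendsto (fun n => weightedSq μ U fun p => (χ n p - 1) * g p) atTop (𝓝 0) := by
    intro g U hg hU hU0 hgU
    refine tendsto_weightedSq (C := 1) hU0 hU.measurable
      (fun n => ((hχm n).sub_const 1).mul hg) (fun n p => ?_) hgU fun p => ?_
    · rw [abs_mul]
      exact mul_le_mul_of_nonneg_right (hχ1 n p) (abs_nonneg _)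
    · simpa using ((hχl p).sub_const 1).mul_const (g p)
  have hfV : weightedSq μ V f ≠ ⊤ := ne_top_of_le_ne_top hfW
    (weightedSq_mono fun p => mul_le_mul_of_nonneg_left (hVW p) (sq_nonneg _))
  have l2 : ∀ i, Tendsto (fun n => weightedSq μ V fun p => fderiv ℝ (χ n) p (e i) * f p)
      atTop (𝓝 0) := by
    intro i
    refine tendsto_weightedSq (C := A * ‖e i‖) hV0 hV.measurable
      (fun n => (hdm n _).mul hf) (fun n p => ?_) hfV fun p => ?_
    · rw [abs_mul]
      refine mul_le_mul_of_nonneg_right ((hχd n p _).trans ?_) (abs_nonneg _)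
      refine mul_le_of_le_one_right (by positivity) (inv_le_one_of_one_le₀ ?_)
      linarith [(Nat.cast_nonneg n : (0 : ℝ) ≤ n)]
    · have h0 : Tendsto (fun n => fderiv ℝ (χ n) p (e i)) atTop (𝓝 0) := by
        refine squeeze_zero_norm (fun n => hχd n p (e i)) ?_
        have := (tendsto_inv_atTop_zero.comp
          (tendsto_atTop_add_const_right _ (1 : ℝ) tendsto_natCast_atTop_atTop)).const_mul
          (A * ‖e i‖)
        simpa using this
      simpa using h0.mul_const (f p)
  have l3 : ∀ i, ∀ᶠ n in atTop, weightedSq μ V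
      (fun p => (χ n p * D i p + fderiv ℝ (χ n) p (e i) * f p) - D i p) ≤ ε := by
    intro i
    have h := ((ENNReal.Tendsto.const_mul (a := 2) (l1 (hD i) hV hV0 (hDV i))
      (Or.inr (by simp))).add (ENNReal.Tendsto.const_mul (a := 2) (l2 i) (Or.inr (by simp))))
    simp only [mul_zero, add_zero] at h
    filter_upwards [h.eventually_le_const hε] with n hn
    refine le_trans (le_trans (le_of_eq ?_) (weightedSq_add_le hV0 hV.measurable
      (((hχm n).sub_const 1).mul (hD i)) (g := fun p => fderiv ℝ (χ n) p (e i) * f p))) hn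
    congr 1
    funext p
    simp only [Pi.add_apply, Pi.mul_apply]
    ring
  have l4 : ∀ᶠ n in atTop, weightedSq μ W (fun p => χ n p * f p - f p) ≤ ε := by
    filter_upwards [(l1 hf hW hW0 hfW).eventually_le_const hε] with n hn
    refine le_trans (le_of_eq ?_) hn
    congr 1
    funext p
    ring
  obtain ⟨n, h1, h2⟩ := (l4.and (eventually_all.2 l3)).exists
  exact ⟨χ n, hχ n, hχc n, h1, h2⟩

/-- Mollification at scale `r < 1` moves the support by less than one; there the continuous weight
is bounded and the unweighted estimate applies. -/
theorem eventually_weightedSq_mollify_le {f W : X → ℝ} (hW : Continuous W) (hf : Measurable f)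
    (hf2 : MemLp f 2 μ) (hfc : HasCompactSupport f) {ε : ℝ} (hε : 0 < ε) :
    ∀ᶠ r in 𝓝[>] (0 : ℝ), ∀ b : ContDiffBump (0 : X), b.rOut = r →
      weightedSq μ W (mollify μ b f - f) ≤ ENNReal.ofReal ε := by
  obtain ⟨R, hR⟩ := hfc.isCompact.isBounded.subset_closedBall 0
  obtain ⟨B, hB⟩ := (isCompact_closedBall (0 : X) (R + 1)).exists_bound_of_continuousOn
    hW.continuousOn
  have hB1 : 0 < max B 1 := lt_max_of_lt_right one_pos
  obtain ⟨δ, hδ, h⟩ := exists_weightedSq_translation_le hf2 (div_pos hε hB1)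
  filter_upwards [Ioo_mem_nhdsGT (lt_min hδ one_pos)] with r hr b hb
  have hr1 := hr.2.trans_le (min_le_left _ _)
  have hr2 := hr.2.trans_le (min_le_right _ _)
  have h1 := weightedSq_mollify_sub_le (b := b) hf hf2
    (fun y hy => h y (hy.trans_le (hb.trans_le hr1.le)))
  have hf0 : ∀ z, R < ‖z‖ → f z = 0 := fun z hz => by
    by_contra h0
    have := hR (subset_tsupport _ h0)
    rw [mem_closedBall_zero_iff] at this
    linarith
  have h2 : ∀ p, (mollify μ b f - f) p ^ 2 * W p ≤
      max B 1 * ((mollify μ b f - f) p ^ 2 * 1) := by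
    intro p
    by_cases hp : ‖p‖ ≤ R + 1
    · have h3 := (le_abs_self _).trans (hB p (by simpa using hp))
      nlinarith [sq_nonneg ((mollify μ b f - f) p), le_max_left B 1]
    · have h4 : mollify μ b f p = 0 := by
        refine mollify_eq_zero fun z hz => hf0 z ?_
        have h5 := norm_sub_norm_le p z
        rw [norm_sub_rev] at h5
        rw [hb] at hz
        linarith
      have h5 : f p = 0 := hf0 p (by linarith)
      simp [h4, h5]
  calc weightedSq μ W (mollify μ b f - f)
      ≤ ∫⁻ p, ENNReal.ofReal (max B 1) *
          ENNReal.ofReal ((mollify μ b f - f) p ^ 2 * 1) ∂μ := by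
        refine lintegral_mono fun p => ?_
        rw [← ENNReal.ofReal_mul hB1.le]
        exact ENNReal.ofReal_le_ofReal (h2 p)
    _ = ENNReal.ofReal (max B 1) * weightedSq μ (fun _ => 1) (mollify μ b f - f) := by
        rw [lintegral_const_mul' _ _ (by simp)]
        rfl
    _ ≤ ENNReal.ofReal (max B 1) * ENNReal.ofReal (ε / max B 1) := by gcongr
    _ = ENNReal.ofReal ε := by
        rw [← ENNReal.ofReal_mul hB1.le, mul_div_cancel₀ _ hB1.ne']

/-- Density of smooth compactly supported functions in weighted Sobolev spaces. -/
theorem exists_smooth_approx (hW : Continuous W) (hV : Continuous V) (hV0 : ∀ p, 0 < V p)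
    (hVW : ∀ p, V p ≤ W p) (hf : Measurable f) (hD : ∀ i, Measurable (D i))
    (hfW : weightedSq μ W f ≠ ⊤) (hDV : ∀ i, weightedSq μ V (D i) ≠ ⊤)
    (hder : ∀ i, IsWeakDeriv μ f (D i) (e i)) {S : Set X} (hfS : ∀ p, p ∉ S → f p = 0)
    {ε δ : ℝ} (hε : 0 < ε) (hδ : 0 < δ) :
    ∃ Φ : X → ℝ, ContDiff ℝ (⊤ : ℕ∞) Φ ∧ HasCompactSupport Φ ∧
      (∀ x, (∀ z ∈ S, δ < ‖z - x‖) → Φ x = 0) ∧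
      weightedSq μ W (Φ - f) ≤ ENNReal.ofReal ε ∧
      ∀ i, weightedSq μ V ((fun p => fderiv ℝ Φ p (e i)) - D i) ≤ ENNReal.ofReal ε := by
  have hW0 : ∀ p, 0 < W p := fun p => (hV0 p).trans_le (hVW p)
  -- Truncation and mollification are each allowed `ε/4`; the inequality `(a+b)² ≤ 2a² + 2b²` turns
  -- this into `ε`.
  obtain ⟨χ, hχ, hχc, hχf, hχD⟩ := exists_cutoff_approx (μ := μ) (e := e) hW hV
    (fun p => (hV0 p).le) hVW hf hD hfW hDV (ε := ENNReal.ofReal (ε / 4))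
    (ENNReal.ofReal_pos.2 (by positivity))
  have lf := locallyIntegrable_of_weightedSq hW hW0 hf hfW
  have lD := fun i => locallyIntegrable_of_weightedSq hV hV0 (hD i) (hDV i)
  set g : X → ℝ := fun p => χ p * f p with hg
  set D' : ι → X → ℝ := fun i p => χ p * D i p + fderiv ℝ χ p (e i) * f p with hD'
  have hder' : ∀ i, IsWeakDeriv μ g (D' i) (e i) := fun i => (hder i).smooth_mul lf (lD i) hχ
  have hχm := hχ.continuous.measurable
  have hχ' : ∀ v, Measurable fun p => fderiv ℝ χ p v := fun v =>
    ((hχ.continuous_fderiv (by simp)).clm_apply continuous_const).measurable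
  have hgm : Measurable g := hχm.mul hf
  have hDm : ∀ i, Measurable (D' i) := fun i => (hχm.mul (hD i)).add ((hχ' _).mul hf)
  have hgc : HasCompactSupport g := hχc.mul_right
  have hDc : ∀ i, HasCompactSupport (D' i) := fun i =>
    HasCompactSupport.add hχc.mul_right (hχc.fderiv_apply (𝕜 := ℝ) (e i)).mul_right
  have mem : ∀ {h U : X → ℝ}, Measurable h → Continuous U → (∀ p, 0 < U p) →
      weightedSq μ U h ≠ ⊤ → HasCompactSupport h → MemLp h 2 μ := by
    intro h U hh hU hU0 hfin hc
    have h1 := memLp_restrict_of_weightedSq hU hU0 hh hfin hc.isCompact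
    rw [← memLp_indicator_iff_restrict hc.isCompact.measurableSet] at h1
    rwa [Set.indicator_eq_self.2 (subset_tsupport h)] at h1
  have fin : ∀ {h k U : X → ℝ}, Measurable h → Measurable k → Continuous U → (∀ p, 0 < U p) →
      weightedSq μ U k ≠ ⊤ → weightedSq μ U (fun p => h p - k p) ≤ ENNReal.ofReal (ε / 4) →
      weightedSq μ U h ≠ ⊤ := by
    intro h k U hh hk hU hU0 h1 h2
    have h3 := weightedSq_add_le (μ := μ) (fun p => (hU0 p).le) hU.measurable hk (g := h - k)
    rw [add_sub_cancel] at h3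
    exact ne_top_of_le_ne_top (ENNReal.add_ne_top.2 ⟨ENNReal.mul_ne_top (by simp) h1,
      ENNReal.mul_ne_top (by simp) (ne_top_of_le_ne_top ENNReal.ofReal_ne_top h2)⟩) h3
  have g2 := mem hgm hW hW0 (fin hgm hf hW hW0 hfW hχf) hgc
  have D2 := fun i => mem (hDm i) hV hV0 (fin (hDm i) (hD i) hV hV0 (hDV i) (hχD i)) (hDc i)
  have ev1 := eventually_weightedSq_mollify_le (μ := μ) hW hgm g2 hgc
    (show 0 < ε / 4 by positivity)
  have ev2 := eventually_all.2 fun i =>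
    eventually_weightedSq_mollify_le (μ := μ) hV (hDm i) (D2 i) (hDc i)
      (show 0 < ε / 4 by positivity)
  -- The scale is small for `f` and for all its derivatives at once, and below `δ`, which confines
  -- the support near `S`.
  obtain ⟨r, h1, h2, hr0, hrδ⟩ := (ev1.and (ev2.and (Ioo_mem_nhdsGT hδ))).exists
  let b : ContDiffBump (0 : X) := ⟨r / 2, r, half_pos hr0, half_lt_self hr0⟩
  have lg : LocallyIntegrable g μ := g2.locallyIntegrable one_le_two
  have sum_le : ∀ {h k l U : X → ℝ}, Measurable h → Measurable k → Continuous U →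
      (∀ p, 0 < U p) → weightedSq μ U (l - h) ≤ ENNReal.ofReal (ε / 4) →
      weightedSq μ U (fun p => h p - k p) ≤ ENNReal.ofReal (ε / 4) →
      weightedSq μ U (l - k) ≤ ENNReal.ofReal ε := by
    intro h k l U hh hk hU hU0 h1 h2
    have h3 := weightedSq_add_le (μ := μ) (fun p => (hU0 p).le) hU.measurable (hh.sub hk)
      (g := l - h)
    have e1 : h - k + (l - h) = l - k := by abel
    rw [e1] at h3
    refine h3.trans ((add_le_add (mul_le_mul_right h2 2) (mul_le_mul_right h1 2)).trans
      (le_of_eq ?_))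
    rw [show (2 : ℝ≥0∞) = ENNReal.ofReal 2 by simp, ← ENNReal.ofReal_mul zero_le_two,
      ← ENNReal.ofReal_add (by positivity) (by positivity)]
    congr 1
    ring
  refine ⟨mollify μ b g, contDiff_mollify lg, ?_, ?_, ?_, ?_⟩
  · rw [mollify_eq]
    exact b.hasCompactSupport_normed.convolution _ hgc
  · intro x hx
    refine mollify_eq_zero fun z hz => ?_
    have hz' : ‖z - x‖ ≤ r := hz
    have : z ∉ S := fun hzS => by
      have := hx z hzS
      linarith
    simp [hg, hfS z this]
  · exact sum_le hgm hf hW hW0 (h1 b rfl) hχf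
  · intro i
    have e1 : (fun p => fderiv ℝ (mollify μ b g) p (e i)) = mollify μ b (D' i) :=
      funext fun p => fderiv_mollify (hder' i) lg p
    rw [e1]
    exact sum_le (hDm i) (hD i) hV hV0 (h2 i b rfl) (hχD i)

end SmoothApproximation

end

end Kinetic


namespace Kinetic

noncomputable section

/-! ### Jointly measurable versions of continuous paths -/

section JointVersion

open Filter Topology ENNReal

variable {Y : Type*} [MeasurableSpace Y] {ν : Measure Y}

theorem lintegral_sq_eq_norm_sq (f : Lp ℝ 2 ν) :
    ∫⁻ x, ENNReal.ofReal (f x ^ 2) ∂ν = ENNReal.ofReal (‖f‖ ^ 2) := by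
  rw [norm_sq_eq_integral, ofReal_integral_eq_lintegral_ofReal (Lp.memLp f).integrable_sq
    (.of_forall fun x => sq_nonneg _)]

theorem lintegral_sub_sq_eq (f g : Lp ℝ 2 ν) :
    ∫⁻ x, ENNReal.ofReal ((f x - g x) ^ 2) ∂ν = ENNReal.ofReal (‖f - g‖ ^ 2) := by
  rw [← lintegral_sq_eq_norm_sq]
  refine lintegral_congr_ae ?_
  filter_upwards [Lp.coeFn_sub f g] with x hx
  rw [hx, Pi.sub_apply]

/-- A continuous path in `L²` has a jointly measurable version. -/
theorem exists_measurable_version {V : ℝ → Lp ℝ 2 ν} (hV : Continuous V) (a b : ℝ) :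
    ∃ u : ℝ × Y → ℝ, Measurable u ∧ ∀ t ∈ Set.Icc a b, ∀ᵐ x ∂ν, u (t, x) = V t x := by
  -- Rounding times down may leave `[a,b]`, by at most one; hence the left end `a - 1`.
  have huc := (isCompact_Icc (a := a - 1) (b := b)).uniformContinuousOn_of_continuous
    hV.continuousOn
  rw [Metric.uniformContinuousOn_iff] at huc
  have hN : ∀ n : ℕ, ∃ N : ℕ, 0 < N ∧ ∀ s ∈ Set.Icc (a - 1) b, ∀ t ∈ Set.Icc (a - 1) b,
      dist s t ≤ (N : ℝ)⁻¹ → ‖V s - V t‖ ≤ (1 / 2) ^ n := by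
    intro n
    obtain ⟨δ, hδ, h⟩ := huc ((1 / 2) ^ n) (by positivity)
    obtain ⟨N, hN⟩ := exists_nat_gt δ⁻¹
    have hN0 : (0 : ℝ) < N := (inv_pos.2 hδ).trans hN
    refine ⟨N, by exact_mod_cast hN0, fun s hs t ht hst => ?_⟩
    rw [← dist_eq_norm]
    refine (h s hs t ht (hst.trans_lt ?_)).le
    exact inv_lt_of_inv_lt₀ hδ hN
  choose N hN0 hN using hN
  -- Times are rounded down to a grid of mesh `1 / N n`. The sampled path takes countably many
  -- values, so it is jointly measurable.
  set σ : ℕ → ℝ → ℝ := fun n t => ⌊t * N n⌋ / (N n : ℝ) with hσ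
  set w : ℕ → ℝ × Y → ℝ := fun n p => V (σ n p.1) p.2 with hw
  have hwm : ∀ n, Measurable (w n) := by
    intro n
    have h1 : Measurable fun q : ℤ × Y => V ((q.1 : ℝ) / (N n : ℝ)) q.2 :=
      measurable_from_prod_countable_right fun k =>
        (Lp.stronglyMeasurable (V ((k : ℝ) / (N n : ℝ)))).measurable
    have h2 : Measurable fun p : ℝ × Y => (⌊p.1 * N n⌋, p.2) :=
      (Int.measurable_floor.comp (measurable_fst.mul_const _)).prodMk measurable_snd
    exact h1.comp h2
  -- The upper limit is measurable without any knowledge of where the samples converge.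
  refine ⟨fun p => limsup (fun n => w n p) atTop, Measurable.limsup hwm, fun t ht => ?_⟩
  have hbound : ∀ n, ∫⁻ x, ENNReal.ofReal ((w n (t, x) - V t x) ^ 2) ∂ν ≤
      ENNReal.ofReal ((1 / 4) ^ n) := by
    intro n
    have hNn : (0 : ℝ) < N n := by exact_mod_cast hN0 n
    have hN1 : (1 : ℝ) ≤ N n := by exact_mod_cast hN0 n
    have e1 : σ n t ≤ t := by
      rw [hσ, div_le_iff₀ hNn]
      exact Int.floor_le _
    have e2 : t - (N n : ℝ)⁻¹ ≤ σ n t := by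
      rw [hσ, le_div_iff₀ hNn, sub_mul, inv_mul_cancel₀ hNn.ne']
      exact (Int.sub_one_lt_floor _).le
    have e3 : (N n : ℝ)⁻¹ ≤ 1 := inv_le_one_of_one_le₀ hN1
    have h := hN n (σ n t) ⟨by linarith [ht.1], e1.trans ht.2⟩ t ⟨by linarith [ht.1], ht.2⟩
      (by rw [Real.dist_eq, abs_le]; constructor <;> linarith [inv_pos.2 hNn])
    simp only [hw]
    rw [lintegral_sub_sq_eq]
    refine ENNReal.ofReal_le_ofReal ((pow_le_pow_left₀ (norm_nonneg _) h 2).trans (le_of_eq ?_))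
    rw [← pow_mul, mul_comm, pow_mul]
    norm_num
  -- The squared errors at a fixed time are summable in `n`, so the samples converge almost
  -- everywhere without extracting a subsequence that would depend on the time.
  have hsum : ∑' n, ∫⁻ x, ENNReal.ofReal ((w n (t, x) - V t x) ^ 2) ∂ν ≠ ⊤ := by
    refine ne_top_of_le_ne_top ?_ (ENNReal.tsum_le_tsum hbound)
    rw [← ENNReal.ofReal_tsum_of_nonneg (fun n => by positivity)
      (summable_geometric_of_lt_one (by norm_num) (by norm_num))]
    exact ENNReal.ofReal_ne_top
  have hm : ∀ n, Measurable fun x => ENNReal.ofReal ((w n (t, x) - V t x) ^ 2) := fun n =>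
    ((((hwm n).comp (measurable_const.prodMk measurable_id)).sub
      (Lp.stronglyMeasurable (V t)).measurable).pow_const 2).ennreal_ofReal
  rw [← lintegral_tsum fun n => (hm n).aemeasurable] at hsum
  filter_upwards [ae_lt_top (Measurable.tsum hm) hsum] with x hx
  have h1 := ENNReal.tendsto_atTop_zero_of_tsum_ne_top hx.ne
  have h2 := (ENNReal.tendsto_toReal ENNReal.zero_ne_top).comp h1
  simp only [Function.comp_def, ENNReal.toReal_ofReal (sq_nonneg _), ENNReal.toReal_zero] at h2
  have h3 : Tendsto (fun n => w n (t, x) - V t x) atTop (𝓝 0) := by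
    have := h2.sqrt
    simp only [Real.sqrt_sq_eq_abs, Real.sqrt_zero] at this
    exact (tendsto_zero_iff_abs_tendsto_zero _).2 this
  have h4 : Tendsto (fun n => w n (t, x)) atTop (𝓝 (V t x)) := by
    simpa using h3.add_const (V t x)
  exact h4.limsup_eq

end JointVersion

/-! ### Interpolation between a degenerate norm and a moment -/

section Interpolation

open ENNReal

variable {α : Type*} [MeasurableSpace α] {m : Measure α}

theorem sq_integral_mul_le {a b : α → ℝ} (ha : MemLp a 2 m) (hb : MemLp b 2 m) :
    (∫ x, a x * b x ∂m) ^ 2 ≤ (∫ x, a x ^ 2 ∂m) * ∫ x, b x ^ 2 ∂m := by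
  have h := abs_real_inner_le_norm ha.toLp hb.toLp
  have e1 : inner ℝ ha.toLp hb.toLp = ∫ x, a x * b x ∂m := by
    rw [L2.inner_def]
    refine integral_congr_ae ?_
    filter_upwards [ha.coeFn_toLp, hb.coeFn_toLp] with x h1 h2
    rw [h1, h2, RCLike.inner_apply, conj_trivial, mul_comm]
  have e2 : ∀ {c : α → ℝ} (hc : MemLp c 2 m), ‖hc.toLp‖ ^ 2 = ∫ x, c x ^ 2 ∂m := by
    intro c hc
    rw [norm_sq_eq_integral]
    refine integral_congr_ae ?_
    filter_upwards [hc.coeFn_toLp] with x h1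
    rw [h1]
  rw [← e1, ← e2 ha, ← e2 hb, ← mul_pow, ← sq_abs]
  gcongr

/-- A function of mean zero is controlled by its distance to the constants in a weaker norm and
by a moment. -/
theorem interpolation [IsFiniteMeasure m] {u ω : α → ℝ} {k ℓ c B : ℝ} (hℓ : 0 < ℓ) (hk : ℓ < k)
    (hum : Measurable u) (hωm : Measurable ω) (hω : ∀ x, 1 ≤ ω x) (hu : MemLp u 2 m)
    (hmean : ∫ x, u x ∂m = 0) (hB : 0 ≤ B)
    (hmom : ∫⁻ x, ENNReal.ofReal (u x ^ 2 * ω x ^ k) ∂m ≤ ENNReal.ofReal B) :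
    (∫ x, u x ^ 2 ∂m) ^ (1 + ℓ / k) ≤
      (∫ x, (u x - c) ^ 2 * ω x ^ (-ℓ) ∂m) * B ^ (ℓ / k) := by
  have hk0 : 0 < k := hℓ.trans hk
  have hω0 : ∀ x, 0 < ω x := fun x => one_pos.trans_le (hω x)
  set θ := ℓ / k with hθ
  have hθ0 : 0 < θ := div_pos hℓ hk0
  have hθ1 : θ < 1 := (div_lt_one hk0).2 hk
  set X := ∫ x, u x ^ 2 ∂m with hX
  set Z := ∫ x, (u x - c) ^ 2 * ω x ^ (-ℓ) ∂m with hZ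
  have hX0 : 0 ≤ X := integral_nonneg fun x => sq_nonneg _
  have hZ0 : 0 ≤ Z := integral_nonneg fun x =>
    mul_nonneg (sq_nonneg _) (Real.rpow_nonneg (hω0 x).le _)
  have hXe : ∫⁻ x, ENNReal.ofReal (u x ^ 2) ∂m = ENNReal.ofReal X :=
    (ofReal_integral_eq_lintegral_ofReal hu.integrable_sq (.of_forall fun x => sq_nonneg _)).symm
  -- the intermediate moment
  have hmid : ∫⁻ x, ENNReal.ofReal (u x ^ 2 * ω x ^ ℓ) ∂m ≤
      ENNReal.ofReal (X ^ (1 - θ) * B ^ θ) := by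
    -- The exponent `ℓ = θ k` lies between `0` and `k`, so Hölder interpolates the moment of order
    -- `ℓ` between `∫ u²` and the moment of order `k`.
    have e : ∀ x, ENNReal.ofReal (u x ^ 2 * ω x ^ ℓ) =
        ENNReal.ofReal (u x ^ 2) ^ (1 - θ) * ENNReal.ofReal (u x ^ 2 * ω x ^ k) ^ θ := by
      intro x
      have h1 : 0 ≤ ω x ^ k := Real.rpow_nonneg (hω0 x).le _
      rw [ENNReal.ofReal_rpow_of_nonneg (sq_nonneg _) (by linarith),
        ENNReal.ofReal_rpow_of_nonneg (mul_nonneg (sq_nonneg _) h1) hθ0.le,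
        ← ENNReal.ofReal_mul (Real.rpow_nonneg (sq_nonneg _) _)]
      congr 1
      rw [Real.mul_rpow (sq_nonneg _) h1, ← Real.rpow_mul (hω0 x).le, ← mul_assoc,
        ← Real.rpow_add_of_nonneg (sq_nonneg _) (by linarith) hθ0.le,
        show k * θ = ℓ by rw [hθ]; field_simp]
      simp
    simp only [e]
    refine (ENNReal.lintegral_mul_norm_pow_le (by fun_prop) (by fun_prop) (by linarith) hθ0.le
      (by ring)).trans ?_
    rw [hXe, ENNReal.ofReal_mul (Real.rpow_nonneg hX0 _),
      ← ENNReal.ofReal_rpow_of_nonneg hX0 (by linarith),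
      ← ENNReal.ofReal_rpow_of_nonneg hB hθ0.le]
    gcongr
  have ha : MemLp (fun x => (u x - c) * ω x ^ (-ℓ / 2)) 2 m := by
    have h1 : MemLp (fun x => u x - c) 2 m := hu.sub (memLp_const c)
    refine h1.mono (by fun_prop) (.of_forall fun x => ?_)
    rw [norm_mul]
    refine mul_le_of_le_one_right (norm_nonneg _) ?_
    rw [Real.norm_of_nonneg (Real.rpow_nonneg (hω0 x).le _)]
    exact Real.rpow_le_one_of_one_le_of_nonpos (hω x) (by linarith)
  have hsqb : ∀ x, (u x * ω x ^ (ℓ / 2)) ^ 2 = u x ^ 2 * ω x ^ ℓ := fun x => by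
    rw [mul_pow, ← Real.rpow_natCast (ω x ^ (ℓ / 2)), ← Real.rpow_mul (hω0 x).le]
    simp
  have hsqa : ∀ x, ((u x - c) * ω x ^ (-ℓ / 2)) ^ 2 = (u x - c) ^ 2 * ω x ^ (-ℓ) := fun x => by
    rw [mul_pow, ← Real.rpow_natCast (ω x ^ (-ℓ / 2)), ← Real.rpow_mul (hω0 x).le]
    simp
  have hb : MemLp (fun x => u x * ω x ^ (ℓ / 2)) 2 m := by
    rw [memLp_two_iff_weightedSq (by fun_prop), weightedSq]
    simp only [hsqb, mul_one]
    exact ne_top_of_le_ne_top ENNReal.ofReal_ne_top hmid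
  have hmidr : ∫ x, u x ^ 2 * ω x ^ ℓ ∂m ≤ X ^ (1 - θ) * B ^ θ := by
    rw [← ENNReal.ofReal_le_ofReal_iff (by positivity), ofReal_integral_eq_lintegral_ofReal
      (by simpa only [hsqb] using hb.integrable_sq)
      (.of_forall fun x => mul_nonneg (sq_nonneg _) (Real.rpow_nonneg (hω0 x).le _))]
    exact hmid
  have hcs := sq_integral_mul_le ha hb
  simp only [hsqa, hsqb] at hcs
  -- The two weights cancel, and the mean zero condition removes `c`: the left-hand side is `∫ (u -
  -- c) u = ∫ u²`.
  have e : ∫ x, (u x - c) * ω x ^ (-ℓ / 2) * (u x * ω x ^ (ℓ / 2)) ∂m = X := by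
    have e1 : ∀ x, (u x - c) * ω x ^ (-ℓ / 2) * (u x * ω x ^ (ℓ / 2)) = u x ^ 2 - c * u x := by
      intro x
      have : ω x ^ (-ℓ / 2) * ω x ^ (ℓ / 2) = 1 := by
        rw [← Real.rpow_add (hω0 x)]
        simp [neg_div]
      linear_combination (u x - c) * u x * this
    simp only [e1]
    rw [integral_sub hu.integrable_sq ((hu.integrable one_le_two).const_mul c),
      integral_const_mul, hmean, mul_zero, sub_zero]
  rw [e] at hcs
  have h2 : X ^ 2 ≤ Z * (X ^ (1 - θ) * B ^ θ) :=
    hcs.trans (mul_le_mul_of_nonneg_left hmidr hZ0)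
  -- The inequality `X² ≤ Z X^(1-θ) B^θ` is divided by `X^(1-θ)`, which requires `X > 0`.
  rcases hX0.eq_or_lt with h0 | h0
  · rw [← h0, Real.zero_rpow (by linarith)]
    positivity
  · have h3 : X ^ 2 = X ^ (1 + θ) * X ^ (1 - θ) := by
      rw [← Real.rpow_add h0, ← Real.rpow_natCast]
      norm_num
    rw [h3] at h2
    refine le_of_mul_le_mul_right (h2.trans (le_of_eq ?_)) (Real.rpow_pos_of_pos h0 (1 - θ))
    ring

end Interpolation

end

end Kinetic


namespace Kinetic

noncomputable section

/-! ### Integration over time windows -/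

section Window

open ENNReal

variable {d : ℕ} {c : Collision} {G : E d → E d → E d} {M fSt : E d → E d → ℝ} {cInf cM : ℝ}

/-- The measure `dt ⟨fSt⟩ dx` on `[a,b] × ℝ^d`. -/
def windowMeasure (fSt : E d → E d → ℝ) (a b : ℝ) : Measure (ℝ × E d) :=
  (volume.restrict (Set.Icc a b)).prod (spaceMeasure fSt)

theorem isFiniteMeasure_window (hS : StationaryState c G M fSt cInf cM) (a b : ℝ) :
    IsFiniteMeasure (windowMeasure fSt a b) := by
  have := hS.isProbabilityMeasure_space
  unfold windowMeasure
  infer_instance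

theorem windowMeasure_eq (hS : StationaryState c G M fSt cInf cM) (a b : ℝ) :
    windowMeasure fSt a b = (volume.restrict (Set.Icc a b ×ˢ Set.univ)).withDensity
      fun p => ENNReal.ofReal (density fSt p.2) := by
  rw [windowMeasure, spaceMeasure, prod_withDensity_right hS.measurable_density.ennreal_ofReal,
    Measure.volume_eq_prod, ← Measure.prod_restrict, Measure.restrict_univ]

theorem lintegral_window (hS : StationaryState c G M fSt cInf cM) (a b : ℝ)
    {F : ℝ × E d → ℝ≥0∞} (hF : Measurable F) : ∫⁻ p, F p ∂(windowMeasure fSt a b) =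
      ∫⁻ p in Set.Icc a b ×ˢ Set.univ, ENNReal.ofReal (density fSt p.2) * F p := by
  have h : Measurable fun p : ℝ × E d => density fSt p.2 :=
    hS.measurable_density.comp measurable_snd
  rw [windowMeasure_eq hS, lintegral_withDensity_eq_lintegral_mul _ h.ennreal_ofReal hF]
  rfl

theorem integral_window (hS : StationaryState c G M fSt cInf cM) (a b : ℝ) (F : ℝ × E d → ℝ) :
    ∫ p, F p ∂(windowMeasure fSt a b) =
      ∫ p in Set.Icc a b ×ˢ Set.univ, density fSt p.2 * F p := by
  have h : Measurable fun p : ℝ × E d => density fSt p.2 :=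
    hS.measurable_density.comp measurable_snd
  rw [windowMeasure_eq hS, integral_withDensity_ofReal h fun p => hS.density_pos p.2]

theorem windowMeasure_restrict {a b a' b' : ℝ} (ha : a' ≤ a) (hb : b ≤ b')
    (hS : StationaryState c G M fSt cInf cM) :
    (windowMeasure fSt a' b').restrict (Set.Icc a b ×ˢ Set.univ) = windowMeasure fSt a b := by
  have := hS.isProbabilityMeasure_space
  rw [windowMeasure, ← Measure.prod_restrict, Measure.restrict_univ,
    Measure.restrict_restrict_of_subset (Set.Icc_subset_Icc ha hb), windowMeasure]

theorem windowMeasure_univ_pos (hS : StationaryState c G M fSt cInf cM) {a b : ℝ} (h : a < b) :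
    0 < windowMeasure fSt a b Set.univ := by
  have := hS.isProbabilityMeasure_space
  rw [windowMeasure, ← Set.univ_prod_univ, Measure.prod_prod]
  simpa using h

theorem lintegral_window_slices (hS : StationaryState c G M fSt cInf cM) {a b : ℝ}
    {F : ℝ × E d → ℝ≥0∞} (hF : Measurable F) : ∫⁻ p, F p ∂(windowMeasure fSt a b) =
      ∫⁻ s in Set.Icc a b, ∫⁻ x, F (s, x) ∂(spaceMeasure fSt) := by
  have := hS.isProbabilityMeasure_space
  rw [windowMeasure, lintegral_prod _ hF.aemeasurable]

variable {V : ℝ → SL2 fSt} {u : ℝ × E d → ℝ} {a b : ℝ}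

theorem lintegral_window_sq (hS : StationaryState c G M fSt cInf cM) (hV : Continuous V)
    (hu : Measurable u) (huV : ∀ s ∈ Set.Icc a b, ∀ᵐ x ∂(spaceMeasure fSt), u (s, x) = V s x) :
    ∫⁻ p, ENNReal.ofReal (u p ^ 2) ∂(windowMeasure fSt a b) =
      ENNReal.ofReal (∫ s in Set.Icc a b, ‖V s‖ ^ 2) := by
  have hc : Continuous fun s => ‖V s‖ ^ 2 := hV.norm.pow 2
  rw [lintegral_window_slices hS (hu.pow_const 2).ennreal_ofReal,
    ofReal_integral_eq_lintegral_ofReal (hc.continuousOn.integrableOn_compact isCompact_Icc)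
    (.of_forall fun s => sq_nonneg _)]
  refine setLIntegral_congr_fun measurableSet_Icc fun s hs => ?_
  rw [← lintegral_sq_eq_norm_sq]
  refine lintegral_congr_ae ?_
  filter_upwards [huV s hs] with x hx
  rw [hx]

theorem memLp_window (hS : StationaryState c G M fSt cInf cM) (hV : Continuous V)
    (hu : Measurable u) (huV : ∀ s ∈ Set.Icc a b, ∀ᵐ x ∂(spaceMeasure fSt), u (s, x) = V s x) :
    MemLp u 2 (windowMeasure fSt a b) := by
  rw [memLp_two_iff_weightedSq hu, weightedSq]
  simp only [mul_one]
  rw [lintegral_window_sq hS hV hu huV]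
  exact ENNReal.ofReal_ne_top

theorem integral_window_sq (hS : StationaryState c G M fSt cInf cM) (hV : Continuous V)
    (hu : Measurable u) (huV : ∀ s ∈ Set.Icc a b, ∀ᵐ x ∂(spaceMeasure fSt), u (s, x) = V s x) :
    ∫ p, u p ^ 2 ∂(windowMeasure fSt a b) = ∫ s in Set.Icc a b, ‖V s‖ ^ 2 := by
  have h := lintegral_window_sq hS hV hu huV
  rw [← ofReal_integral_eq_lintegral_ofReal (memLp_window hS hV hu huV).integrable_sq
    (.of_forall fun p => sq_nonneg _)] at h
  rwa [ENNReal.ofReal_eq_ofReal_iff (integral_nonneg fun p => sq_nonneg _)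
    (integral_nonneg fun p => sq_nonneg _)] at h

end Window

/-! ### Regularisation of the divergence fields -/

section SmoothFields

open ENNReal

variable {d : ℕ} {c : Collision} {G : E d → E d → E d} {M fSt : E d → E d → ℝ} {cInf cM : ℝ}

/-- The weight of a field in the spatial coercivity estimate. -/
def fieldWeight (G : E d → E d → E d) (fSt : E d → E d → ℝ) (p : ℝ × E d) : ℝ :=
  weight G fSt p.2 / density fSt p.2

/-- The weight of the derivatives of a field in the spatial coercivity estimate. -/
def gradWeight (fSt : E d → E d → ℝ) (p : ℝ × E d) : ℝ := (density fSt p.2)⁻¹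

theorem continuous_gradWeight (hS : StationaryState c G M fSt cInf cM) :
    Continuous (gradWeight fSt) :=
  (hS.density_regular.continuous.comp continuous_snd).inv₀ fun p => (hS.density_pos p.2).ne'

theorem continuous_fieldWeight (hS : StationaryState c G M fSt cInf cM) (hm : Model c G M) :
    Continuous (fieldWeight G fSt) :=
  ((continuous_weight hS hm).comp continuous_snd).div
    (hS.density_regular.continuous.comp continuous_snd) fun p => (hS.density_pos p.2).ne'

theorem gradWeight_pos (hS : StationaryState c G M fSt cInf cM) (p : ℝ × E d) :
    0 < gradWeight fSt p := inv_pos.2 (hS.density_pos p.2)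

theorem gradWeight_le_fieldWeight (hS : StationaryState c G M fSt cInf cM) (p : ℝ × E d) :
    gradWeight fSt p ≤ fieldWeight G fSt p := by
  rw [gradWeight, fieldWeight, inv_eq_one_div]
  exact div_le_div_of_nonneg_right (weight_ge hS p.2).2.2 (hS.density_pos p.2).le

theorem lintegral_fieldEnergy_eq (hS : StationaryState c G M fSt cInf cM) (hm : Model c G M)
    {F : Fin (d + 1) → ℝ × E d → ℝ} {D : Fin (d + 1) → Fin (d + 1) → ℝ × E d → ℝ}
    (hF : ∀ i, Measurable (F i)) (hD : ∀ i j, Measurable (D i j)) :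
    ∫⁻ p, ENNReal.ofReal (((∑ i, F i p ^ 2) * weight G fSt p.2 + ∑ i, ∑ j, D i j p ^ 2) /
      density fSt p.2) = (∑ i, weightedSq volume (fieldWeight G fSt) (F i)) +
        ∑ i, ∑ j, weightedSq volume (gradWeight fSt) (D i j) := by
  have hW := (continuous_fieldWeight hS hm).measurable
  have hV := (continuous_gradWeight hS).measurable
  have hW0 : ∀ p, 0 ≤ fieldWeight G fSt p := fun p =>
    (gradWeight_pos hS p).le.trans (gradWeight_le_fieldWeight hS p)
  have hV0 : ∀ p, 0 ≤ gradWeight fSt p := fun p => (gradWeight_pos hS p).le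
  have m1 : ∀ i, Measurable fun p => ENNReal.ofReal (F i p ^ 2 * fieldWeight G fSt p) :=
    fun i => (((hF i).pow_const 2).mul hW).ennreal_ofReal
  have m2 : ∀ i j, Measurable fun p => ENNReal.ofReal (D i j p ^ 2 * gradWeight fSt p) :=
    fun i j => (((hD i j).pow_const 2).mul hV).ennreal_ofReal
  unfold weightedSq
  simp only [← lintegral_finsetSum _ fun j _ => m2 _ j]
  rw [← lintegral_finsetSum _ fun i _ => m1 i,
    ← lintegral_finsetSum _ fun i _ => Finset.measurable_fun_sum _ fun j _ => m2 i j,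
    ← lintegral_add_left (Finset.measurable_fun_sum _ fun i _ => m1 i)]
  refine lintegral_congr fun p => ?_
  have n1 : ∀ i, 0 ≤ F i p ^ 2 * fieldWeight G fSt p := fun i => mul_nonneg (sq_nonneg _) (hW0 p)
  have n2 : ∀ i j, 0 ≤ D i j p ^ 2 * gradWeight fSt p := fun i j =>
    mul_nonneg (sq_nonneg _) (hV0 p)
  simp only [← ENNReal.ofReal_sum_of_nonneg fun j _ => n2 _ j]
  rw [← ENNReal.ofReal_sum_of_nonneg fun i _ => n1 i,
    ← ENNReal.ofReal_sum_of_nonneg fun i _ => Finset.sum_nonneg fun j _ => n2 i j,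
    ← ENNReal.ofReal_add (Finset.sum_nonneg fun i _ => n1 i)
      (Finset.sum_nonneg fun i _ => Finset.sum_nonneg fun j _ => n2 i j)]
  congr 1
  simp only [← Finset.sum_mul, fieldWeight, gradWeight]
  ring

theorem weightedSq_sum_le {α : Type*} [MeasurableSpace α] {μ : Measure α} {n : ℕ} {W : α → ℝ}
    (hW : ∀ p, 0 ≤ W p) (hWm : Measurable W) {g : Fin n → α → ℝ} (hg : ∀ i, Measurable (g i)) :
    weightedSq μ W (fun p => ∑ i, g i p) ≤ n * ∑ i, weightedSq μ W (g i) := by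
  have m : ∀ i, Measurable fun p => ENNReal.ofReal (g i p ^ 2 * W p) := fun i =>
    (((hg i).pow_const 2).mul hWm).ennreal_ofReal
  unfold weightedSq
  rw [← lintegral_finsetSum _ fun i _ => m i, ← lintegral_const_mul' _ _ (by simp)]
  refine lintegral_mono fun p => ?_
  rw [← ENNReal.ofReal_sum_of_nonneg fun i _ => mul_nonneg (sq_nonneg _) (hW p),
    ← ENNReal.ofReal_natCast, ← ENNReal.ofReal_mul (by positivity)]
  refine ENNReal.ofReal_le_ofReal ?_
  have h := sq_sum_le_card_mul_sum_sq (s := Finset.univ) (f := fun i => g i p)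
  simp only [Finset.card_univ, Fintype.card_fin] at h
  rw [← Finset.sum_mul, ← mul_assoc]
  exact mul_le_mul_of_nonneg_right h (hW p)

/-- Approximation of the fields of the spatial coercivity estimate by regular ones. -/
theorem exists_smooth_field (hS : StationaryState c G M fSt cInf cM) (hm : Model c G M)
    {T R : ℝ} (hT : 0 < T) (hR : 0 ≤ R) {F : Fin (d + 1) → ℝ × E d → ℝ}
    {DF : Fin (d + 1) → Fin (d + 1) → ℝ × E d → ℝ} (hF : ∀ i, Measurable (F i))
    (hDF : ∀ i j, Measurable (DF i j)) (hw : HasWeakGradientZeroTrace T F DF)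
    (hb : ∫⁻ p in slab d T, ENNReal.ofReal
      (((∑ i, F i p ^ 2) * weight G fSt p.2 + ∑ i, ∑ j, DF i j p ^ 2) / density fSt p.2)
        ≤ ENNReal.ofReal R) {ε : ℝ} (hε : 0 < ε) :
    ∃ Φ : ℝ × E d → E1 d, ContDiff ℝ 1 Φ ∧ HasCompactSupport Φ ∧
      (∀ x, Φ (-T, x) = 0) ∧ (∀ x, Φ (2 * T, x) = 0) ∧
      ∫ p, fieldEnergy G fSt Φ p ≤ 2 * R + 2 * ((d + 1) * (d + 2)) * ε ∧
      weightedSq volume (gradWeight fSt) (fun p => (∑ i, (fderiv ℝ Φ p (direction i)) i) -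
        (slab d T).indicator (fun p => ∑ i, DF i i p) p) ≤ ENNReal.ofReal ((d + 1) ^ 2 * ε) := by
  have hWc := continuous_fieldWeight hS hm
  have hVc := continuous_gradWeight hS
  have hV0 := gradWeight_pos hS
  have hVW := gradWeight_le_fieldWeight hS
  have hslab : MeasurableSet (slab d T) := measurableSet_Icc.prod MeasurableSet.univ
  set F' : Fin (d + 1) → ℝ × E d → ℝ := fun i => (slab d T).indicator (F i) with hF'
  set D' : Fin (d + 1) → Fin (d + 1) → ℝ × E d → ℝ := fun i j => (slab d T).indicator (DF i j)
    with hD'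
  have hFm : ∀ i, Measurable (F' i) := fun i => (hF i).indicator hslab
  have hDm : ∀ i j, Measurable (D' i j) := fun i j => (hDF i j).indicator hslab
  have htot : (∑ i, weightedSq volume (fieldWeight G fSt) (F' i)) +
      ∑ i, ∑ j, weightedSq volume (gradWeight fSt) (D' i j) ≤ ENNReal.ofReal R := by
    rw [← lintegral_fieldEnergy_eq hS hm hFm hDm]
    refine le_trans (le_of_eq ?_) hb
    rw [← lintegral_indicator hslab]
    refine lintegral_congr fun p => ?_
    by_cases hp : p ∈ slab d T <;> simp [hF', hD', hp]
  have hfin1 : ∀ i, weightedSq volume (fieldWeight G fSt) (F' i) ≠ ⊤ := fun i =>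
    ne_top_of_le_ne_top ENNReal.ofReal_ne_top (((Finset.single_le_sum
      (f := fun i => weightedSq volume (fieldWeight G fSt) (F' i)) (fun i _ => zero_le)
      (Finset.mem_univ i)).trans le_self_add).trans htot)
  have hfin2 : ∀ i j, weightedSq volume (gradWeight fSt) (D' i j) ≠ ⊤ := fun i j =>
    ne_top_of_le_ne_top ENNReal.ofReal_ne_top ((((Finset.single_le_sum
      (f := fun j => weightedSq volume (gradWeight fSt) (D' i j)) (fun i _ => zero_le)
      (Finset.mem_univ j)).trans (Finset.single_le_sum
      (f := fun i => ∑ j, weightedSq volume (gradWeight fSt) (D' i j)) (fun i _ => zero_le)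
      (Finset.mem_univ i))).trans le_add_self).trans htot)
  -- The test functions in `HasWeakGradientZeroTrace` need not vanish at `0` and `T`, so the
  -- extensions by zero have the extended derivatives as weak derivatives on the whole space.
  have hweak : ∀ i j, IsWeakDeriv volume (F' i) (D' i j) (direction j) := by
    intro i j φ hφ hφc
    have h := hw i j φ hφ hφc
    rw [← integral_indicator hslab, ← integral_indicator hslab] at h
    simpa only [Set.indicator_mul_left, hF', hD'] using h
  have : (volume : Measure (ℝ × E d)).IsAddHaarMeasure := by
    rw [Measure.volume_eq_prod]
    infer_instance
  -- With `δ = T/2` the smooth fields vanish at the times `-T` and `2T`, which are at distance at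
  -- least `T` from the slab.
  have happ := fun i => exists_smooth_approx (e := direction) (δ := T / 2) hWc hVc hV0 hVW (hFm i)
    (hDm i) (hfin1 i) (hfin2 i) (hweak i) (S := slab d T)
    (fun p hp => Set.indicator_of_notMem hp _) hε (half_pos hT)
  choose Ψ hΨ hΨc hΨ0 hΨ1 hΨ2 using happ
  set Φ : ℝ × E d → E1 d := fun p => WithLp.toLp 2 fun i => Ψ i p with hΦdef
  have hΦ : ContDiff ℝ 1 Φ := contDiff_euclidean.2 fun i => (hΨ i).of_le (by simp)
  have hΦc : HasCompactSupport Φ := by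
    refine HasCompactSupport.intro (K := ⋃ i, tsupport (Ψ i))
      (isCompact_iUnion fun i => (hΨc i).isCompact) fun p hp => ?_
    simp only [Set.mem_iUnion, not_exists] at hp
    ext i
    show Ψ i p = 0
    exact image_eq_zero_of_notMem_tsupport (hp i)
  have hcoord : ∀ p e i, (fderiv ℝ Φ p e) i = fderiv ℝ (Ψ i) p e := fun p e i =>
    (fderiv_coord hΦ i p e).symm
  have hvan : ∀ s : ℝ, (∀ t ∈ Set.Icc 0 T, T / 2 < |t - s|) → ∀ x, Φ (s, x) = 0 := by
    intro s hs x
    ext i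
    refine hΨ0 i (s, x) fun z hz => ?_
    refine (hs z.1 hz.1).trans_le ?_
    exact norm_fst_le (z - (s, x))
  have hΨm : ∀ i, Measurable (Ψ i) := fun i => (hΨ i).continuous.measurable
  have hdm : ∀ i j, Measurable fun p => fderiv ℝ (Ψ i) p (direction j) := fun i j =>
    (((hΨ i).continuous_fderiv (by simp)).clm_apply continuous_const).measurable
  refine ⟨Φ, hΦ, hΦc, hvan _ fun t ht => ?_, hvan _ fun t ht => ?_, ?_, ?_⟩
  · rw [lt_abs]
    left
    linarith [ht.1]
  · rw [lt_abs]
    right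
    linarith [ht.2]
  · have e1 : ∀ p, fieldEnergy G fSt Φ p = ((∑ i, Ψ i p ^ 2) * weight G fSt p.2 +
        ∑ i, ∑ j, fderiv ℝ (Ψ i) p (direction j) ^ 2) / density fSt p.2 := by
      intro p
      rw [fieldEnergy, Finset.sum_comm]
      simp only [EuclideanSpace.real_norm_sq_eq, hcoord]
      rw [add_comm]
    have h0 : ∀ p, 0 ≤ fieldEnergy G fSt Φ p := fun p => by
      refine div_nonneg (add_nonneg (Finset.sum_nonneg fun i _ => sq_nonneg _)
        (mul_nonneg (sq_nonneg _) ?_)) (hS.density_pos _).le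
      exact zero_le_one.trans (weight_ge hS p.2).2.2
    have hsub : ∀ {h k U : ℝ × E d → ℝ}, Measurable k → Continuous U → (∀ p, 0 < U p) →
        weightedSq volume U (h - k) ≤ ENNReal.ofReal ε →
        weightedSq volume U h ≤ 2 * weightedSq volume U k + 2 * ENNReal.ofReal ε := by
      intro h k U hk hU hU0 h2
      have h3 := weightedSq_add_le (μ := volume) (fun p => (hU0 p).le) hU.measurable hk
        (g := h - k)
      rw [add_sub_cancel] at h3
      exact h3.trans (by gcongr)
    have h2 : ∫⁻ p, ENNReal.ofReal (fieldEnergy G fSt Φ p) ≤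
        ENNReal.ofReal (2 * R + 2 * ((d + 1) * (d + 2)) * ε) := by
      simp only [e1]
      rw [lintegral_fieldEnergy_eq hS hm hΨm hdm]
      -- There are `d + 1` components and `(d + 1)²` derivatives, each with error `2ε`; hence the
      -- factor `2 (d + 1) (d + 2)`.
      calc _ ≤ (∑ i, (2 * weightedSq volume (fieldWeight G fSt) (F' i) + 2 * ENNReal.ofReal ε)) +
            ∑ i, ∑ j, (2 * weightedSq volume (gradWeight fSt) (D' i j) +
              2 * ENNReal.ofReal ε) := by
            gcongr with i _ i _ j _
            · exact hsub (hFm i) hWc (fun p => (hV0 p).trans_le (hVW p)) (hΨ1 i)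
            · exact hsub (hDm i j) hVc hV0 (hΨ2 i j)
        _ = 2 * ((∑ i, weightedSq volume (fieldWeight G fSt) (F' i)) +
              ∑ i, ∑ j, weightedSq volume (gradWeight fSt) (D' i j)) +
              ((d + 1 : ℕ) * (2 * ENNReal.ofReal ε) +
                (d + 1 : ℕ) * ((d + 1 : ℕ) * (2 * ENNReal.ofReal ε))) := by
            simp only [Finset.sum_add_distrib, ← Finset.mul_sum, Finset.sum_const,
              Finset.card_univ, Fintype.card_fin, nsmul_eq_mul]
            ring
        _ ≤ 2 * ENNReal.ofReal R + ((d + 1 : ℕ) * (2 * ENNReal.ofReal ε) +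
                (d + 1 : ℕ) * ((d + 1 : ℕ) * (2 * ENNReal.ofReal ε))) := by gcongr
        _ = _ := by
            have h2 : (2 : ℝ≥0∞) = ENNReal.ofReal 2 := by simp
            rw [h2, ← ENNReal.ofReal_natCast, ← ENNReal.ofReal_mul zero_le_two,
              ← ENNReal.ofReal_mul zero_le_two, ← ENNReal.ofReal_mul (by positivity),
              ← ENNReal.ofReal_mul (by positivity), ← ENNReal.ofReal_add (by positivity)
                (by positivity), ← ENNReal.ofReal_add (by positivity) (by positivity)]
            congr 1
            push_cast
            ring
    rw [← ofReal_integral_eq_lintegral_ofReal (integrable_fieldEnergy hS hm hΦ hΦc)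
      (.of_forall h0)] at h2
    exact (ENNReal.ofReal_le_ofReal_iff (by positivity)).1 h2
  · have e2 : (fun p => (∑ i, (fderiv ℝ Φ p (direction i)) i) -
        (slab d T).indicator (fun p => ∑ i, DF i i p) p) =
        fun p => ∑ i, ((fun p => fderiv ℝ (Ψ i) p (direction i)) - D' i i) p := by
      funext p
      by_cases hp : p ∈ slab d T <;>
        simp [hD', hp, hcoord, Finset.sum_sub_distrib]
    rw [e2]
    refine (weightedSq_sum_le (fun p => (hV0 p).le) hVc.measurable
      fun i => (hdm i i).sub (hDm i i)).trans ?_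
    -- One factor `d + 1` is from Cauchy-Schwarz for the trace, the other counts its terms.
    calc _ ≤ ((d + 1 : ℕ) : ℝ≥0∞) * ∑ _i : Fin (d + 1), ENNReal.ofReal ε := by
          gcongr with i
          exact hΨ2 i i
      _ = _ := by
          rw [Finset.sum_const, Finset.card_univ, Fintype.card_fin, nsmul_eq_mul,
            ← ENNReal.ofReal_natCast, ← ENNReal.ofReal_mul (by positivity),
            ← ENNReal.ofReal_mul (by positivity)]
          congr 1
          push_cast
          ring

end SmoothFields

end

end Kinetic


namespace Kinetic

noncomputable section

/-! ### Control of the spatial density by the dissipation -/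

section Deviation

open ENNReal

/-- `exists_divergence_estimate` on a time window that starts before `t0`. -/
theorem exists_divergence_estimate_window (d : ℕ) {cInf : ℝ} (hcInf : 0 < cInf) (cM : ℝ) :
    ∃ K : ℝ, 0 < K ∧ ∀ (c : Collision) (G : E d → E d → E d) (M fSt : E d → E d → ℝ)
      (hS : StationaryState c G M fSt cInf cM), Model c G M → ∀ f : ℝ → WL2 fSt,
      IsPath c G M fSt f → ∀ Φ : ℝ × E d → E1 d, ContDiff ℝ 1 Φ → HasCompactSupport Φ →
      ∀ t0 α β : ℝ, 0 ≤ t0 + α → α ≤ β → (∀ x, Φ (α, x) = 0) → (∀ x, Φ (β, x) = 0) →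
      ∀ ε : ℝ, 0 < ε →
      ∫ s in α..β, ∫ x, hS.localDensity (f (t0 + s)) x *
          ∑ i, (fderiv ℝ Φ (s, x) (direction i)) i ≤
        ε * (∫ s in α..β, ‖hS.micro (f (t0 + s))‖ ^ 2) +
          ε⁻¹ * K * ∫ s in α..β, ∫ x, fieldEnergy G fSt Φ (s, x) := by
  obtain ⟨K, hK, h⟩ := exists_divergence_estimate d hcInf cM
  refine ⟨K, hK, fun c G M fSt hS hm f hf Φ hΦ hΦc t0 α β hα hαβ h0 h1 ε hε => ?_⟩
  -- The field is translated in time to the window around `t0`; the weights do not depend on time.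
  set Ψ : ℝ × E d → E1 d := fun q => Φ (q - (t0, 0)) with hΨ
  have hΨs : ContDiff ℝ 1 Ψ := hΦ.comp (contDiff_id.sub contDiff_const)
  have hΨc : HasCompactSupport Ψ := hΦc.comp_homeomorph (Homeomorph.subRight (t0, (0 : E d)))
  have e1 : ∀ (s : ℝ) (x : E d), ((t0 + s, x) - (t0, 0) : ℝ × E d) = (s, x) := fun s x => by
    simp
  have hval : ∀ s x, Ψ (t0 + s, x) = Φ (s, x) := fun s x => by rw [hΨ]; simp only [e1]
  have hder : ∀ s x, fderiv ℝ Ψ (t0 + s, x) = fderiv ℝ Φ (s, x) := fun s x => by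
    rw [hΨ, fderiv_comp_sub, e1]
  have key := h c G M fSt hS hm f hf Ψ hΨs hΨc (t0 + α) (t0 + β) hα (by linarith)
    (fun x => by rw [hval, h0]) (fun x => by rw [hval, h1]) ε hε
  rw [← intervalIntegral.integral_comp_add_left, ← intervalIntegral.integral_comp_add_left,
    ← intervalIntegral.integral_comp_add_left] at key
  simpa only [fieldEnergy, hval, hder] using key

theorem exists_mean_value {α : Type*} [MeasurableSpace α] {m : Measure α} [IsFiniteMeasure m]
    (hm : 0 < m Set.univ) {u ω : α → ℝ} (hu : MemLp u 2 m) (hω : ∀ x, 0 < ω x)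
    (hω1 : ∀ x, ω x ≤ 1) (hωm : Measurable ω) : ∃ c : ℝ, ∫ x, (u x - c) * ω x ∂m = 0 := by
  have hb : ∀ᵐ x ∂m, ‖ω x‖ ≤ 1 := .of_forall fun x => by
    rw [Real.norm_of_nonneg (hω x).le]
    exact hω1 x
  have i1 : Integrable (fun x => u x * ω x) m :=
    (hu.integrable one_le_two).mul_bdd hωm.aestronglyMeasurable hb
  have i2 : Integrable ω m := (memLp_top_of_bound hωm.aestronglyMeasurable 1 hb).integrable le_top
  have hpos : 0 < ∫ x, ω x ∂m := by
    rw [integral_pos_iff_support_of_nonneg (fun x => (hω x).le) i2]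
    have : Function.support ω = Set.univ := by
      ext x
      simpa using (hω x).ne'
    rwa [this]
  refine ⟨(∫ x, u x * ω x ∂m) / ∫ x, ω x ∂m, ?_⟩
  simp only [sub_mul]
  rw [integral_sub i1 (i2.const_mul _), integral_const_mul, div_mul_cancel₀ _ hpos.ne', sub_self]

/-- The mean value of a product is controlled by Young's inequality. -/
theorem integral_mul_le_of_close {α : Type*} [MeasurableSpace α] {m : Measure α}
    {u q h : α → ℝ} (hu : MemLp u 2 m) (hq : MemLp q 2 m) (hh : MemLp h 2 m) {η : ℝ}
    (hη : 0 < η) : ∫ x, u x * h x ∂m ≤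
      (∫ x, u x * q x ∂m) + η * (∫ x, u x ^ 2 ∂m) + η⁻¹ * ∫ x, (q x - h x) ^ 2 ∂m := by
  have i1 : Integrable (fun x => u x * h x) m := hu.integrable_mul hh
  have i2 : Integrable (fun x => u x * q x) m := hu.integrable_mul hq
  have i3 : Integrable (fun x => u x ^ 2) m := hu.integrable_sq
  have i4 : Integrable (fun x => (q x - h x) ^ 2) m := (hq.sub hh).integrable_sq
  have i5 : Integrable (fun x => u x * q x + η * u x ^ 2) m := i2.add (i3.const_mul _)
  rw [← integral_const_mul, ← integral_const_mul, ← integral_add i2 (i3.const_mul _),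
    ← integral_add i5 (i4.const_mul _)]
  refine integral_mono i1 (i5.add (i4.const_mul _)) fun x => ?_
  have e : u x * q x + η * u x ^ 2 + η⁻¹ * (q x - h x) ^ 2 - u x * h x =
      3 / 4 * (η * u x ^ 2) + η⁻¹ * ((q x - h x) + η * u x / 2) ^ 2 := by
    field_simp
    ring
  have : 0 ≤ 3 / 4 * (η * u x ^ 2) + η⁻¹ * ((q x - h x) + η * u x / 2) ^ 2 := by positivity
  simp only
  linarith

variable {d : ℕ} {c : Collision} {G : E d → E d → E d} {M fSt : E d → E d → ℝ} {cInf cM : ℝ}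

/-- The weight `(1 + |x|²)^{-ℓ}`. -/
def decayWeight (ℓ : ℝ) (p : ℝ × E d) : ℝ := (1 + ‖p.2‖ ^ 2) ^ (-ℓ)

theorem decayWeight_pos (ℓ : ℝ) (p : ℝ × E d) : 0 < decayWeight ℓ p :=
  Real.rpow_pos_of_pos (by positivity) _

theorem decayWeight_le_one {ℓ : ℝ} (hℓ : 0 < ℓ) (p : ℝ × E d) : decayWeight ℓ p ≤ 1 :=
  Real.rpow_le_one_of_one_le_of_nonpos (by linarith [sq_nonneg ‖p.2‖]) (by linarith)

theorem measurable_decayWeight (ℓ : ℝ) : Measurable (decayWeight (d := d) ℓ) := by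
  unfold decayWeight
  fun_prop

/-- This makes the squared norm of the source `⟨fSt⟩ (u - b) (1+|x|²)^(-ℓ)` in the coercivity
hypothesis equal to the quantity to be estimated. -/
theorem decayWeight_sq_mul (ℓ : ℝ) (p : ℝ × E d) :
    decayWeight ℓ p ^ 2 * (1 + ‖p.2‖ ^ 2) ^ ℓ = decayWeight ℓ p := by
  have h : decayWeight ℓ p * (1 + ‖p.2‖ ^ 2) ^ ℓ = 1 := by
    rw [decayWeight, ← Real.rpow_add (by positivity)]
    simp
  rw [sq, mul_assoc, h, mul_one]

theorem memLp_mul_decayWeight {m : Measure (ℝ × E d)} {g : ℝ × E d → ℝ} (hg : MemLp g 2 m)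
    {ℓ : ℝ} (hℓ : 0 < ℓ) : MemLp (fun p => g p * decayWeight ℓ p) 2 m := by
  refine hg.mono (hg.1.mul (measurable_decayWeight ℓ).aestronglyMeasurable)
    (.of_forall fun p => ?_)
  rw [norm_mul, Real.norm_of_nonneg (decayWeight_pos ℓ p).le]
  exact mul_le_of_le_one_right (norm_nonneg _) (decayWeight_le_one hℓ p)

/-- The divergence of a regular field tested against the spatial density. -/
theorem integral_localDensity_divergence (hS : StationaryState c G M fSt cInf cM)
    {V : ℝ → SL2 fSt} (hV : Continuous V) {u : ℝ × E d → ℝ} (hu : Measurable u) {α β : ℝ}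
    (hαβ : α ≤ β)
    (huV : ∀ s ∈ Set.Icc α β, ∀ᵐ x ∂(spaceMeasure fSt), u (s, x) = V s x)
    {D : ℝ × E d → ℝ} (hD : MemLp (fun p => D p / density fSt p.2) 2 (windowMeasure fSt α β)) :
    ∫ s in α..β, ∫ x, V s x * D (s, x) =
      ∫ p, u p * (D p / density fSt p.2) ∂(windowMeasure fSt α β) := by
  have := hS.isProbabilityMeasure_space
  have hi : Integrable (fun p => u p * (D p / density fSt p.2)) (windowMeasure fSt α β) :=
    (memLp_window hS hV hu huV).integrable_mul hD
  rw [windowMeasure] at hi ⊢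
  rw [integral_prod _ hi, intervalIntegral.integral_of_le hαβ, ← integral_Icc_eq_integral_Ioc]
  refine setIntegral_congr_fun measurableSet_Icc fun s hs => ?_
  simp only
  rw [hS.integral_space]
  refine integral_congr_ae ?_
  filter_upwards [hS.ae_space.1 (huV s hs)] with x hx
  have := (hS.density_pos x).ne'
  rw [hx]
  field_simp

theorem memLp_div_density (hS : StationaryState c G M fSt cInf cM) {D : ℝ × E d → ℝ}
    (hD : Continuous D) (hDc : HasCompactSupport D) (α β : ℝ) :
    MemLp (fun p => D p / density fSt p.2) 2 (windowMeasure fSt α β) := by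
  have := isFiniteMeasure_window hS α β
  have hc : Continuous fun p => D p / density fSt p.2 :=
    hD.div (hS.density_regular.continuous.comp continuous_snd) fun p => (hS.density_pos p.2).ne'
  have hcc : HasCompactSupport fun p => D p / density fSt p.2 := by
    refine hDc.mono fun p hp => ?_
    contrapose! hp
    simp [Function.notMem_support.1 hp]
  obtain ⟨C, hC⟩ := hc.bounded_above_of_compact_support hcc
  exact MemLp.of_bound hc.aestronglyMeasurable C (.of_forall hC)

/-- The deviation of the spatial density from a multiple of the stationary one is controlled by
the distance to local equilibria. -/
theorem exists_deviation_estimate (d : ℕ) {cInf lam2 : ℝ} (hcInf : 0 < cInf) (cM : ℝ)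
    (hlam2 : 0 < lam2) :
    ∃ K : ℝ, 0 < K ∧ ∀ (c : Collision) (G : E d → E d → E d) (M fSt : E d → E d → ℝ)
      (hS : StationaryState c G M fSt cInf cM), Model c G M → ∀ (T ℓ : ℝ), 0 < T → 0 < ℓ →
      WeakSpatialCoercivity G fSt T ℓ lam2 → ∀ f : ℝ → WL2 fSt, IsPath c G M fSt f →
      ∀ t0 : ℝ, T ≤ t0 → ∀ u : ℝ × E d → ℝ, Measurable u →
      (∀ s ∈ Set.Icc (-T) (2 * T), ∀ᵐ x ∂(spaceMeasure fSt),
        u (s, x) = hS.localDensity (f (t0 + s)) x) →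
      ∃ b : ℝ, ∫ p, (u p - b) ^ 2 * decayWeight ℓ p ∂(windowMeasure fSt 0 T) ≤
        K * ∫ s in (-T)..(2 * T), ‖hS.micro (f (t0 + s))‖ ^ 2 := by
  obtain ⟨K0, hK0, hdiv⟩ := exists_divergence_estimate_window d hcInf cM
  -- Twice the parameter `ε1 = 4 K0 lam2` used below, because half of `Y` is absorbed on the left.
  refine ⟨8 * (K0 * lam2), by positivity, ?_⟩
  intro c G M fSt hS hm T ℓ hT hℓ hWSC f hf t0 ht0 u hu huV
  have hspace := hS.isProbabilityMeasure_space
  have hfin := isFiniteMeasure_window hS 0 T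
  have hfin' := isFiniteMeasure_window hS (-T) (2 * T)
  have hslab : MeasurableSet (slab d T) := measurableSet_Icc.prod MeasurableSet.univ
  have hVc : Continuous fun s => hS.localDensity (f (t0 + s)) :=
    hS.localDensity.continuous.comp (hf.continuous.comp (by fun_prop))
  set m := windowMeasure fSt 0 T with hmdef
  set m' := windowMeasure fSt (-T) (2 * T) with hm'def
  have hres : m'.restrict (slab d T) = m :=
    windowMeasure_restrict (by linarith) (by linarith) hS
  have hu' : MemLp u 2 m' := memLp_window hS hVc hu huV
  have hum : MemLp u 2 m := by
    rw [← hres]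
    exact hu'.restrict _
  -- The constant `b` is the mean of `u` for the decaying weight, so the source of the divergence
  -- equation has integral zero.
  obtain ⟨b, hb⟩ := exists_mean_value (windowMeasure_univ_pos hS hT) hum (decayWeight_pos ℓ)
    (decayWeight_le_one hℓ) (measurable_decayWeight ℓ)
  refine ⟨b, ?_⟩
  have hρm : Measurable fun p : ℝ × E d => density fSt p.2 :=
    hS.measurable_density.comp measurable_snd
  have hωm := measurable_decayWeight (d := d) ℓ
  have hub : MemLp (fun p => u p - b) 2 m := hum.sub (memLp_const b)
  have hubω := memLp_mul_decayWeight hub hℓ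
  have iY : Integrable (fun p => (u p - b) ^ 2 * decayWeight ℓ p) m := by
    refine (hub.integrable_mul hubω).congr (.of_forall fun p => ?_)
    simp only [Pi.mul_apply]
    ring
  have hY0 : ∀ p, 0 ≤ (u p - b) ^ 2 * decayWeight ℓ p := fun p =>
    mul_nonneg (sq_nonneg _) (decayWeight_pos ℓ p).le
  set Y := ∫ p, (u p - b) ^ 2 * decayWeight ℓ p ∂m with hYdef
  have hYnn : 0 ≤ Y := integral_nonneg hY0
  set D := ∫ s in (-T)..(2 * T), ‖hS.micro (f (t0 + s))‖ ^ 2 with hD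
  -- the source of the divergence equation
  set g : ℝ × E d → ℝ := fun p => density fSt p.2 * ((u p - b) * decayWeight ℓ p) with hg
  have hgm : Measurable g := hρm.mul ((hu.sub_const b).mul hωm)
  have hgY : ∫⁻ p in slab d T, ENNReal.ofReal
      (g p ^ 2 * (1 + ‖p.2‖ ^ 2) ^ ℓ / density fSt p.2) = ENNReal.ofReal Y := by
    have hmY : Measurable fun p => ENNReal.ofReal ((u p - b) ^ 2 * decayWeight ℓ p) :=
      (((hu.sub_const b).pow_const 2).mul hωm).ennreal_ofReal
    rw [hYdef, ofReal_integral_eq_lintegral_ofReal iY (.of_forall hY0), hmdef,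
      lintegral_window hS 0 T hmY]
    refine lintegral_congr fun p => ?_
    have hρ := hS.density_pos p.2
    rw [← ENNReal.ofReal_mul hρ.le]
    congr 1
    have e := decayWeight_sq_mul ℓ p
    rw [hg]
    field_simp
    linear_combination (u p - b) ^ 2 * e
  obtain ⟨F, DF, hF, hDF, hweak, hdivF, hbound⟩ := hWSC g hgm (by rw [hgY]; simp) (by
    have h := integral_window hS 0 T fun p => (u p - b) * decayWeight ℓ p
    rw [hb] at h
    exact h.symm)
  rw [hgY, ← ENNReal.ofReal_mul hlam2.le] at hbound
  set h : ℝ × E d → ℝ := (slab d T).indicator fun p => (u p - b) * decayWeight ℓ p with hh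
  have hh2 : MemLp h 2 m' := by
    rw [hh, memLp_indicator_iff_restrict hslab, hres]
    exact hubω
  have hhm : Measurable h := ((hu.sub_const b).mul hωm).indicator hslab
  -- Replacing `u - b` by `u` in one factor is free because `(u - b) decayWeight` has mean zero.
  have hYh : ∫ p, u p * h p ∂m' = Y := by
    have e1 : ∀ p, u p * h p =
        (slab d T).indicator (fun p => u p * ((u p - b) * decayWeight ℓ p)) p := fun p => by
      by_cases hp : p ∈ slab d T <;> simp [hh, hp]
    simp only [e1]
    rw [integral_indicator hslab, hres]
    have e2 : ∀ p, u p * ((u p - b) * decayWeight ℓ p) =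
        (u p - b) ^ 2 * decayWeight ℓ p + b * ((u p - b) * decayWeight ℓ p) := fun p => by ring
    simp only [e2]
    rw [integral_add iY ((hubω.integrable one_le_two).const_mul b), integral_const_mul, hb]
    simp [hYdef]
  set A := ∫ p, u p ^ 2 ∂m' with hA
  have hA0 : 0 ≤ A := integral_nonneg fun p => sq_nonneg _
  have hD0 : 0 ≤ D := by
    rw [hD, intervalIntegral.integral_of_le (by linarith)]
    exact integral_nonneg fun s => sq_nonneg _
  set ε1 := 4 * (K0 * lam2) with hε1
  have hε1p : 0 < ε1 := by positivity
  set C := ε1⁻¹ * K0 * (2 * ((d + 1) * (d + 2))) + A + (d + 1) ^ 2 with hC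
  have hC0 : 0 ≤ C := by positivity
  -- `η²` is the approximation error of the field, and `η` the parameter in Young's inequality. All
  -- errors are then of order `η`, with a constant `C` that may depend on the solution since `η`
  -- tends to zero.
  have main : ∀ η : ℝ, 0 < η → η ≤ 1 →
      Y ≤ ε1 * D + ε1⁻¹ * K0 * (2 * (lam2 * Y)) + C * η := by
    intro η hη hη1
    obtain ⟨Φ, hΦ, hΦc, hΦ0, hΦ1, hΦE, hΦD⟩ := exists_smooth_field hS hm hT
      (mul_nonneg hlam2.le hYnn) hF hDF hweak hbound (ε := η ^ 2) (by positivity)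
    set Δ : ℝ × E d → ℝ := fun p => ∑ i, (fderiv ℝ Φ p (direction i)) i with hΔ
    have hΔc : Continuous Δ := by
      refine continuous_finsetSum _ fun i _ => ?_
      have h1 : Continuous fun p => fderiv ℝ Φ p (direction i) :=
        (hΦ.continuous_fderiv one_ne_zero).clm_apply continuous_const
      exact (EuclideanSpace.proj (𝕜 := ℝ) i).continuous.comp h1
    have hΔs : HasCompactSupport Δ := by
      refine HasCompactSupport.intro hΦc.isCompact fun p hp => ?_
      simp [hΔ, fderiv_eq_zero_of_notMem_tsupport hp]
    have hq := memLp_div_density hS hΔc hΔs (-T) (2 * T)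
    have hest := hdiv c G M fSt hS hm f hf Φ hΦ hΦc t0 (-T) (2 * T) (by linarith) (by linarith)
      hΦ0 hΦ1 ε1 hε1p
    have e1 := integral_localDensity_divergence hS hVc hu (by linarith) huV hq
    rw [e1] at hest
    have hEn : ∫ s in (-T)..(2 * T), ∫ x, fieldEnergy G fSt Φ (s, x) ≤
        2 * (lam2 * Y) + 2 * ((d + 1) * (d + 2)) * η ^ 2 := by
      refine le_trans ?_ hΦE
      have hi := integrable_fieldEnergy hS hm hΦ hΦc
      rw [Measure.volume_eq_prod] at hi ⊢
      rw [integral_prod _ hi, intervalIntegral.integral_of_le (by linarith)]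
      refine setIntegral_le_integral hi.integral_prod_left (.of_forall fun s => ?_)
      refine integral_nonneg fun x => ?_
      refine div_nonneg (add_nonneg (Finset.sum_nonneg fun i _ => sq_nonneg _)
        (mul_nonneg (sq_nonneg _) ?_)) (hS.density_pos _).le
      exact zero_le_one.trans (weight_ge hS x).2.2
    have hyoung := integral_mul_le_of_close hu' hq hh2 hη
    -- Because `⟨fSt⟩ (Δ/⟨fSt⟩ - h)² = (Δ - ⟨fSt⟩ h)²/⟨fSt⟩`, this is the weighted divergence error
    -- of the smooth field.
    have hclose : ∫ p, (Δ p / density fSt p.2 - h p) ^ 2 ∂m' ≤ (d + 1) ^ 2 * η ^ 2 := by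
      have hi : Integrable (fun p => (Δ p / density fSt p.2 - h p) ^ 2) m' :=
        (hq.sub hh2).integrable_sq
      have hmi : Measurable fun p => ENNReal.ofReal ((Δ p / density fSt p.2 - h p) ^ 2) :=
        ((((hΔc.measurable.div hρm).sub hhm)).pow_const 2).ennreal_ofReal
      rw [← ENNReal.ofReal_le_ofReal_iff (by positivity), ofReal_integral_eq_lintegral_ofReal
        hi (.of_forall fun p => sq_nonneg _), hm'def, lintegral_window hS (-T) (2 * T) hmi]
      refine (setLIntegral_le_lintegral _ _).trans (le_trans (le_of_eq ?_) hΦD)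
      refine lintegral_congr_ae ?_
      have hd := (ae_restrict_iff' hslab).1 hdivF
      filter_upwards [hd] with p hp
      have hρ := hS.density_pos p.2
      rw [← ENNReal.ofReal_mul hρ.le]
      congr 1
      by_cases hps : p ∈ slab d T
      · rw [Set.indicator_of_mem hps, hp hps, gradWeight, hh, Set.indicator_of_mem hps, hg]
        simp only [hΔ]
        field_simp
      · rw [Set.indicator_of_notMem hps, gradWeight, hh, Set.indicator_of_notMem hps]
        simp only [hΔ]
        field_simp
        ring
    have hη2 : η ^ 2 ≤ η := by nlinarith
    have b1 : ε1⁻¹ * K0 * (∫ s in (-T)..(2 * T), ∫ x, fieldEnergy G fSt Φ (s, x)) ≤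
        ε1⁻¹ * K0 * (2 * (lam2 * Y) + 2 * ((d + 1) * (d + 2)) * η) := by
      refine mul_le_mul_of_nonneg_left (hEn.trans ?_) (by positivity)
      gcongr
    have b2 : η⁻¹ * ∫ p, (Δ p / density fSt p.2 - h p) ^ 2 ∂m' ≤ (d + 1) ^ 2 * η := by
      calc _ ≤ η⁻¹ * ((d + 1) ^ 2 * η ^ 2) := by gcongr
        _ = _ := by field_simp
    rw [hYh] at hyoung
    calc Y ≤ (ε1 * D + ε1⁻¹ * K0 * (2 * (lam2 * Y) + 2 * ((d + 1) * (d + 2)) * η)) +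
          η * A + (d + 1) ^ 2 * η := by
          refine hyoung.trans (add_le_add (add_le_add (hest.trans ?_) le_rfl) b2)
          exact add_le_add le_rfl b1
      _ = _ := by rw [hC]; ring
  have hlim : Y ≤ ε1 * D + ε1⁻¹ * K0 * (2 * (lam2 * Y)) := by
    refine le_of_forall_pos_le_add fun δ hδ => ?_
    have hη : 0 < min 1 (δ / (C + 1)) := lt_min one_pos (by positivity)
    refine (main _ hη (min_le_left _ _)).trans (add_le_add le_rfl ?_)
    calc C * min 1 (δ / (C + 1)) ≤ (C + 1) * (δ / (C + 1)) := by
          gcongr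
          · linarith
          · exact min_le_right _ _
      _ = δ := by field_simp
  -- The choice of `ε1` makes the field energy cost exactly half of `Y`.
  have e : ε1⁻¹ * K0 * (2 * (lam2 * Y)) = Y / 2 := by
    rw [hε1]
    field_simp
    ring
  rw [e] at hlim
  rw [hε1] at hlim
  linarith

end Deviation

end

end Kinetic


namespace Kinetic

noncomputable section

/-! ### A discrete nonlinear decay inequality -/

section Recursion

/-- A recursive inequality that forces polynomial decay. -/
theorem le_rpow_of_recursion {e : ℕ → ℝ} {p K A : ℝ} (hp : 1 < p) (hK : 0 < K)
    (h0 : e 0 ≤ A) (hA : (K * 2 ^ (p + 1)) ^ p ≤ A)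
    (hrec : ∀ n, e (n + 1) ^ (1 + p⁻¹) ≤ K * (e n - e (n + 1))) (n : ℕ) :
    e n ≤ A * ((n : ℝ) + 1) ^ (-p) := by
  have hp0 : 0 < p := one_pos.trans hp
  have hB : 0 < K * 2 ^ (p + 1) := by positivity
  have hA0 : 0 < A := (Real.rpow_pos_of_pos hB p).trans_le hA
  have hAθ : K * 2 ^ (p + 1) ≤ A ^ p⁻¹ := by
    calc K * 2 ^ (p + 1) = ((K * 2 ^ (p + 1)) ^ p) ^ p⁻¹ := by
          rw [← Real.rpow_mul hB.le, mul_inv_cancel₀ hp0.ne', Real.rpow_one]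
      _ ≤ A ^ p⁻¹ := Real.rpow_le_rpow (Real.rpow_nonneg hB.le _) hA (inv_nonneg.2 hp0.le)
  induction n with
  | zero => simpa using h0
  | succ n ih =>
    -- If `e (n + 1)` exceeded the claimed bound `q`, the recursion would force a drop of at least
    -- `q^(1 + 1/p) / K`. As `q^(1/p) = A^(1/p) / (r + 1)`, the lower bound on `A` makes this drop
    -- at least `q 2^(p+1) / (r + 1)`.
    by_contra! hlt
    push_cast at hlt
    set r : ℝ := (n : ℝ) + 1 with hr
    have hr1 : 1 ≤ r := by linarith [(Nat.cast_nonneg n : (0 : ℝ) ≤ n)]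
    have hr0 : 0 < r := one_pos.trans_le hr1
    set q := A * (r + 1) ^ (-p) with hq
    have hq0 : 0 < q := by positivity
    have h1 : q ^ (1 + p⁻¹) ≤ K * (e n - e (n + 1)) :=
      (Real.rpow_le_rpow hq0.le hlt.le (by positivity)).trans (hrec n)
    have h2 : q ^ (1 + p⁻¹) = q * (A ^ p⁻¹ * (r + 1)⁻¹) := by
      rw [Real.rpow_add hq0, Real.rpow_one]
      congr 1
      rw [hq, Real.mul_rpow hA0.le (by positivity), ← Real.rpow_mul (by positivity)]
      congr 1
      rw [neg_mul, mul_inv_cancel₀ hp0.ne', Real.rpow_neg_one]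
    have h3 : q * (2 ^ (p + 1) * (r + 1)⁻¹) ≤ e n - e (n + 1) := by
      refine le_of_mul_le_mul_left ?_ hK
      calc K * (q * (2 ^ (p + 1) * (r + 1)⁻¹)) = q * (K * 2 ^ (p + 1) * (r + 1)⁻¹) := by ring
        _ ≤ q * (A ^ p⁻¹ * (r + 1)⁻¹) := by gcongr
        _ ≤ _ := h2 ▸ h1
    -- convexity of the power function
    have h4 : (1 + r⁻¹) ^ p ≤ 1 + 2 ^ p * r⁻¹ := by
      have hx0 : 0 ≤ r⁻¹ := by positivity
      have hx1 : r⁻¹ ≤ 1 := inv_le_one_of_one_le₀ hr1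
      have hc := (convexOn_rpow hp.le).2 (show (1 : ℝ) ∈ Set.Ici 0 by simp)
        (show (2 : ℝ) ∈ Set.Ici 0 by simp) (show 0 ≤ 1 - r⁻¹ by linarith) hx0
        (show 1 - r⁻¹ + r⁻¹ = 1 by ring)
      simp only [smul_eq_mul, Real.one_rpow, mul_one] at hc
      rw [show 1 - r⁻¹ + r⁻¹ * 2 = 1 + r⁻¹ by ring] at hc
      linarith
    have h5 : 2 ^ p * r⁻¹ ≤ 2 ^ (p + 1) * (r + 1)⁻¹ := by
      rw [Real.rpow_add two_pos, Real.rpow_one, mul_assoc]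
      refine mul_le_mul_of_nonneg_left ?_ (by positivity)
      rw [← div_eq_mul_inv, inv_eq_one_div, div_le_div_iff₀ hr0 (by linarith)]
      linarith
    have h6 : A * r ^ (-p) = q * (1 + r⁻¹) ^ p := by
      have e1 : 1 + r⁻¹ = (r + 1) / r := by field_simp
      rw [hq, e1, Real.div_rpow (by linarith) hr0.le, Real.rpow_neg hr0.le,
        Real.rpow_neg (by linarith)]
      have : (r + 1) ^ p ≠ 0 := by positivity
      field_simp
    have h7 : q * (1 + r⁻¹) ^ p ≤ q * (1 + 2 ^ (p + 1) * (r + 1)⁻¹) := by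
      gcongr
      linarith
    have h8 : e n ≤ q * (1 + r⁻¹) ^ p := h6 ▸ ih
    -- Contradiction: `e n` is at most `q (1 + 2^(p+1)/(r+1))` by induction, but exceeds it by the
    -- assumed drop.
    nlinarith

end Recursion

/-! ### The energy recursion over one time window -/

section Decay

open ENNReal

variable {d : ℕ} {c : Collision} {G : E d → E d → E d} {M fSt : E d → E d → ℝ}
  {cInf cM lam1 : ℝ} {f : ℝ → WL2 fSt}

theorem IsPath.norm_sq_le (hf : IsPath c G M fSt f) (hS : StationaryState c G M fSt cInf cM)
    (hm : Model c G M) (hL : LocalCoercivity c M fSt lam1) (hlam1 : 0 < lam1) {s t : ℝ}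
    (hs : 0 ≤ s) (hst : s ≤ t) : ‖f t‖ ^ 2 ≤ ‖f s‖ ^ 2 := by
  have h := hf.energy hS hm hL hlam1 hs hst
  have h2 : 0 ≤ 2 / lam1 * ∫ t in s..t, ‖hS.micro (f t)‖ ^ 2 :=
    mul_nonneg (by positivity) (intervalIntegral.integral_nonneg hst fun s _ => sq_nonneg _)
  linarith

theorem integral_localDensity (hS : StationaryState c G M fSt cInf cM) (g : WL2 fSt) :
    ∫ x, hS.localDensity g x ∂(spaceMeasure fSt) = ∫ p, g p := by
  have := hS.isProbabilityMeasure_space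
  have h1 : MemLp (fun _ : E d => (1 : ℝ)) 2 (spaceMeasure fSt) := memLp_const 1
  have h := hS.inner_localDensity g h1.toLp
  rw [hS.embed_toLp h1, hS.inner_ofMultiplier g (hS.memLp_const 1), L2.inner_def] at h
  simp only [mul_one] at h
  rw [← h]
  refine integral_congr_ae ?_
  filter_upwards [h1.coeFn_toLp] with x hx
  rw [hx]
  simp

theorem spatialMoment_eq (hS : StationaryState c G M fSt cInf cM) (k : ℝ) (g : WL2 fSt) :
    spatialMoment fSt k g =
      ∫⁻ x, ENNReal.ofReal (hS.localDensity g x ^ 2 * (1 + ‖x‖ ^ 2) ^ k) ∂(spaceMeasure fSt) := by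
  have hm : Measurable fun x =>
      ENNReal.ofReal (hS.localDensity g x ^ 2 * (1 + ‖x‖ ^ 2) ^ k) := by
    have := (Lp.stronglyMeasurable (hS.localDensity g)).measurable
    fun_prop
  refine Eq.trans ?_ (lintegral_withDensity_eq_lintegral_mul volume
    hS.measurable_density.ennreal_ofReal hm).symm
  rw [spatialMoment]
  refine lintegral_congr_ae ?_
  filter_upwards [hS.localDensity_ae g] with x hx
  have hρ := hS.density_pos x
  rw [Pi.mul_apply, ← ENNReal.ofReal_mul hρ.le, hx]
  congr 1
  field_simp

theorem rpow_add_le {x y q : ℝ} (hx : 0 ≤ x) (hy : 0 ≤ y) (hq : 0 ≤ q) :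
    (x + y) ^ q ≤ 2 ^ q * (x ^ q + y ^ q) := by
  have h1 : x + y ≤ 2 * max x y := by linarith [le_max_left x y, le_max_right x y]
  have h2 : max x y ^ q ≤ x ^ q + y ^ q := by
    rcases le_total x y with h | h
    · rw [max_eq_right h]
      linarith [Real.rpow_nonneg hx q]
    · rw [max_eq_left h]
      linarith [Real.rpow_nonneg hy q]
  calc (x + y) ^ q ≤ (2 * max x y) ^ q := Real.rpow_le_rpow (by positivity) h1 hq
    _ = 2 ^ q * max x y ^ q := Real.mul_rpow zero_le_two (hx.trans (le_max_left _ _))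
    _ ≤ _ := by gcongr

/-- The loss of energy over a time window controls a power of the energy. -/
theorem exists_energy_recursion (d : ℕ) {cInf lam1 lam2 T k ℓ Ck : ℝ} (hcInf : 0 < cInf)
    (cM N : ℝ) (hlam1 : 0 < lam1) (hlam2 : 0 < lam2) (hT : 0 < T) (hℓ : 0 < ℓ) (hk : ℓ < k)
    (hCk : 0 < Ck) :
    ∃ K : ℝ, 0 < K ∧ ∀ (c : Collision) (G : E d → E d → E d) (M fSt : E d → E d → ℝ),
      StationaryState c G M fSt cInf cM → Model c G M → LocalCoercivity c M fSt lam1 →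
      WeakSpatialCoercivity G fSt T ℓ lam2 → ∀ f : ℝ → WL2 fSt, IsPath c G M fSt f →
      (∀ t : ℝ, 0 ≤ t → spatialMoment fSt k (f t) ≤ ENNReal.ofReal Ck) →
      ∫ p, f 0 p = 0 → ‖f 0‖ = N → ∀ τ : ℝ, 0 ≤ τ →
      (‖f (τ + 3 * T)‖ ^ 2) ^ (1 + ℓ / k) ≤ K * (‖f τ‖ ^ 2 - ‖f (τ + 3 * T)‖ ^ 2) := by
  obtain ⟨K0, hK0, hdev⟩ := exists_deviation_estimate d hcInf cM hlam2
  have hk0 : 0 < k := hℓ.trans hk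
  set θ := ℓ / k with hθ
  have hθ0 : 0 < θ := div_pos hℓ hk0
  -- The power of `T⁻¹` comes from averaging over the window and that of `2` from separating the two
  -- parts of the energy. The two summands belong to the spatial density and to the microscopic
  -- part; the latter brings in the size `N` of the data.
  set P := (T⁻¹) ^ (1 + θ) * (2 ^ (1 + θ) * (K0 * (Ck * T) ^ θ + (lam1 / 2 * N ^ 2) ^ θ)) with hP
  have hP0 : 0 < P := by positivity
  refine ⟨P * (lam1 / 2), by positivity, ?_⟩
  intro c G M fSt hS hm hL hWSC f hf hmom hmass hN τ hτ
  have hspace := hS.isProbabilityMeasure_space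
  have hfin := isFiniteMeasure_window hS 0 T
  -- The enlarged window `[-T, 2T]` around `t0` is then `[τ, τ + 3T]`, which starts at a nonnegative
  -- time.
  set t0 := τ + T with ht0
  have cV : Continuous fun s => hS.localDensity (f (t0 + s)) :=
    hS.localDensity.continuous.comp (hf.continuous.comp (by fun_prop))
  have cm : Continuous fun s => ‖hS.micro (f (t0 + s))‖ ^ 2 :=
    (hS.continuous_micro.comp (hf.continuous.comp (by fun_prop))).norm.pow 2
  obtain ⟨u, hu, huV⟩ := exists_measurable_version cV (-T) (2 * T)
  obtain ⟨b, hb⟩ := hdev c G M fSt hS hm T ℓ hT hℓ hWSC f hf t0 (by linarith) u hu huV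
  set D := ∫ s in (-T)..(2 * T), ‖hS.micro (f (t0 + s))‖ ^ 2 with hD
  have huV' : ∀ s ∈ Set.Icc 0 T, ∀ᵐ x ∂(spaceMeasure fSt),
      u (s, x) = hS.localDensity (f (t0 + s)) x := fun s hs =>
    huV s ⟨by linarith [hs.1], by linarith [hs.2]⟩
  have hum : MemLp u 2 (windowMeasure fSt 0 T) := memLp_window hS cV hu huV'
  have hmean : ∫ p, u p ∂(windowMeasure fSt 0 T) = 0 := by
    have hi := hum.integrable one_le_two
    rw [windowMeasure] at hi ⊢
    rw [integral_prod _ hi]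
    refine (setIntegral_congr_fun measurableSet_Icc fun s hs => ?_).trans
      (integral_zero ℝ ℝ)
    rw [integral_congr_ae (huV' s hs), integral_localDensity hS,
      hf.mass_eq hS hm (by linarith [hs.1]), hmass]
  have hmoment : ∫⁻ p, ENNReal.ofReal (u p ^ 2 * (1 + ‖p.2‖ ^ 2) ^ k) ∂(windowMeasure fSt 0 T) ≤
      ENNReal.ofReal (Ck * T) := by
    have hmeas : Measurable fun p : ℝ × E d =>
        ENNReal.ofReal (u p ^ 2 * (1 + ‖p.2‖ ^ 2) ^ k) := by fun_prop
    rw [lintegral_window_slices hS hmeas]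
    calc _ ≤ ∫⁻ _s in Set.Icc (0 : ℝ) T, ENNReal.ofReal Ck := by
          refine setLIntegral_mono' measurableSet_Icc fun s hs => ?_
          refine le_trans (le_of_eq ?_) (hmom (t0 + s) (by linarith [hs.1]))
          rw [spatialMoment_eq hS]
          refine lintegral_congr_ae ?_
          filter_upwards [huV' s hs] with x hx
          rw [hx]
      _ = ENNReal.ofReal (Ck * T) := by
          rw [setLIntegral_const, Real.volume_Icc, sub_zero, ENNReal.ofReal_mul hCk.le]
  have hint := interpolation (c := b) hℓ hk hu
    (by fun_prop : Measurable fun p : ℝ × E d => 1 + ‖p.2‖ ^ 2)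
    (fun p => by linarith [sq_nonneg ‖p.2‖]) hum hmean (by positivity) hmoment
  rw [integral_window_sq hS cV hu huV', ← hθ] at hint
  set X := ∫ s in Set.Icc 0 T, ‖hS.localDensity (f (t0 + s))‖ ^ 2 with hX
  have hX0 : 0 ≤ X := integral_nonneg fun s => sq_nonneg _
  have hD0 : 0 ≤ D := intervalIntegral.integral_nonneg (by linarith) fun s _ => sq_nonneg _
  have hXD : X ^ (1 + θ) ≤ K0 * D * (Ck * T) ^ θ :=
    hint.trans (mul_le_mul_of_nonneg_right hb (by positivity))
  have hen : D ≤ lam1 / 2 * (‖f τ‖ ^ 2 - ‖f (τ + 3 * T)‖ ^ 2) := by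
    have h := hf.energy hS hm hL hlam1 hτ (by linarith : τ ≤ τ + 3 * T)
    have e : D = ∫ t in τ..(τ + 3 * T), ‖hS.micro (f t)‖ ^ 2 := by
      rw [hD, intervalIntegral.integral_comp_add_left fun t => ‖hS.micro (f t)‖ ^ 2]
      congr 1 <;> rw [ht0] <;> ring
    rw [← e] at h
    have h2 : 2 / lam1 * D ≤ ‖f τ‖ ^ 2 - ‖f (τ + 3 * T)‖ ^ 2 := by linarith
    calc D = lam1 / 2 * (2 / lam1 * D) := by field_simp
      _ ≤ _ := by gcongr
  have hmono : ∀ s t : ℝ, 0 ≤ s → s ≤ t → ‖f t‖ ^ 2 ≤ ‖f s‖ ^ 2 := fun s t =>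
    hf.norm_sq_le hS hm hL hlam1
  -- The total dissipation is bounded by the initial energy, so `D^(1+θ)` can be replaced by a
  -- multiple of `D`.
  have hDN : D ≤ lam1 / 2 * N ^ 2 := by
    refine hen.trans (mul_le_mul_of_nonneg_left ?_ (by positivity))
    have := hmono 0 τ le_rfl hτ
    rw [hN] at this
    linarith [sq_nonneg ‖f (τ + 3 * T)‖]
  -- The energy decreases, so its final value is at most its mean over the middle third, where
  -- Pythagoras splits it.
  have hT1 : T * ‖f (τ + 3 * T)‖ ^ 2 ≤ X + D := by
    have i1 : IntegrableOn (fun s => ‖hS.localDensity (f (t0 + s))‖ ^ 2) (Set.Icc 0 T) := by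
      have cV2 : Continuous fun s => ‖hS.localDensity (f (t0 + s))‖ ^ 2 := cV.norm.pow 2
      exact cV2.continuousOn.integrableOn_compact isCompact_Icc
    have i2 : ∀ a b, IntegrableOn (fun s => ‖hS.micro (f (t0 + s))‖ ^ 2) (Set.Icc a b) :=
      fun a b => cm.continuousOn.integrableOn_compact isCompact_Icc
    have h1 : ∫ s in Set.Icc 0 T, ‖hS.micro (f (t0 + s))‖ ^ 2 ≤ D := by
      rw [hD, intervalIntegral.integral_of_le (by linarith), ← integral_Icc_eq_integral_Ioc]
      exact setIntegral_mono_set (i2 _ _) (.of_forall fun s => sq_nonneg _)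
        (Set.Icc_subset_Icc (by linarith) (by linarith)).eventuallyLE
    calc T * ‖f (τ + 3 * T)‖ ^ 2 = ∫ _s in Set.Icc (0 : ℝ) T, ‖f (τ + 3 * T)‖ ^ 2 := by
          rw [setIntegral_const]
          simp [hT.le]
      _ ≤ ∫ s in Set.Icc 0 T, (‖hS.localDensity (f (t0 + s))‖ ^ 2 +
            ‖hS.micro (f (t0 + s))‖ ^ 2) := by
          refine setIntegral_mono_on (integrableOn_const (by simp)) (i1.add (i2 _ _))
            measurableSet_Icc fun s hs => ?_
          rw [← hS.norm_sq_eq_localDensity_add_micro]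
          exact hmono _ _ (by linarith [hs.1]) (by linarith [hs.2])
      _ = X + ∫ s in Set.Icc 0 T, ‖hS.micro (f (t0 + s))‖ ^ 2 := integral_add i1 (i2 _ _)
      _ ≤ X + D := by gcongr
  have hDθ : D ^ (1 + θ) ≤ D * (lam1 / 2 * N ^ 2) ^ θ := by
    rw [Real.rpow_add_of_nonneg hD0 zero_le_one hθ0.le, Real.rpow_one]
    exact mul_le_mul_of_nonneg_left (Real.rpow_le_rpow hD0 hDN hθ0.le) hD0
  have hXD0 : 0 ≤ X + D := add_nonneg hX0 hD0
  calc (‖f (τ + 3 * T)‖ ^ 2) ^ (1 + θ) ≤ (T⁻¹ * (X + D)) ^ (1 + θ) := by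
        refine Real.rpow_le_rpow (sq_nonneg _) ?_ (by linarith)
        rw [inv_mul_eq_div, le_div_iff₀ hT, mul_comm]
        exact hT1
    _ = T⁻¹ ^ (1 + θ) * (X + D) ^ (1 + θ) := Real.mul_rpow (by positivity) hXD0
    _ ≤ T⁻¹ ^ (1 + θ) * (2 ^ (1 + θ) * (X ^ (1 + θ) + D ^ (1 + θ))) := by
        gcongr
        exact rpow_add_le hX0 hD0 (by linarith)
    _ ≤ T⁻¹ ^ (1 + θ) * (2 ^ (1 + θ) *
          (K0 * D * (Ck * T) ^ θ + D * (lam1 / 2 * N ^ 2) ^ θ)) := by gcongr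
    _ = P * D := by rw [hP]; ring
    _ ≤ P * (lam1 / 2 * (‖f τ‖ ^ 2 - ‖f (τ + 3 * T)‖ ^ 2)) := by gcongr
    _ = _ := by ring

end Decay

end

end Kinetic


namespace Kinetic

noncomputable section

/-! ### Polynomial decay -/

section PolynomialDecay

/-- A monotone function that decays polynomially along an arithmetic progression decays
polynomially. -/
theorem le_rpow_of_antitone {e : ℝ → ℝ} {p A S t : ℝ} (hp : 0 ≤ p) (hA : 0 ≤ A) (hS : 0 < S)
    (hmono : ∀ s t : ℝ, 0 ≤ s → s ≤ t → e t ≤ e s)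
    (h : ∀ n : ℕ, e (n * S) ≤ A * ((n : ℝ) + 1) ^ (-p)) (ht : 0 ≤ t) :
    e t ≤ A * (1 + S) ^ p * (1 + t) ^ (-p) := by
  set n := ⌊t / S⌋₊ with hn
  have h1 : (n : ℝ) * S ≤ t := by
    rw [← le_div_iff₀ hS]
    exact Nat.floor_le (by positivity)
  have h2 : t ≤ (n + 1) * S := by
    rw [← div_le_iff₀ hS]
    exact (Nat.lt_floor_add_one _).le
  have hn0 : (0 : ℝ) ≤ n := Nat.cast_nonneg n
  -- This comparison of `t` with the number of completed steps is where the factor `(1 + S)^p`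
  -- originates.
  have h3 : 1 + t ≤ (1 + S) * (n + 1) := by nlinarith
  calc e t ≤ e (n * S) := hmono _ _ (by positivity) h1
    _ ≤ A * ((n : ℝ) + 1) ^ (-p) := h n
    _ = A * (1 + S) ^ p * ((1 + S) * (n + 1)) ^ (-p) := by
        rw [Real.mul_rpow (by positivity) (by positivity), Real.rpow_neg (by positivity : 0 ≤ 1 + S)]
        field_simp
    _ ≤ A * (1 + S) ^ p * (1 + t) ^ (-p) := by
        refine mul_le_mul_of_nonneg_left ?_ (by positivity)
        exact Real.rpow_le_rpow_of_nonpos (by linarith) h3 (by linarith)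

theorem exists_polynomial_decay (d : ℕ) (c : Collision) {cInf lam1 lam2 T k ℓ Ck : ℝ}
    (hcInf : 0 < cInf) (cM N : ℝ) (hlam1 : 0 < lam1) (hlam2 : 0 < lam2) (hT : 0 < T)
    (hℓ : 0 < ℓ) (hk : ℓ < k) (hCk : 0 < Ck) :
    ∃ C : ℝ, 0 < C ∧ ∀ (G : E d → E d → E d) (M fSt : E d → E d → ℝ),
      Model c G M → StationaryState c G M fSt cInf cM → LocalCoercivity c M fSt lam1 →
      WeakSpatialCoercivity G fSt T ℓ lam2 → ∀ f : ℝ → WL2 fSt, IsPath c G M fSt f →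
      (∀ t : ℝ, 0 ≤ t → spatialMoment fSt k (f t) ≤ ENNReal.ofReal Ck) →
      ∫ p, f 0 p = 0 → ‖f 0‖ = N → ∀ t : ℝ, 0 ≤ t →
      ‖f t‖ ≤ C / (1 + t) ^ (k / (2 * ℓ)) * ‖f 0‖ := by
  obtain ⟨K, hK, hrec⟩ := exists_energy_recursion d hcInf cM N hlam1 hlam2 hT hℓ hk hCk
  set p := k / ℓ with hp
  have hp1 : 1 < p := (one_lt_div hℓ).2 hk
  have hp0 : 0 < p := one_pos.trans hp1
  have hpi : p⁻¹ = ℓ / k := inv_div k ℓ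
  -- The two summands meet the two requirements of the recursion lemma: `A` dominates the initial
  -- energy, and it exceeds the threshold set by `K`.
  set A := N ^ 2 + (K * 2 ^ (p + 1)) ^ p with hA
  have hA0 : 0 < A := by positivity
  have hB0 : 0 < A * (1 + 3 * T) ^ p := by positivity
  -- For `N ≤ 0` the data vanish, and the solution stays zero by monotonicity; any positive constant
  -- will do.
  rcases le_or_gt N 0 with hN0 | hN0
  · refine ⟨1, one_pos, ?_⟩
    intro G M fSt hm hS hL _ f hf _ _ hN t ht
    have h0 : ‖f 0‖ = 0 := le_antisymm (hN.trans_le hN0) (norm_nonneg _)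
    have h := hf.norm_sq_le hS hm hL hlam1 le_rfl ht
    rw [h0] at h ⊢
    rw [mul_zero]
    nlinarith
  -- Division by `N = ‖f 0‖` puts the estimate in the form proportional to the data; the inequality
  -- is nonlinear, so the constant keeps depending on `N`.
  · refine ⟨√(A * (1 + 3 * T) ^ p) / N, by positivity, ?_⟩
    intro G M fSt hm hS hL hWSC f hf hmom hmass hN t ht
    have hr := hrec c G M fSt hS hm hL hWSC f hf hmom hmass hN
    have hmono : ∀ s t : ℝ, 0 ≤ s → s ≤ t → ‖f t‖ ^ 2 ≤ ‖f s‖ ^ 2 := fun s t =>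
      hf.norm_sq_le hS hm hL hlam1
    have hseq : ∀ n : ℕ, ‖f (n * (3 * T))‖ ^ 2 ≤ A * ((n : ℝ) + 1) ^ (-p) := by
      refine le_rpow_of_recursion (e := fun n : ℕ => ‖f (n * (3 * T))‖ ^ 2) hp1 hK
        ?_ (by rw [hA]; linarith [sq_nonneg N]) fun n => ?_
      · have : 0 ≤ (K * 2 ^ (p + 1)) ^ p := by positivity
        simp only [Nat.cast_zero, zero_mul, hN]
        linarith
      · have e1 : ((n + 1 : ℕ) : ℝ) * (3 * T) = n * (3 * T) + 3 * T := by
          push_cast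
          ring
        rw [hpi]
        simp only [e1]
        exact hr _ (by positivity)
    have h := le_rpow_of_antitone (e := fun t => ‖f t‖ ^ 2) hp0.le hA0.le
      (by positivity : 0 < 3 * T) hmono hseq ht
    have ht1 : 0 < 1 + t := by linarith
    have e2 : ((1 + t) ^ (k / (2 * ℓ))) ^ 2 = (1 + t) ^ p := by
      rw [← Real.rpow_natCast, ← Real.rpow_mul ht1.le]
      congr 1
      rw [hp]
      push_cast
      field_simp
    rw [hN]
    refine le_of_sq_le_sq ?_ (by positivity)
    rw [show √(A * (1 + 3 * T) ^ p) / N / (1 + t) ^ (k / (2 * ℓ)) * N =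
      √(A * (1 + 3 * T) ^ p) / (1 + t) ^ (k / (2 * ℓ)) by field_simp, div_pow,
      Real.sq_sqrt hB0.le, e2, div_eq_mul_inv, ← Real.rpow_neg ht1.le]
    exact h

end PolynomialDecay

end

end Kinetic

theorem theorem2 (d : ℕ) (hd : 0 < d) (c : Kinetic.Collision)
    (cInf cM lam1 lam2 T k ℓ Ck N : ℝ)
    (hcInf : 0 < cInf) (hlam1 : 0 < lam1) (hlam2 : 0 < lam2) (hT : 0 < T)
    (hℓ : 0 < ℓ) (hk : ℓ < k) (hCk : 0 < Ck) :
    ∃ C : ℝ, 0 < C ∧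
      ∀ (G : Kinetic.E d → Kinetic.E d → Kinetic.E d)
        (M fSt : Kinetic.E d → Kinetic.E d → ℝ),
        Kinetic.Model c G M →
        Kinetic.StationaryState c G M fSt cInf cM →
        Kinetic.LocalCoercivity c M fSt lam1 →
        Kinetic.WeakSpatialCoercivity G fSt T ℓ lam2 →
        ∀ f : ℝ → Kinetic.WL2 fSt,
          Kinetic.IsSolution c G M fSt f →
          (∀ t : ℝ, 0 ≤ t → Kinetic.spatialMoment fSt k (f t) ≤ ENNReal.ofReal Ck) →
          ∫ p, f 0 p = 0 →
          ‖f 0‖ = N →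
          ∀ t : ℝ, 0 ≤ t → ‖f t‖ ≤ C / (1 + t) ^ (k / (2 * ℓ)) * ‖f 0‖ := by
  obtain ⟨C, hC, h⟩ := Kinetic.exists_polynomial_decay d c hcInf cM N hlam1 hlam2 hT hℓ hk hCk
  refine ⟨C, hC, ?_⟩
  intro G M fSt hm hS hL hWSC f hf hmom hmass hN t ht
  -- The estimate is applied to the extension frozen at negative times, which agrees with `f`
  -- wherever the hypotheses and the conclusion look.
  have h' := h G M fSt hm hS hL hWSC _ (hf.isPath hm)
    (fun s hs => by simpa only [max_eq_left hs] using hmom s hs)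
    (by simpa only [max_self] using hmass) (by simpa only [max_self] using hN) t ht
  simpa only [max_eq_left ht, max_self] using h'
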